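/- **Setting.** There are $n$ bidders with independent values $v_i\in[0,1]$, $v_i\sim D_i$; write $D=D_1\times\dots\times D_n$. Let $\mathcal X\subseteq\mathbb R_{\ge 0}^n$ be an arbitrary set of feasible allocations. An auction maps a value profile $v\in[0,1]^n$ to an allocation $x(v)\in\mathcal X$ and prices $p(v)\in\mathbb R_{\ge0}^n$. It is *truthful* if bidding one's value always gives nonnegative utility $v_ix_i-p_i$ and is a dominant strategy. Let $M(D)$ be the expected revenue $\mathbb E_{v\sim D}\sum_i p_i(v)$ of an auction $M$, and $\mathrm{Opt}(D)$ the supremum of $M(D)$ over (measurable) truthful auctions. Let $k=\max_{x\in\mathcal X}\|x\|_1$ be the rank and $d=\max_{x\in\mathcal X}\max_i x_i$ the maximum demand. For a distribution with CDF $F$ let $q_F(v)=1-F(v)$, $v_F(q)=\inf\{v\ge 0: q_F(v)\le q\}$ and $R_F(q)=q\,v_F(q)$. Let $\bar R_F(q)$ be the supremum of $\mathbb E_{t\sim P}R_F(t)$ over distributions $P$ on $[0,1]$ with mean $q$, and let the ironed virtual value $\bar\varphi_F(v)$ be the right derivative of $\bar R_F$ at $q_F(v)$. Myerson's optimal auction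 with respect to $F_1\times\dots\times F_n$ chooses an allocation $x(v)\in\mathcal X$ that maximizes $\sum_i x_i\,\bar\varphi_{F_i}(v_i)$, ties being broken as a function of the profile of ironed virtual values, and charges $p_i(v)=v_ix_i(v)-\int_0^{v_i}x_i(t,v_{-i})\,dt$. Given $N$ i.i.d. samples from $D$ and $0<\delta<1$, let $E_i$ be the empirical CDF of bidder $i$'s samples. The dominated product empirical distribution $\tilde E=\tilde E_1\times\dots\times\tilde E_n$ has CDFs, for $v\ge0$, $$\tilde E_i(v)=\min\Big\{1,\;E_i(v)+\sqrt{\tfrac{2E_i(v)(1-E_i(v))\ln\frac{2nN}{\delta}}{N}}+\tfrac{4\ln\frac{2nN}{\delta}}{N}\Big\}.$$ **Theorem.** For every $\rho>1$ there is a constant $C>0$, depending only on $\rho$, such that the following holds for every $n$, every $\mathcal X$ with rank $k$ and maximum demand $d$, every product distribution $D$ on $[0,1]^n$, every $\varepsilon>0$ with $nk/\varepsilon\ge\rho$, and every $0<\delta<1$. If $$N\;\ge\;C\cdot\frac{nk^2}{\varepsilon^2}\,\log\frac{nk}{\varepsilon}\,\log\frac{nk}{\varepsilon\delta},$$ then with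 probability at least $1-\delta$ over the $N$ samples, Myerson's optimal auction $M_{\tilde E}$ with respect to $\tilde E$ (with any such tie-breaking) satisfies $M_{\tilde E}(D)\ge\mathrm{Opt}(D)-\varepsilon$. In particular, the bound does not depend on $d$. -/

import Mathlib

open MeasureTheory
open scoped BigOperators

noncomputable section

/-- A (direct-revelation) single-parameter auction with `n` bidders: an allocation rule and a
payment rule, both functions of the bid profile. -/
structure Auction (n : ℕ) where
  alloc : (Fin n → ℝ) → Fin n → ℝ
  pay : (Fin n → ℝ) → Fin n → ℝ

/-- The value profiles: every bidder has a value in `[0, 1]`. -/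
def valueProfiles (n : ℕ) : Set (Fin n → ℝ) := {v | ∀ i, v i ∈ Set.Icc (0 : ℝ) 1}

/-- Truthful auctions with set of feasible allocations `X`: allocations are feasible, prices are
nonnegative, no bidder ever has negative utility when bidding truthfully, and no bidder can ever
gain by misreporting, whatever the other bidders do. -/
structure Auction.IsTruthful {n : ℕ} (M : Auction n) (X : Set (Fin n → ℝ)) : Prop where
  measurable_alloc : Measurable M.alloc
  measurable_pay : Measurable M.pay
  feasible : ∀ v ∈ valueProfiles n, M.alloc v ∈ X
  pay_nonneg : ∀ v ∈ valueProfiles n, ∀ i, 0 ≤ M.pay v i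
  individually_rational : ∀ v ∈ valueProfiles n, ∀ i, 0 ≤ v i * M.alloc v i - M.pay v i
  incentive_compatible : ∀ v ∈ valueProfiles n, ∀ i, ∀ b ∈ Set.Icc (0 : ℝ) 1,
    v i * M.alloc (Function.update v i b) i - M.pay (Function.update v i b) i
      ≤ v i * M.alloc v i - M.pay v i

/-- The expected revenue `M(D)` for the product value distribution `D₁ × ⋯ × Dₙ`. -/
def Auction.revenue {n : ℕ} (M : Auction n) (D : Fin n → Measure ℝ) : ℝ :=
  ∫ v, ∑ i, M.pay v i ∂(Measure.pi D)

/-- `Opt(D)`: the largest expected revenue of a truthful auction. -/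
def optRevenue {n : ℕ} (X : Set (Fin n → ℝ)) (D : Fin n → Measure ℝ) : ℝ :=
  sSup {r : ℝ | ∃ M : Auction n, M.IsTruthful X ∧ M.revenue D = r}

/-- The quantile `Pr[u > v]` of a value `v`, for a distribution given by its CDF `F`. -/
def quantileOf (F : ℝ → ℝ) (v : ℝ) : ℝ := 1 - F v

/-- The value `inf {v ≥ 0 : Pr[u > v] ≤ q}` at quantile `q`, for the CDF `F`. -/
def valueAt (F : ℝ → ℝ) (q : ℝ) : ℝ := sInf {v : ℝ | 0 ≤ v ∧ quantileOf F v ≤ q}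

/-- The revenue curve in quantile space, `R(q) = q * v(q)`. While `v(q)` stays at a point mass `v`,
this is the linear interpolation between the points `(q⁻, q⁻ v)` and `(q⁺, q⁺ v)`, where
`q⁻ = Pr[u > v]` and `q⁺ = Pr[u ≥ v]`. -/
def revenueCurve (F : ℝ → ℝ) (q : ℝ) : ℝ := q * valueAt F q

/-- The ironed revenue curve: the largest expectation of the revenue curve under a distribution
over `[0, 1]` with mean `q` (its concave envelope). -/
def ironedRevenueCurve (F : ℝ → ℝ) (q : ℝ) : ℝ :=
  sSup {r : ℝ | ∃ P : Measure ℝ, IsProbabilityMeasure P ∧ P (Set.Icc 0 1) = 1 ∧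
    ∫ t, t ∂P = q ∧ ∫ t, revenueCurve F t ∂P = r}

/-- The ironed virtual value of `v`: the right derivative of the ironed revenue curve at the
quantile of `v`. -/
def ironedVirtualValue (F : ℝ → ℝ) (v : ℝ) : ℝ :=
  derivWithin (ironedRevenueCurve F) (Set.Ioi (quantileOf F v)) (quantileOf F v)

/-- `a` assigns to every profile `w` of (ironed virtual) values a feasible allocation of maximum
welfare `∑ wᵢ xᵢ`; which one it takes when there are several is the tie-breaking rule. -/
def IsWelfareMaximizer {n : ℕ} (X : Set (Fin n → ℝ)) (a : (Fin n → ℝ) → Fin n → ℝ) : Prop :=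
  ∀ w, a w ∈ X ∧ ∀ x ∈ X, ∑ i, w i * x i ≤ ∑ i, w i * a w i

/-- The allocation rule of Myerson's auction for the product distribution with CDFs `F i`: apply
`a` to the ironed virtual values. -/
def myersonAlloc {n : ℕ} (F : Fin n → ℝ → ℝ) (a : (Fin n → ℝ) → Fin n → ℝ)
    (v : Fin n → ℝ) : Fin n → ℝ :=
  a fun i => ironedVirtualValue (F i) (v i)

/-- Myerson's optimal auction for the product distribution with CDFs `F i`, where the welfare
maximizer `a` fixes the tie-breaking. The payments are those given by Myerson's formula. -/
def myersonAuction {n : ℕ} (F : Fin n → ℝ → ℝ) (a : (Fin n → ℝ) → Fin n → ℝ) : Auction n where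
  alloc := myersonAlloc F a
  pay v i := v i * myersonAlloc F a v i
    - ∫ t in (0 : ℝ)..(v i), myersonAlloc F a (Function.update v i t) i

/-- The CDF of the empirical distribution of bidder `i`'s value in the samples `S 0, …, S (N - 1)`. -/
def empiricalCDF {n N : ℕ} (S : Fin N → Fin n → ℝ) (i : Fin n) (v : ℝ) : ℝ :=
  (Nat.card {j : Fin N // S j i ≤ v} : ℝ) / N

/-- The CDFs of the dominated product empirical distribution with failure probability `δ`. -/
def dominatedEmpiricalCDF {n N : ℕ} (δ : ℝ) (S : Fin N → Fin n → ℝ) (i : Fin n) (v : ℝ) : ℝ :=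
  if v < 0 then 0 else
    min 1 (empiricalCDF S i v
      + Real.sqrt (2 * empiricalCDF S i v * (1 - empiricalCDF S i v)
          * Real.log (2 * n * N / δ) / N)
      + 4 * Real.log (2 * n * N / δ) / N)

end

/-! ### Lower and upper sets of the real line -/

/-! Let φᵢ be the ironed virtual value for Ẽᵢ, x the allocation of Myerson's auction for Ẽ, z that
of a competing truthful auction, and η = ε/(90k). A Bernstein bound makes Ẽᵢ stochastically smaller
than Dᵢ but close to it. The facts used about the pair are collected in `ShadedPair` (proved in
`exists_shadedPair`); after that the samples play no role.

One bidder. Myerson's payment for a monotone rule y is a mixture of posted prices, one for each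
layer {y > u}. Under Ẽᵢ a posted price selling on U earns at most ∫_U φᵢ dẼᵢ, with equality if U is
a union of level sets of φᵢ. Under Dᵢ it sells more often, but by at most η Dᵢ(U) + η/n. So revenue
under Dᵢ is at most ∫ φᵢ y dẼᵢ + η ∫ y dDᵢ + ηk/n for every y, and at least ∫ φᵢ y dẼᵢ if y depends
only on φᵢ (`integral_myersonPay_le`, `le_integral_myersonPay`). The errors sum to O(ηk), because
the expected allocations of all bidders add up to at most k; the maximum demand never enters.

All bidders. It remains to compare the virtual welfares ∑ ∫ φᵢ yᵢ dẼᵢ and ∑ ∫ φᵢ yᵢ' dẼᵢ of the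
interim rules of x and z. Pointwise optimality of x compares them when vᵢ follows the same law as
the one used to average over the other bidders. That law is taken to be Dᵢ with a density ωᵢ ≤ 1,
and then only the law of vᵢ is exchanged for Ẽᵢ (`integral_trimDensity_mul_le`). Truncated at −2n,
virtual values allow this at cost O(η ∫ y + ηk/n), since ∫ φᵢ dẼᵢ = 0 and φᵢ ≤ 1 bound the negative
part. Below −2n, optimality of x forces −φᵢ(t)(yᵢ(t) − yᵢ(0)) ≤ 5k (`neg_mul_interim_sub_le`), but z
satisfies nothing similar. The density ωᵢ is therefore built by trimming, from each slice {φᵢ < −l},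
the top mass by which Dᵢ might exceed Ẽᵢ, so that the comparison for z needs no error term. The mass
removed is at most 4η/n per bidder, which costs z at most 4kη of revenue. All errors add up to 90kη
= ε (`sum_expostPay_le`). -/

/-- CDF estimates concern closed rays only; exhausting a lower set by such rays extends them to open
rays, which occur as layers of monotone functions. -/
theorem IsLowerSet.exists_seq_iUnion_Iic {L : Set ℝ} (hL : IsLowerSet L) (hne : L.Nonempty) :
    ∃ u : ℕ → ℝ, Monotone u ∧ (∀ n, u n ∈ L) ∧ ⋃ n, Set.Iic (u n) = L := by
  suffices H : ∃ u : ℕ → ℝ, Monotone u ∧ (∀ n, u n ∈ L) ∧ ∀ x ∈ L, ∃ n, x ≤ u n by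
    obtain ⟨u, hu, huL, hx⟩ := H
    refine ⟨u, hu, huL, Set.Subset.antisymm ?_ ?_⟩
    · exact Set.iUnion_subset fun n x hx => hL hx (huL n)
    · intro x hxL
      simpa using hx x hxL
  by_cases hb : BddAbove L
  · by_cases hs : sSup L ∈ L
    · exact ⟨fun _ => sSup L, monotone_const, fun _ => hs, fun x hx => ⟨0, le_csSup hb hx⟩⟩
    · obtain ⟨u, hu, ht, huL⟩ := exists_seq_tendsto_sSup hne hb
      refine ⟨u, hu, huL, fun x hx => ?_⟩
      have hlt : x < sSup L := lt_of_le_of_ne (le_csSup hb hx) (fun h => hs (h ▸ hx))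
      obtain ⟨n, hn⟩ := (ht.eventually (lt_mem_nhds hlt)).exists
      exact ⟨n, hn.le⟩
  · rw [not_bddAbove_iff] at hb
    refine ⟨fun n => n, Nat.mono_cast, fun n => ?_, fun x _ => exists_nat_ge x⟩
    obtain ⟨y, hy, hny⟩ := hb n
    exact hL hny.le hy

theorem IsLowerSet.exists_seq_tendsto_measure {L : Set ℝ} (hL : IsLowerSet L) (hne : L.Nonempty) :
    ∃ u : ℕ → ℝ, (∀ n, u n ∈ L) ∧ ∀ μ : Measure ℝ, IsFiniteMeasure μ →
      Filter.Tendsto (fun n => μ.real (Set.Iic (u n))) Filter.atTop (nhds (μ.real L)) := by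
  obtain ⟨u, hu, huL, hU⟩ := hL.exists_seq_iUnion_Iic hne
  refine ⟨u, huL, fun μ hμ => ?_⟩
  have hmono : Monotone fun n => Set.Iic (u n) := fun a b hab => Set.Iic_subset_Iic.2 (hu hab)
  have := tendsto_measure_iUnion_atTop (μ := μ) hmono
  rw [hU] at this
  exact (ENNReal.tendsto_toReal (measure_ne_top μ L)).comp this

theorem IsLowerSet.measureReal_le {L : Set ℝ} (hL : IsLowerSet L) {μ : Measure ℝ}
    [IsFiniteMeasure μ] {c : ℝ} (hc : 0 ≤ c) (h : ∀ v ∈ L, μ.real (Set.Iic v) ≤ c) :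
    μ.real L ≤ c := by
  rcases L.eq_empty_or_nonempty with rfl | hne
  · simpa using hc
  · obtain ⟨u, huL, ht⟩ := hL.exists_seq_tendsto_measure hne
    exact le_of_tendsto' (ht μ inferInstance) fun n => h _ (huL n)

/-- Without a minimum, U is a directed union of open rays starting at rational points of U, so
continuity from below applies. -/
theorem IsUpperSet.measure_le_of_no_min {U : Set ℝ} (hU : IsUpperSet U)
    (hmin : ∀ v ∈ U, ∃ w ∈ U, w < v) {μ : Measure ℝ} {c : ENNReal}
    (h : ∀ v ∈ U, μ (Set.Ioi v) ≤ c) : μ U ≤ c := by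
  have hUeq : U = ⋃ q : {q : ℚ // (q : ℝ) ∈ U}, Set.Ioi (q.1 : ℝ) := by
    ext v
    simp only [Set.mem_iUnion, Set.mem_Ioi, Subtype.exists, exists_prop]
    constructor
    · intro hv
      obtain ⟨w, hw, hwv⟩ := hmin v hv
      obtain ⟨q, hq1, hq2⟩ := exists_rat_btwn hwv
      exact ⟨q, hU hq1.le hw, hq2⟩
    · rintro ⟨q, hq, hqv⟩
      exact hU hqv.le hq
  have hdir : Directed (· ⊆ ·) fun q : {q : ℚ // (q : ℝ) ∈ U} => Set.Ioi (q.1 : ℝ) := by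
    intro p q
    rcases le_total (p.1 : ℝ) q.1 with hpq | hpq
    · exact ⟨p, subset_rfl, Set.Ioi_subset_Ioi hpq⟩
    · exact ⟨q, Set.Ioi_subset_Ioi hpq, subset_rfl⟩
  rw [hUeq, hdir.measure_iUnion]
  exact iSup_le fun q => h _ q.2

theorem IsLowerSet.measurableSet_real {L : Set ℝ} (hL : IsLowerSet L) : MeasurableSet L :=
  hL.ordConnected.measurableSet

theorem IsUpperSet.measurableSet_real {U : Set ℝ} (hU : IsUpperSet U) : MeasurableSet U :=
  hU.ordConnected.measurableSet

theorem Monotone.isUpperSet_lt {f : ℝ → ℝ} (hf : Monotone f) (u : ℝ) :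
    IsUpperSet {x | u < f x} := fun _ _ hab ha => lt_of_lt_of_le ha (hf hab)

theorem Antitone.isLowerSet_lt {f : ℝ → ℝ} (hf : Antitone f) (u : ℝ) :
    IsLowerSet {x | u < f x} := fun _ _ hab ha => lt_of_lt_of_le ha (hf hab)

/-! ### Comparing integrals through superlevel sets -/

/-- Layer cake: an excess of at most c at each level u in (0, B] integrates to c * B. For monotone f
the superlevel sets are upper or lower sets. -/
theorem integral_le_add_of_superlevel {μ ν : Measure ℝ} [IsFiniteMeasure μ] [IsFiniteMeasure ν]
    {f : ℝ → ℝ} (hf : Measurable f) (h0 : ∀ x, 0 ≤ f x) {B : ℝ} (hB : ∀ x, f x ≤ B) {c : ℝ}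
    (hc : 0 ≤ c)
    (h : ∀ u, 0 ≤ u → μ {x | u < f x} ≤ ν {x | u < f x} + ENNReal.ofReal c) :
    ∫ x, f x ∂μ ≤ ∫ x, f x ∂ν + c * B := by
  have hB0 : 0 ≤ B := (h0 0).trans (hB 0)
  have hint : ∀ κ : Measure ℝ, IsFiniteMeasure κ → Integrable f κ := fun κ _ =>
    Integrable.of_bound hf.aestronglyMeasurable B
      (Filter.Eventually.of_forall fun x => by rw [Real.norm_of_nonneg (h0 x)]; exact hB x)
  have key : ∫⁻ x, ENNReal.ofReal (f x) ∂μ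
      ≤ ∫⁻ x, ENNReal.ofReal (f x) ∂ν + ENNReal.ofReal (c * B) := by
    rw [lintegral_eq_lintegral_meas_lt μ (Filter.Eventually.of_forall h0) hf.aemeasurable,
      lintegral_eq_lintegral_meas_lt ν (Filter.Eventually.of_forall h0) hf.aemeasurable]
    have h1 : ∀ u ∈ Set.Ioi (0 : ℝ), μ {x | u < f x} ≤ ν {x | u < f x}
        + (Set.Ioc 0 B).indicator (fun _ => ENNReal.ofReal c) u := by
      intro u hu
      by_cases huB : u ≤ B
      · rw [Set.indicator_of_mem (show u ∈ Set.Ioc 0 B from ⟨hu, huB⟩)]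
        exact h u (le_of_lt hu)
      · have : {x | u < f x} = ∅ := by
          ext x
          simp only [Set.mem_ofPred_eq, Set.mem_empty_iff_false, iff_false, not_lt]
          exact (hB x).trans (not_le.1 huB).le
        simp [this]
    refine (setLIntegral_mono' measurableSet_Ioi h1).trans ?_
    rw [lintegral_add_right _ (measurable_const.indicator measurableSet_Ioc)]
    gcongr
    rw [lintegral_indicator measurableSet_Ioc, lintegral_const]
    simp only [Measure.restrict_apply MeasurableSet.univ, Set.univ_inter]
    rw [Measure.restrict_apply measurableSet_Ioc]
    have : Set.Ioc 0 B ∩ Set.Ioi 0 = Set.Ioc 0 B :=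
      Set.inter_eq_left.2 fun x hx => hx.1
    rw [this, Real.volume_Ioc, sub_zero, ENNReal.ofReal_mul hc]
  have hn : ∀ κ : Measure ℝ, IsFiniteMeasure κ →
      ∫⁻ x, ENNReal.ofReal (f x) ∂κ = ENNReal.ofReal (∫ x, f x ∂κ) := fun κ hκ =>
    (ofReal_integral_eq_lintegral_ofReal (hint κ hκ) (Filter.Eventually.of_forall h0)).symm
  rw [hn μ inferInstance, hn ν inferInstance,
    ← ENNReal.ofReal_add (integral_nonneg h0) (mul_nonneg hc hB0)] at key
  exact (ENNReal.ofReal_le_ofReal_iff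
    (add_nonneg (integral_nonneg h0) (mul_nonneg hc hB0))).1 key

theorem lintegral_le_of_superlevel {μ ν : Measure ℝ} {f : ℝ → ℝ} (hf : Measurable f)
    (h0 : ∀ x, 0 ≤ f x) (h : ∀ u, 0 ≤ u → μ {x | u < f x} ≤ ν {x | u < f x}) :
    ∫⁻ x, ENNReal.ofReal (f x) ∂μ ≤ ∫⁻ x, ENNReal.ofReal (f x) ∂ν := by
  rw [lintegral_eq_lintegral_meas_lt μ (Filter.Eventually.of_forall h0) hf.aemeasurable,
    lintegral_eq_lintegral_meas_lt ν (Filter.Eventually.of_forall h0) hf.aemeasurable]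
  exact setLIntegral_mono' measurableSet_Ioi fun u hu => h u (le_of_lt hu)

/-! ### Trimming the top of a measure -/

/-- The weight with which the topmost `ρ` of the mass of `μ` is trimmed (an atom at the boundary is
trimmed partially). -/
noncomputable def topWeight (μ : Measure ℝ) (ρ : ENNReal) (v : ℝ) : ENNReal :=
  if μ (Set.Ioi v) ≤ ρ then min 1 (ρ / μ (Set.Ici v)) else 0

theorem topWeight_le_one (μ : Measure ℝ) (ρ : ENNReal) (v : ℝ) : topWeight μ ρ v ≤ 1 := by
  unfold topWeight
  split_ifs
  · exact min_le_left _ _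
  · exact zero_le_one

theorem isUpperSet_Ioi_le (μ : Measure ℝ) (ρ : ENNReal) :
    IsUpperSet {v | μ (Set.Ioi v) ≤ ρ} := fun _ _ hab ha =>
  (measure_mono (Set.Ioi_subset_Ioi hab)).trans ha

theorem measurable_topWeight (μ : Measure ℝ) (ρ : ENNReal) : Measurable (topWeight μ ρ) := by
  have h1 : Measurable fun v => μ (Set.Ici v) :=
    Antitone.measurable fun a b hab => measure_mono (Set.Ici_subset_Ici.2 hab)
  exact Measurable.ite (isUpperSet_Ioi_le μ ρ).measurableSet_real
    (measurable_const.min (measurable_const.div h1)) measurable_const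

theorem mul_min_one_div {a ρ : ENNReal} (ha : a ≠ ⊤) : a * min 1 (ρ / a) = min a ρ := by
  by_cases h0 : a = 0
  · simp [h0]
  · rw [mul_min, mul_one, ENNReal.mul_div_cancel h0 ha]

/-- For v in U the ray above v stays in U, so the weight at v is at least min(1, ρ/μ(U)).
Integrating this constant over U gives the bound. -/
theorem min_le_lintegral_topWeight_of_subset (μ : Measure ℝ) [IsFiniteMeasure μ] (ρ : ENNReal)
    {U : Set ℝ} (hU : IsUpperSet U) (hsub : U ⊆ {v | μ (Set.Ioi v) ≤ ρ}) :
    min (μ U) ρ ≤ ∫⁻ v in U, topWeight μ ρ v ∂μ := by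
  rw [← mul_min_one_div (measure_ne_top μ U), mul_comm, ← setLIntegral_const]
  refine setLIntegral_mono' hU.measurableSet_real fun v hv => ?_
  rw [topWeight, if_pos (show μ (Set.Ioi v) ≤ ρ from hsub hv)]
  exact min_le_min le_rfl
    (ENNReal.div_le_div_left (measure_mono fun w hw => hU hw hv) ρ)

/-- The purpose of the weight: each upper set loses mass ρ, or all it has. If U is not inside V,
then U contains V, and V already carries mass at least ρ. -/
theorem min_le_lintegral_topWeight (μ : Measure ℝ) [IsFiniteMeasure μ] {ρ : ENNReal}
    (hρ : ρ ≠ ⊤) {U : Set ℝ} (hU : IsUpperSet U) :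
    min (μ U) ρ ≤ ∫⁻ v in U, topWeight μ ρ v ∂μ := by
  set V := {v | μ (Set.Ioi v) ≤ ρ} with hV
  have hVu : IsUpperSet V := isUpperSet_Ioi_le μ ρ
  by_cases hsub : U ⊆ V
  · exact min_le_lintegral_topWeight_of_subset μ ρ hU hsub
  · obtain ⟨b, hbU, hbV⟩ := Set.not_subset.1 hsub
    have hVU : V ⊆ U := fun v hv =>
      hU (le_of_not_ge fun h => hbV (hVu h hv)) hbU
    refine le_trans ?_ (lintegral_mono_set hVU)
    refine le_trans ?_ (min_le_lintegral_topWeight_of_subset μ ρ hVu subset_rfl)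
    refine le_trans (min_le_right _ _) (le_min ?_ le_rfl)
    have hL : IsLowerSet Vᶜ := hVu.compl
    -- A point outside V leaves more than ρ above it; the resulting bound on closed rays passes to
    -- the lower set Vᶜ.
    have h1 : μ.real Vᶜ ≤ μ.real Set.univ - ρ.toReal := by
      have hIic : ∀ v ∈ Vᶜ, μ.real (Set.Iic v) ≤ μ.real Set.univ - ρ.toReal := by
        intro v hv
        have hlt : ρ < μ (Set.Ioi v) := not_le.1 hv
        have h2 : ρ.toReal ≤ μ.real (Set.Ioi v) :=
          ENNReal.toReal_mono (measure_ne_top _ _) hlt.le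
        have h3 := measureReal_compl (μ := μ) (s := Set.Iic v) measurableSet_Iic
        rw [Set.compl_Iic] at h3
        linarith
      refine hL.measureReal_le ?_ hIic
      exact le_trans measureReal_nonneg (hIic b hbV)
    have h2 := measureReal_compl (μ := μ) (s := V) hVu.measurableSet_real
    have h3 : ρ.toReal ≤ μ.real V := by linarith
    rw [Measure.real, ENNReal.toReal_le_toReal hρ (measure_ne_top _ _)] at h3
    exact h3

/-- If V has no minimum, its mass is at most ρ. Otherwise the weighted atom at the minimum and the
open ray above it carry at most ρ each, hence the factor 2. -/
theorem lintegral_topWeight_le (μ : Measure ℝ) [IsFiniteMeasure μ] (ρ : ENNReal) :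
    ∫⁻ v, topWeight μ ρ v ∂μ ≤ 2 * ρ := by
  set V := {v | μ (Set.Ioi v) ≤ ρ} with hV
  have hVu : IsUpperSet V := isUpperSet_Ioi_le μ ρ
  have h0 : ∫⁻ v, topWeight μ ρ v ∂μ = ∫⁻ v in V, topWeight μ ρ v ∂μ := by
    rw [← lintegral_indicator hVu.measurableSet_real]
    congr 1
    ext v
    by_cases hv : v ∈ V
    · simp [hv]
    · rw [Set.indicator_of_notMem hv, topWeight, if_neg (show ¬ μ (Set.Ioi v) ≤ ρ from hv)]
  rw [h0]
  by_cases hmin : ∀ v ∈ V, ∃ w ∈ V, w < v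
  · calc ∫⁻ v in V, topWeight μ ρ v ∂μ ≤ ∫⁻ _ in V, 1 ∂μ :=
          lintegral_mono fun v => topWeight_le_one μ ρ v
      _ = μ V := by simp
      _ ≤ ρ := hVu.measure_le_of_no_min hmin fun v hv => hv
      _ ≤ 2 * ρ := by rw [two_mul]; exact le_self_add
  · push Not at hmin
    obtain ⟨a, ha, hmin⟩ := hmin
    have hVa : V = {a} ∪ Set.Ioi a := by
      ext v
      constructor
      · intro hv
        rcases (hmin v hv).eq_or_lt with h | h
        · exact Or.inl h.symm
        · exact Or.inr h
      · rintro (h | h)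
        · rw [Set.mem_singleton_iff] at h; exact h ▸ ha
        · exact hVu (le_of_lt h) ha
    rw [hVa]
    refine (lintegral_union_le _ _ _).trans ?_
    rw [two_mul]
    refine add_le_add ?_ ?_
    · rw [lintegral_singleton, topWeight, if_pos (show μ (Set.Ioi a) ≤ ρ from ha)]
      calc min 1 (ρ / μ (Set.Ici a)) * μ {a} ≤ min 1 (ρ / μ (Set.Ici a)) * μ (Set.Ici a) := by
            gcongr
            simp
        _ = min (μ (Set.Ici a)) ρ := by rw [mul_comm, mul_min_one_div (measure_ne_top _ _)]
        _ ≤ ρ := min_le_right _ _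
    · calc ∫⁻ v in Set.Ioi a, topWeight μ ρ v ∂μ ≤ ∫⁻ _ in Set.Ioi a, 1 ∂μ :=
            lintegral_mono fun v => topWeight_le_one μ ρ v
        _ = μ (Set.Ioi a) := by simp
        _ ≤ ρ := ha


/-! ### Posted prices, Myerson payments and shaded distributions -/

/-- The posted price that sells exactly on the upper set `U` of values in `[0, 1]`. -/
noncomputable def postedPrice (U : Set ℝ) : ℝ := volume.real (Set.Ioo 0 1 \ U)

theorem postedPrice_nonneg (U : Set ℝ) : 0 ≤ postedPrice U := measureReal_nonneg

theorem postedPrice_le_one (U : Set ℝ) : postedPrice U ≤ 1 := by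
  calc volume.real (Set.Ioo 0 1 \ U) ≤ volume.real (Set.Ioo (0 : ℝ) 1) :=
        measureReal_mono Set.sdiff_subset (by simp)
    _ = 1 := by simp [Measure.real]

/-- The payment that Myerson's formula assigns to the single-bidder allocation rule `y`. -/
noncomputable def myersonPay (y : ℝ → ℝ) (v : ℝ) : ℝ := v * y v - ∫ t in (0 : ℝ)..v, y t

/-- `D` is a value distribution, `E` a slightly shaded version of it, and `φ` the ironed virtual
value function of `E`. -/
structure ShadedPair (n η σ : ℝ) (D E : Measure ℝ) (φ : ℝ → ℝ) : Prop where
  probD : IsProbabilityMeasure D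
  probE : IsProbabilityMeasure E
  supp : D (Set.Icc 0 1) = 1
  mono : Monotone φ
  le_one : ∀ v, φ v ≤ 1
  zero_le : ∀ v, φ 0 ≤ φ v
  one_le : 1 ≤ n
  η_nonneg : 0 ≤ η
  σ_nonneg : 0 ≤ σ
  σ_le : σ * √n ≤ η
  -- Domination, then two measures of closeness: `close_low` is sharp for lower sets of small mass,
  -- `close_up` for upper sets of small mass, with an error η/n that may be paid once per bidder.
  -- The last two fields say that posted-price revenue under E is at most virtual welfare, with
  -- equality on unions of level sets of φ.
  dom : ∀ L, IsLowerSet L → D.real L ≤ E.real L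
  close_low : ∀ L, IsLowerSet L → E.real L ≤ D.real L + σ * √(E.real L)
  close_up : ∀ L, IsLowerSet L → E.real L ≤ D.real L + η * D.real Lᶜ + η / n
  price_le : ∀ U, IsUpperSet U → postedPrice U * E.real U ≤ ∫ v in U, φ v ∂E
  le_price : ∀ U, IsUpperSet U → (∀ v w, φ v = φ w → v ∈ U → w ∈ U) →
    ∫ v in U, φ v ∂E ≤ postedPrice U * E.real U

theorem Monotone.integrable_of_bound {f : ℝ → ℝ} (hf : Monotone f) {μ : Measure ℝ}
    [IsFiniteMeasure μ] {B : ℝ} (h0 : ∀ x, 0 ≤ f x) (hB : ∀ x, f x ≤ B) : Integrable f μ :=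
  Integrable.of_bound hf.measurable.aestronglyMeasurable B
    (Filter.Eventually.of_forall fun x => by rw [Real.norm_of_nonneg (h0 x)]; exact hB x)

theorem Antitone.integrable_of_bound {f : ℝ → ℝ} (hf : Antitone f) {μ : Measure ℝ}
    [IsFiniteMeasure μ] {B : ℝ} (h0 : ∀ x, 0 ≤ f x) (hB : ∀ x, f x ≤ B) : Integrable f μ :=
  Integrable.of_bound hf.measurable.aestronglyMeasurable B
    (Filter.Eventually.of_forall fun x => by rw [Real.norm_of_nonneg (h0 x)]; exact hB x)

/-! ### Layers -/

theorem integral_Ioc_indicator_lt {k a : ℝ} (h0 : 0 ≤ a) (hk : a ≤ k) :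
    ∫ u in Set.Ioc 0 k, (Set.Iio a).indicator (fun _ => (1 : ℝ)) u = a := by
  rw [setIntegral_indicator measurableSet_Iio, setIntegral_const, smul_eq_mul, mul_one]
  have : Set.Ioc 0 k ∩ Set.Iio a = Set.Ioo 0 a := by
    ext x
    simp only [Set.mem_inter_iff, Set.mem_Ioc, Set.mem_Iio, Set.mem_Ioo]
    constructor
    · rintro ⟨⟨h1, _⟩, h3⟩; exact ⟨h1, h3⟩
    · rintro ⟨h1, h2⟩; exact ⟨⟨h1, (h2.trans_le hk).le⟩, h2⟩
  rw [this, Measure.real, Real.volume_Ioo, sub_zero, ENNReal.toReal_ofReal h0]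

theorem measurableSet_layer {y : ℝ → ℝ} (hy : Measurable y) :
    MeasurableSet {p : ℝ × ℝ | p.2 < y p.1} :=
  measurableSet_lt measurable_snd (hy.comp measurable_fst)

theorem integrable_layer {y ψ : ℝ → ℝ} (hy : Measurable y) (hψ : Measurable ψ) {B : ℝ}
    (hB : ∀ v, |ψ v| ≤ B) {χ : ℝ → ℝ} (hχ : Measurable χ) {C : ℝ} (hC : ∀ v, |χ v| ≤ C)
    (k : ℝ) (μ : Measure ℝ) [IsFiniteMeasure μ] :
    Integrable (fun p : ℝ × ℝ => {p : ℝ × ℝ | p.2 < y p.1}.indicator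
      (fun p => ψ p.1 * χ p.2) p) (μ.prod (volume.restrict (Set.Ioc 0 k))) := by
  refine Integrable.of_bound (C := B * C) ?_ (Filter.Eventually.of_forall fun p => ?_)
  · exact (((hψ.comp measurable_fst).mul (hχ.comp measurable_snd)).indicator
      (measurableSet_layer hy)).aestronglyMeasurable
  · refine (norm_indicator_le_norm_self _ _).trans ?_
    rw [norm_mul]
    exact mul_le_mul (hB _) (hC _) (norm_nonneg _) ((abs_nonneg _).trans (hB 0))

theorem layer_slice (y ψ χ : ℝ → ℝ) (v u : ℝ) :
    {p : ℝ × ℝ | p.2 < y p.1}.indicator (fun p => ψ p.1 * χ p.2) (v, u)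
      = ψ v * χ u * (Set.Iio (y v)).indicator (fun _ => (1 : ℝ)) u := by
  by_cases h : u < y v
  · rw [Set.indicator_of_mem (show (v, u) ∈ {p : ℝ × ℝ | p.2 < y p.1} from h),
      Set.indicator_of_mem (show u ∈ Set.Iio (y v) from h), mul_one]
  · rw [Set.indicator_of_notMem (show (v, u) ∉ {p : ℝ × ℝ | p.2 < y p.1} from h),
      Set.indicator_of_notMem (show u ∉ Set.Iio (y v) from h), mul_zero]

theorem layer_slice' (y ψ χ : ℝ → ℝ) (v u : ℝ) :
    {p : ℝ × ℝ | p.2 < y p.1}.indicator (fun p => ψ p.1 * χ p.2) (v, u)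
      = χ u * {v | u < y v}.indicator ψ v := by
  by_cases h : u < y v
  · rw [Set.indicator_of_mem (show (v, u) ∈ {p : ℝ × ℝ | p.2 < y p.1} from h),
      Set.indicator_of_mem (show v ∈ {v | u < y v} from h), mul_comm]
  · rw [Set.indicator_of_notMem (show (v, u) ∉ {p : ℝ × ℝ | p.2 < y p.1} from h),
      Set.indicator_of_notMem (show v ∉ {v | u < y v} from h), mul_zero]

theorem integrable_layer_integral {y ψ : ℝ → ℝ} (hy : Measurable y) (hψ : Measurable ψ) {B : ℝ}
    (hB : ∀ v, |ψ v| ≤ B) {χ : ℝ → ℝ} (hχ : Measurable χ) {C : ℝ} (hC : ∀ v, |χ v| ≤ C)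
    (k : ℝ) (μ : Measure ℝ) [IsFiniteMeasure μ] :
    IntegrableOn (fun u => χ u * ∫ v in {v | u < y v}, ψ v ∂μ) (Set.Ioc 0 k) := by
  have h := (integrable_layer hy hψ hB hχ hC k μ).integral_prod_right
  refine h.congr (Filter.Eventually.of_forall fun u => ?_)
  simp only [layer_slice', integral_const_mul]
  rw [integral_indicator (measurableSet_lt measurable_const hy)]

/-- Fubini on the region below the graph of y. The weight χ on levels is 1 for plain layer cake, and
the posted price of the layer for payments. -/
theorem integral_layer {y ψ : ℝ → ℝ} (hy : Measurable y) (hψ : Measurable ψ) {B : ℝ}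
    (hB : ∀ v, |ψ v| ≤ B) {χ : ℝ → ℝ} (hχ : Measurable χ) {C : ℝ} (hC : ∀ v, |χ v| ≤ C)
    (k : ℝ) (μ : Measure ℝ) [IsFiniteMeasure μ] :
    ∫ v, ψ v * (∫ u in Set.Ioc 0 k, χ u * (Set.Iio (y v)).indicator (fun _ => (1 : ℝ)) u) ∂μ
      = ∫ u in Set.Ioc 0 k, χ u * ∫ v in {v | u < y v}, ψ v ∂μ := by
  have h := integral_integral_swap (f := fun v u => {p : ℝ × ℝ | p.2 < y p.1}.indicator
    (fun p => ψ p.1 * χ p.2) (v, u)) (integrable_layer hy hψ hB hχ hC k μ)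
  calc _ = ∫ v, (∫ u in Set.Ioc 0 k,
        {p : ℝ × ℝ | p.2 < y p.1}.indicator (fun p => ψ p.1 * χ p.2) (v, u)) ∂μ := by
        refine integral_congr_ae (Filter.Eventually.of_forall fun v => ?_)
        simp only [layer_slice, mul_assoc, integral_const_mul]
    _ = _ := h
    _ = _ := by
        refine integral_congr_ae (Filter.Eventually.of_forall fun u => ?_)
        simp only [layer_slice', integral_const_mul]
        rw [integral_indicator (measurableSet_lt measurable_const hy)]

theorem integral_mul_eq_layer {y ψ : ℝ → ℝ} (hy : Measurable y) (h0 : ∀ v, 0 ≤ y v) {k : ℝ}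
    (hk : ∀ v, y v ≤ k) (hψ : Measurable ψ) {B : ℝ} (hB : ∀ v, |ψ v| ≤ B)
    (μ : Measure ℝ) [IsFiniteMeasure μ] :
    ∫ v, ψ v * y v ∂μ = ∫ u in Set.Ioc 0 k, ∫ v in {v | u < y v}, ψ v ∂μ := by
  have h := integral_layer hy hψ hB (χ := fun _ => 1) measurable_const (C := 1) (by simp) k μ
  simp only [one_mul] at h
  rw [← h]
  refine integral_congr_ae (Filter.Eventually.of_forall fun v => ?_)
  simp only []
  rw [integral_Ioc_indicator_lt (h0 v) (hk v)]

/-! ### Payments as mixtures of posted prices -/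

theorem measurable_postedPrice_layer (y : ℝ → ℝ) : Measurable fun u => postedPrice {v | u < y v} := by
  refine Monotone.measurable fun a b hab => measureReal_mono ?_ ?_
  · exact Set.sdiff_subset_sdiff_right fun v (hv : b < y v) => lt_of_le_of_lt hab hv
  · exact ((measure_mono Set.sdiff_subset).trans_lt (by simp : volume (Set.Ioo (0 : ℝ) 1) < ⊤)).ne

/-- Myerson's formula is linear in y, and y is the integral of its layers. The rule that sells
exactly on a layer charges the posted price of that layer to the buyers and nothing to the others.
-/
theorem myersonPay_eq_layer {y : ℝ → ℝ} (hy : Monotone y) (h0 : ∀ v, 0 ≤ y v) {k : ℝ}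
    (hk : ∀ v, y v ≤ k) {v : ℝ} (hv : v ∈ Set.Icc (0 : ℝ) 1) :
    myersonPay y v = ∫ u in Set.Ioc 0 k,
      postedPrice {w | u < y w} * (Set.Iio (y v)).indicator (fun _ => (1 : ℝ)) u := by
  have h1 : ∫ t in (0 : ℝ)..v, y t
      = ∫ u in Set.Ioc 0 k, ∫ _ in {w | u < y w}, (1 : ℝ) ∂(volume.restrict (Set.Ioc 0 v)) := by
    rw [intervalIntegral.integral_of_le hv.1]
    have := integral_mul_eq_layer hy.measurable h0 hk (ψ := fun _ => 1) measurable_const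
      (B := 1) (by simp) (volume.restrict (Set.Ioc 0 v))
    simpa using this
  have hi1 : IntegrableOn (fun u => ∫ _ in {w | u < y w}, (1 : ℝ)
      ∂(volume.restrict (Set.Ioc 0 v))) (Set.Ioc 0 k) := by
    simpa using integrable_layer_integral hy.measurable (ψ := fun _ => 1) measurable_const
      (B := 1) (by simp) (χ := fun _ => 1) measurable_const (C := 1) (by simp) k
      (volume.restrict (Set.Ioc 0 v))
  have hi2 : IntegrableOn (fun u => v * (Set.Iio (y v)).indicator (fun _ => (1 : ℝ)) u)
      (Set.Ioc 0 k) :=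
    ((integrable_const (1 : ℝ)).indicator measurableSet_Iio).const_mul v
  rw [myersonPay, h1]
  conv_lhs => rw [← integral_Ioc_indicator_lt (h0 v) (hk v), ← integral_const_mul]
  rw [← integral_sub hi2 hi1]
  refine integral_congr_ae (Filter.Eventually.of_forall fun u => ?_)
  simp only []
  have hU : MeasurableSet {w | u < y w} := (hy.isUpperSet_lt u).measurableSet_real
  rw [setIntegral_const, smul_eq_mul, mul_one, Measure.real, Measure.restrict_apply hU]
  by_cases h : u < y v
  · rw [Set.indicator_of_mem (show u ∈ Set.Iio (y v) from h), mul_one, mul_one, postedPrice]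
    -- Everything from v upwards lies in the layer, so the price is determined by the values below
    -- v.
    have hset : Set.Ioo (0 : ℝ) 1 \ {w | u < y w} = Set.Ioc 0 v \ {w | u < y w} := by
      ext t
      simp only [Set.mem_sdiff, Set.mem_Ioo, Set.mem_Ioc, Set.mem_ofPred_eq, not_lt]
      constructor
      · rintro ⟨⟨h1, _⟩, h3⟩
        refine ⟨⟨h1, le_of_not_gt fun h4 => ?_⟩, h3⟩
        exact absurd (lt_of_lt_of_le h (hy h4.le)) (not_lt.2 h3)
      · rintro ⟨⟨h1, h2⟩, h3⟩
        refine ⟨⟨h1, lt_of_lt_of_le (lt_of_le_of_ne h2 ?_) hv.2⟩, h3⟩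
        rintro rfl
        exact absurd h (not_lt.2 h3)
    have hsum := measureReal_sdiff_add_inter (μ := volume) (s := Set.Ioc 0 v)
      (t := {w | u < y w}) hU (by simp)
    rw [hset, Set.inter_comm]
    have h3 : volume.real (Set.Ioc 0 v) = v := by
      simp [Measure.real, Real.volume_Ioc, ENNReal.toReal_ofReal hv.1]
    rw [h3] at hsum
    simp only [Measure.real] at hsum ⊢
    linarith
  · rw [Set.indicator_of_notMem (show u ∉ Set.Iio (y v) from h), mul_zero, mul_zero]
    have : {w | u < y w} ∩ Set.Ioc 0 v = ∅ := by
      ext t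
      simp only [Set.mem_inter_iff, Set.mem_ofPred_eq, Set.mem_Ioc, Set.mem_empty_iff_false,
        iff_false, not_and]
      intro h1 h2 h3
      exact h (lt_of_lt_of_le h1 (hy h3))
    simp [this]

theorem myersonPay_nonneg {y : ℝ → ℝ} (hy : Monotone y) (h0 : ∀ v, 0 ≤ y v) {k : ℝ}
    (hk : ∀ v, y v ≤ k) {v : ℝ} (hv : v ∈ Set.Icc (0 : ℝ) 1) : 0 ≤ myersonPay y v := by
  rw [myersonPay_eq_layer hy h0 hk hv]
  refine integral_nonneg fun u => mul_nonneg (postedPrice_nonneg _) ?_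
  exact Set.indicator_nonneg (fun _ _ => zero_le_one) u

theorem integral_myersonPay {y : ℝ → ℝ} (hy : Monotone y) (h0 : ∀ v, 0 ≤ y v) {k : ℝ}
    (hk : ∀ v, y v ≤ k) {D : Measure ℝ} [IsProbabilityMeasure D] (hD : D (Set.Icc 0 1) = 1) :
    ∫ v, myersonPay y v ∂D
      = ∫ u in Set.Ioc 0 k, postedPrice {w | u < y w} * D.real {w | u < y w} := by
  have h := integral_layer hy.measurable (ψ := fun _ => 1) measurable_const (B := 1) (by simp)
    (measurable_postedPrice_layer y) (C := 1)
    (fun u => by rw [abs_of_nonneg (postedPrice_nonneg _)]; exact postedPrice_le_one _) k D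
  simp only [one_mul, integral_const, MeasurableSet.univ, measureReal_restrict_apply,
    Set.univ_inter, smul_eq_mul, mul_one] at h
  rw [← h]
  have hae : ∀ᵐ v ∂D, v ∈ Set.Icc (0 : ℝ) 1 :=
    (mem_ae_iff_prob_eq_one measurableSet_Icc).2 hD
  exact integral_congr_ae (hae.mono fun v hv => myersonPay_eq_layer hy h0 hk hv)

/-! ### Comparing expectations and revenues under the two distributions -/

namespace ShadedPair

variable {n η σ : ℝ} {D E : Measure ℝ} {φ : ℝ → ℝ}

theorem abs_le (h : ShadedPair n η σ D E φ) (v : ℝ) : |φ v| ≤ |φ 0| + 1 := by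
  have h1 := h.le_one v
  have h2 := h.zero_le v
  rw [_root_.abs_le]
  constructor
  · have := neg_abs_le (φ 0); linarith
  · have := abs_nonneg (φ 0); linarith

theorem integrable (h : ShadedPair n η σ D E φ) (μ : Measure ℝ) [IsFiniteMeasure μ] :
    Integrable φ μ :=
  Integrable.of_bound h.mono.measurable.aestronglyMeasurable (|φ 0| + 1)
    (Filter.Eventually.of_forall h.abs_le)

/-- The whole line is a saturated upper set with posted price 0, so both pricing inequalities apply.
Together with φ ≤ 1 this controls the negative part of φ. -/
theorem integral_eq_zero (h : ShadedPair n η σ D E φ) : ∫ v, φ v ∂E = 0 := by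
  have h1 := h.price_le Set.univ isUpperSet_univ
  have h2 := h.le_price Set.univ isUpperSet_univ fun _ _ _ _ => Set.mem_univ _
  simp [postedPrice] at h1 h2
  exact le_antisymm h2 h1

/-- Since √(na) ≤ na + 1 and σ√n ≤ η, the square-root error satisfies σ√a ≤ ηa + η/n. -/
theorem sub_le_low (h : ShadedPair n η σ D E φ) {L : Set ℝ} (hL : IsLowerSet L) :
    E.real L ≤ D.real L + η * E.real L + η / n := by
  have h1 := h.close_low L hL
  have hn : 0 < n := lt_of_lt_of_le one_pos h.one_le
  have hsn : 0 < √n := Real.sqrt_pos.2 hn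
  set a := E.real L
  have ha : 0 ≤ a := measureReal_nonneg
  have h2 : √a * (√n * √n) ≤ √n * (n * a + 1) := by
    have h3 : √n * √n = n := Real.mul_self_sqrt hn.le
    have h4 : √a * √a = a := Real.mul_self_sqrt ha
    have h5 : √n * √a ≤ n * a + 1 := by
      nlinarith [sq_nonneg (√n * √a - 1), mul_nonneg hn.le ha,
        show (√n * √a) ^ 2 = n * a by rw [mul_pow, Real.sq_sqrt hn.le, Real.sq_sqrt ha]]
    nlinarith
  have h3 : σ * √a ≤ η * a + η / n := by
    have h4 : σ * √a * n ≤ η * (n * a + 1) := by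
      have h5 : σ * (√a * (√n * √n)) ≤ σ * (√n * (n * a + 1)) :=
        mul_le_mul_of_nonneg_left h2 h.σ_nonneg
      rw [Real.mul_self_sqrt hn.le] at h5
      have h6 : σ * √n * (n * a + 1) ≤ η * (n * a + 1) :=
        mul_le_mul_of_nonneg_right h.σ_le (by positivity)
      nlinarith
    have h5 : η * a + η / n = η * (n * a + 1) / n := by field_simp
    rw [h5, le_div_iff₀ hn]
    exact h4
  linarith

theorem sub_le_up (h : ShadedPair n η σ D E φ) {U : Set ℝ} (hU : IsUpperSet U) :
    D.real U ≤ E.real U + η * D.real U + η / n := by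
  have := h.probD
  have := h.probE
  have h1 := h.close_up _ hU.compl
  rw [compl_compl] at h1
  have h2 := probReal_compl_eq_one_sub (μ := D) hU.measurableSet_real
  have h3 := probReal_compl_eq_one_sub (μ := E) hU.measurableSet_real
  linarith

theorem up_le (h : ShadedPair n η σ D E φ) {U : Set ℝ} (hU : IsUpperSet U) :
    E.real U ≤ D.real U := by
  have := h.probD
  have := h.probE
  have h1 := h.dom _ hU.compl
  have h2 := probReal_compl_eq_one_sub (μ := D) hU.measurableSet_real
  have h3 := probReal_compl_eq_one_sub (μ := E) hU.measurableSet_real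
  linarith

theorem n_pos (h : ShadedPair n η σ D E φ) : 0 < n := lt_of_lt_of_le one_pos h.one_le

theorem measure_le_of_real_le {μ ν : Measure ℝ} [IsFiniteMeasure μ] [IsFiniteMeasure ν] {s : Set ℝ}
    {c : ℝ} (hc : 0 ≤ c) (h : μ.real s ≤ ν.real s + c) : μ s ≤ ν s + ENNReal.ofReal c := by
  rw [← ENNReal.ofReal_toReal (measure_ne_top μ s), ← ENNReal.ofReal_toReal (measure_ne_top ν s),
    ← ENNReal.ofReal_add ENNReal.toReal_nonneg hc]
  exact ENNReal.ofReal_le_ofReal h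

theorem integral_mono_le (h : ShadedPair n η σ D E φ) {f : ℝ → ℝ} (hf : Monotone f)
    (h0 : ∀ x, 0 ≤ f x) {B : ℝ} (hB : ∀ x, f x ≤ B) : ∫ x, f x ∂E ≤ ∫ x, f x ∂D := by
  have := h.probD
  have := h.probE
  have := integral_le_add_of_superlevel (μ := E) (ν := D) hf.measurable h0 hB le_rfl fun u _ =>
    measure_le_of_real_le le_rfl (by simpa using h.up_le (hf.isUpperSet_lt u))
  simpa using this

/-- Layer cake against the measure E + ηD: superlevel sets of f are upper sets, and each level costs
a further η/n. -/
theorem integral_mono_sub_le (h : ShadedPair n η σ D E φ) {f : ℝ → ℝ} (hf : Monotone f)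
    (h0 : ∀ x, 0 ≤ f x) {B : ℝ} (hB : ∀ x, f x ≤ B) :
    ∫ x, f x ∂D ≤ ∫ x, f x ∂E + η * ∫ x, f x ∂D + η / n * B := by
  have := h.probD
  have := h.probE
  have hη := h.η_nonneg
  have hc : 0 ≤ η / n := div_nonneg hη h.n_pos.le
  have hfin : IsFiniteMeasure (E + ENNReal.ofReal η • D) := by
    have : IsFiniteMeasure (ENNReal.ofReal η • D) := D.smul_finite (by simp)
    infer_instance
  have key := integral_le_add_of_superlevel (μ := D) (ν := E + ENNReal.ofReal η • D)
    hf.measurable h0 hB hc fun u _ => measure_le_of_real_le hc (by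
      have h1 := h.sub_le_up (hf.isUpperSet_lt u)
      have h2 : (E + ENNReal.ofReal η • D).real {x | u < f x}
          = E.real {x | u < f x} + η * D.real {x | u < f x} := by
        rw [measureReal_add_apply (by finiteness) (by
          rw [Measure.smul_apply, smul_eq_mul]; finiteness)]
        simp [measureReal_ennreal_smul_apply, ENNReal.toReal_ofReal hη]
      rw [h2]
      exact h1)
  rw [integral_add_measure (hf.integrable_of_bound h0 hB)
    ((hf.integrable_of_bound h0 hB).smul_measure (by simp)), integral_smul_measure,
    ENNReal.toReal_ofReal hη, smul_eq_mul] at key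
  exact key

theorem integral_anti_le (h : ShadedPair n η σ D E φ) {f : ℝ → ℝ} (hf : Antitone f)
    (h0 : ∀ x, 0 ≤ f x) {B : ℝ} (hB : ∀ x, f x ≤ B) : ∫ x, f x ∂D ≤ ∫ x, f x ∂E := by
  have := h.probD
  have := h.probE
  have := integral_le_add_of_superlevel (μ := D) (ν := E) hf.measurable h0 hB le_rfl fun u _ =>
    measure_le_of_real_le le_rfl (by simpa using h.dom _ (hf.isLowerSet_lt u))
  simpa using this

theorem integral_anti_sub_le (h : ShadedPair n η σ D E φ) {f : ℝ → ℝ} (hf : Antitone f)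
    (h0 : ∀ x, 0 ≤ f x) {B : ℝ} (hB : ∀ x, f x ≤ B) :
    ∫ x, f x ∂E ≤ ∫ x, f x ∂D + η * ∫ x, f x ∂E + η / n * B := by
  have := h.probD
  have := h.probE
  have hη := h.η_nonneg
  have hc : 0 ≤ η / n := div_nonneg hη h.n_pos.le
  have hfin : IsFiniteMeasure (D + ENNReal.ofReal η • E) := by
    have : IsFiniteMeasure (ENNReal.ofReal η • E) := E.smul_finite (by simp)
    infer_instance
  have key := integral_le_add_of_superlevel (μ := E) (ν := D + ENNReal.ofReal η • E)
    hf.measurable h0 hB hc fun u _ => measure_le_of_real_le hc (by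
      have h1 := h.sub_le_low (hf.isLowerSet_lt u)
      have h2 : (D + ENNReal.ofReal η • E).real {x | u < f x}
          = D.real {x | u < f x} + η * E.real {x | u < f x} := by
        rw [measureReal_add_apply (by finiteness) (by
          rw [Measure.smul_apply, smul_eq_mul]; finiteness)]
        simp [measureReal_ennreal_smul_apply, ENNReal.toReal_ofReal hη]
      rw [h2]
      exact h1)
  rw [integral_add_measure (hf.integrable_of_bound h0 hB)
    ((hf.integrable_of_bound h0 hB).smul_measure (by simp)), integral_smul_measure,
    ENNReal.toReal_ofReal hη, smul_eq_mul] at key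
  exact key

/-! ### Revenue and virtual welfare -/

theorem integrableOn_price (y : ℝ → ℝ) (hy : Monotone y) (k : ℝ) (μ : Measure ℝ)
    [IsFiniteMeasure μ] :
    IntegrableOn (fun u => postedPrice {w | u < y w} * μ.real {w | u < y w}) (Set.Ioc 0 k) := by
  have := integrable_layer_integral hy.measurable (ψ := fun _ => 1) measurable_const (B := 1)
    (by simp) (measurable_postedPrice_layer y) (C := 1)
    (fun u => by rw [abs_of_nonneg (postedPrice_nonneg _)]; exact postedPrice_le_one _) k μ
  simpa using this

/-- On each layer U the price is at most 1, so the extra sales under D cost at most η D(U) + η/n.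
Integrating D(U) over the layers gives the expected allocation; only the η/n term meets the bound k.
-/
theorem integral_myersonPay_le (h : ShadedPair n η σ D E φ) {y : ℝ → ℝ} (hy : Monotone y)
    (h0 : ∀ v, 0 ≤ y v) {k : ℝ} (hk : ∀ v, y v ≤ k) :
    ∫ v, myersonPay y v ∂D ≤ ∫ v, φ v * y v ∂E + η * ∫ v, y v ∂D + η / n * k := by
  have := h.probD
  have := h.probE
  have hk0 : 0 ≤ k := (h0 0).trans (hk 0)
  have h1 : ∫ v, y v ∂D = ∫ u in Set.Ioc 0 k, D.real {v | u < y v} := by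
    have := integral_mul_eq_layer hy.measurable h0 hk (ψ := fun _ => 1) measurable_const
      (B := 1) (by simp) D
    simpa using this
  have h2 : η / n * k = ∫ _ in Set.Ioc 0 k, η / n := by
    simp [Measure.real, hk0, mul_comm]
  have i1 : IntegrableOn (fun u => ∫ v in {v | u < y v}, φ v ∂E) (Set.Ioc 0 k) := by
    simpa using integrable_layer_integral hy.measurable h.mono.measurable h.abs_le
      (χ := fun _ => 1) measurable_const (C := 1) (by simp) k E
  have i2 : IntegrableOn (fun u => η * D.real {v | u < y v}) (Set.Ioc 0 k) := by
    have := integrable_layer_integral hy.measurable (ψ := fun _ => 1) measurable_const (B := 1)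
      (by simp) (χ := fun _ => η) measurable_const (C := |η|) (by simp) k D
    simpa using this
  have i3 : IntegrableOn (fun _ : ℝ => η / n) (Set.Ioc 0 k) := by simp
  have i12 : IntegrableOn (fun u => (∫ v in {v | u < y v}, φ v ∂E)
      + η * D.real {v | u < y v}) (Set.Ioc 0 k) := i1.add i2
  have i123 : IntegrableOn (fun u => (∫ v in {v | u < y v}, φ v ∂E)
      + η * D.real {v | u < y v} + η / n) (Set.Ioc 0 k) := i12.add i3
  have e1 := integral_add i1 i2
  have e2 := integral_add i12 i3
  rw [integral_myersonPay hy h0 hk h.supp,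
    integral_mul_eq_layer hy.measurable h0 hk h.mono.measurable h.abs_le E, h1, h2,
    ← integral_const_mul, ← e1, ← e2]
  refine integral_mono (integrableOn_price y hy k D) i123 fun u => ?_
  have hU := hy.isUpperSet_lt u
  have h3 := h.price_le _ hU
  have h4 := h.sub_le_up hU
  have h5 := postedPrice_nonneg {w | u < y w}
  have h6 := postedPrice_le_one {w | u < y w}
  have h7 : 0 ≤ η * D.real {w | u < y w} + η / n :=
    add_nonneg (mul_nonneg h.η_nonneg measureReal_nonneg) (div_nonneg h.η_nonneg h.n_pos.le)
  simp only []
  nlinarith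

/-- As y depends only on φ, its layers are unions of level sets of φ, on which posted-price revenue
dominates virtual welfare; under D each layer sells at least as often. -/
theorem le_integral_myersonPay (h : ShadedPair n η σ D E φ) {y : ℝ → ℝ} (hy : Monotone y)
    (h0 : ∀ v, 0 ≤ y v) {k : ℝ} (hk : ∀ v, y v ≤ k) (hφ : ∀ v w, φ v = φ w → y v = y w) :
    ∫ v, φ v * y v ∂E ≤ ∫ v, myersonPay y v ∂D := by
  have := h.probD
  have := h.probE
  have i1 : IntegrableOn (fun u => ∫ v in {v | u < y v}, φ v ∂E) (Set.Ioc 0 k) := by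
    simpa using integrable_layer_integral hy.measurable h.mono.measurable h.abs_le
      (χ := fun _ => 1) measurable_const (C := 1) (by simp) k E
  rw [integral_myersonPay hy h0 hk h.supp,
    integral_mul_eq_layer hy.measurable h0 hk h.mono.measurable h.abs_le E]
  refine integral_mono i1 (integrableOn_price y hy k D) fun u => ?_
  have hU := hy.isUpperSet_lt u
  have h3 := h.le_price _ hU fun v w hvw (hv : u < y v) => (show u < y w from hφ v w hvw ▸ hv)
  exact h3.trans (mul_le_mul_of_nonneg_left (h.up_le hU) (postedPrice_nonneg _))

end ShadedPair


namespace ShadedPair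

variable {n η σ : ℝ} {D E : Measure ℝ} {φ : ℝ → ℝ}

/-! ### Negative virtual values -/

theorem antitone_neg_part (h : ShadedPair n η σ D E φ) (T : ℝ) :
    Antitone fun v => max (-φ v - T) 0 := fun a b hab => by
  have := h.mono hab
  exact max_le_max (by linarith) le_rfl

theorem neg_part_le (h : ShadedPair n η σ D E φ) {T : ℝ} (hT : 0 ≤ T) (v : ℝ) :
    max (-φ v - T) 0 ≤ |φ 0| := by
  refine max_le ?_ (abs_nonneg _)
  have := h.zero_le v
  have := neg_abs_le (φ 0)
  linarith

theorem integral_neg_part_le (h : ShadedPair n η σ D E φ) : ∫ v, max (-φ v) 0 ∂E ≤ 1 := by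
  have := h.probE
  have h1 : ∀ v, max (-φ v) 0 = max (φ v) 0 - φ v := fun v => by
    rcases le_total (φ v) 0 with hv | hv
    · rw [max_eq_left (by linarith), max_eq_right hv]; ring
    · rw [max_eq_right (by linarith), max_eq_left hv]; ring
  simp only [h1]
  rw [integral_sub (h.integrable E).pos_part (h.integrable E), h.integral_eq_zero, sub_zero]
  calc ∫ v, max (φ v) 0 ∂E ≤ ∫ _, (1 : ℝ) ∂E :=
        integral_mono (h.integrable E).pos_part (integrable_const _)
          fun v => max_le (h.le_one v) zero_le_one
    _ = 1 := by simp

theorem measure_neg_lt_le (h : ShadedPair n η σ D E φ) {t : ℝ} (ht : 0 < t) :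
    E.real {v | φ v < -t} ≤ 1 / t := by
  have := h.probE
  have h1 := mul_meas_ge_le_integral_of_nonneg (μ := E)
    (f := fun v => max (-φ v) 0) (Filter.Eventually.of_forall fun v => le_max_right _ _)
    (h.integrable E).neg.pos_part t
  rw [le_div_iff₀ ht, mul_comm]
  refine le_trans (mul_le_mul_of_nonneg_left ?_ ht.le) (h1.trans h.integral_neg_part_le)
  refine measureReal_mono fun v (hv : φ v < -t) => ?_
  exact le_trans (by linarith : t ≤ -φ v) (le_max_left _ _)

theorem isLowerSet_neg_lt (h : ShadedPair n η σ D E φ) (t : ℝ) : IsLowerSet {v | φ v < -t} :=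
  fun _ _ hab hb => lt_of_le_of_lt (h.mono hab) hb

/-- By Markov's inequality {φ < -2} has mass at most 1/2 under E, hence under D. The other half of D
lies above v, where y is at least y v. -/
theorem le_two_mul_integral (h : ShadedPair n η σ D E φ) {y : ℝ → ℝ} (hy : Monotone y)
    (h0 : ∀ v, 0 ≤ y v) {k : ℝ} (hk : ∀ v, y v ≤ k) {v : ℝ} (hv : φ v < -2) :
    y v ≤ 2 * ∫ w, y w ∂D := by
  have := h.probD
  have := h.probE
  have hL := h.isLowerSet_neg_lt 2
  have h1 : D.real {w | φ w < -2} ≤ 1 / 2 :=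
    (h.dom _ hL).trans (h.measure_neg_lt_le two_pos)
  have h2 := probReal_compl_eq_one_sub (μ := D) hL.measurableSet_real
  have h3 : y v * D.real {w | φ w < -2}ᶜ ≤ ∫ w, y w ∂D := by
    calc y v * D.real {w | φ w < -2}ᶜ = ∫ _ in {w | φ w < -2}ᶜ, y v ∂D := by simp [mul_comm]
      _ ≤ ∫ w in {w | φ w < -2}ᶜ, y w ∂D := by
          refine setIntegral_mono_on (by simp) (hy.integrable_of_bound h0 hk).integrableOn
            hL.measurableSet_real.compl fun w hw => hy ?_
          refine le_of_not_gt fun hwv => hw ?_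
          exact lt_of_le_of_lt (h.mono hwv.le) hv
      _ ≤ ∫ w, y w ∂D := setIntegral_le_integral (hy.integrable_of_bound h0 hk)
          (Filter.Eventually.of_forall h0)
  nlinarith [h0 v]

/-- Where φ ≥ -2 the negative part is at most 2. Elsewhere y is at most twice its mean m, and the
negative part has D-integral at most its E-integral, so at most 1. The two regions give 2m each. -/
theorem integral_neg_part_mul_le (h : ShadedPair n η σ D E φ) {y : ℝ → ℝ} (hy : Monotone y)
    (h0 : ∀ v, 0 ≤ y v) {k : ℝ} (hk : ∀ v, y v ≤ k) :
    ∫ v, max (-φ v) 0 * y v ∂D ≤ 4 * ∫ v, y v ∂D := by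
  have := h.probD
  have := h.probE
  set m := ∫ v, y v ∂D
  have hm : 0 ≤ m := integral_nonneg h0
  have hneg : Antitone fun v => max (-φ v) 0 := by simpa using h.antitone_neg_part 0
  have hb : ∀ v, max (-φ v) 0 ≤ |φ 0| := by simpa using h.neg_part_le le_rfl
  have h1 : ∫ v, max (-φ v) 0 ∂D ≤ 1 :=
    (h.integral_anti_le hneg (fun v => le_max_right _ _) hb).trans h.integral_neg_part_le
  have hi := hy.integrable_of_bound (μ := D) h0 hk
  have hin : Integrable (fun v => max (-φ v) 0) D := (h.integrable D).neg.pos_part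
  calc ∫ v, max (-φ v) 0 * y v ∂D
      ≤ ∫ v, (2 * y v + 2 * m * max (-φ v) 0) ∂D := by
        refine integral_mono_of_nonneg (Filter.Eventually.of_forall fun v =>
          mul_nonneg (le_max_right _ _) (h0 v)) ((hi.const_mul 2).add (hin.const_mul (2 * m)))
          (Filter.Eventually.of_forall fun v => ?_)
        have hp : 0 ≤ max (-φ v) 0 := le_max_right _ _
        simp only []
        by_cases hv : φ v < -2
        · have := h.le_two_mul_integral hy h0 hk hv
          have := h0 v
          nlinarith
        · have h2 : max (-φ v) 0 ≤ 2 := max_le (by linarith) (by norm_num)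
          have := mul_le_mul_of_nonneg_right h2 (h0 v)
          have := mul_nonneg (mul_nonneg zero_le_two hm) hp
          linarith
    _ = 2 * m + 2 * m * ∫ v, max (-φ v) 0 ∂D := by
        rw [integral_add (hi.const_mul 2) (hin.const_mul (2 * m)), integral_const_mul,
          integral_const_mul]
    _ ≤ 4 * m := by nlinarith

/-! ### Moderately negative virtual values -/

/-- The truncated φ times y is not monotone, so it is written as f1 - 2y - f3 + f4 with nonnegative
monotone or antitone pieces. The excess r of depth beyond -2 lives where y ≤ 2m, so r y = 2m r -
r(2m - y) is a difference of antitone functions of E-integral at most 2m. Truncation at -2n bounds r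
by 2n, turning their η/n errors into 4ηm. -/
theorem abs_integral_trunc_sub_le (h : ShadedPair n η σ D E φ) {y : ℝ → ℝ} (hy : Monotone y)
    (h0 : ∀ v, 0 ≤ y v) {k : ℝ} (hk : ∀ v, y v ≤ k) :
    |∫ v, max (φ v) (-(2 * n)) * y v ∂E - ∫ v, max (φ v) (-(2 * n)) * y v ∂D|
      ≤ 9 * η * ∫ v, y v ∂D + 3 * (η / n * k) := by
  have := h.probD
  have := h.probE
  have hn := h.one_le
  have hη := h.η_nonneg
  have hk0 : 0 ≤ k := (h0 0).trans (hk 0)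
  set m := ∫ v, y v ∂D with hmdef
  have hm : 0 ≤ m := integral_nonneg h0
  have hc : 0 ≤ η / n * k := mul_nonneg (div_nonneg hη h.n_pos.le) hk0
  set r : ℝ → ℝ := fun v => max (φ v) (-2) - max (φ v) (-(2 * n)) with hr
  have hreq : ∀ v, r v = min (max (-φ v - 2) 0) (2 * n - 2) := by
    intro v
    simp only [hr]
    rcases le_total (φ v) (-2) with h1 | h1
    · rcases le_total (φ v) (-(2 * n)) with h2 | h2
      · rw [max_eq_right h1, max_eq_right h2, max_eq_left (by linarith),
          min_eq_right (by linarith)]; ring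
      · rw [max_eq_right h1, max_eq_left h2, max_eq_left (by linarith),
          min_eq_left (by linarith)]; ring
    · rw [max_eq_left h1, max_eq_left (by linarith), max_eq_right (by linarith),
        min_eq_left (by linarith)]; ring
  have hr0 : ∀ v, 0 ≤ r v := fun v => by
    rw [hreq]; exact le_min (le_max_right _ _) (by linarith)
  have hrT : ∀ v, r v ≤ 2 * n := fun v => by
    rw [hreq]; exact (min_le_right _ _).trans (by linarith)
  have hranti : Antitone r := fun a b hab => by
    rw [hreq, hreq]; exact min_le_min (h.antitone_neg_part 2 hab) le_rfl
  have hrneg : ∀ v, r v ≤ max (-φ v) 0 := fun v => by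
    rw [hreq]; exact (min_le_left _ _).trans (max_le_max (by linarith) le_rfl)
  have hrpos : ∀ v, 0 < r v → y v ≤ 2 * m := fun v hv => by
    refine h.le_two_mul_integral hy h0 hk (lt_of_not_ge fun h2 => ?_)
    rw [hreq, max_eq_right (by linarith), min_eq_left (by linarith)] at hv
    exact lt_irrefl _ hv
  have hIr : ∫ v, r v ∂E ≤ 1 := (integral_mono (hranti.integrable_of_bound hr0 hrT)
    (h.integrable E).neg.pos_part hrneg).trans h.integral_neg_part_le
  set f1 : ℝ → ℝ := fun v => (max (φ v) (-2) + 2) * y v with hf1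
  set f3 : ℝ → ℝ := fun v => r v * (2 * m) with hf3
  set f4 : ℝ → ℝ := fun v => r v * max (2 * m - y v) 0 with hf4
  have hs0 : ∀ v, 0 ≤ max (φ v) (-2) + 2 := fun v => by
    have := le_max_right (φ v) (-2); linarith
  have hs3 : ∀ v, max (φ v) (-2) + 2 ≤ 3 := fun v => by
    have := max_le (h.le_one v) (by norm_num : (-2 : ℝ) ≤ 1); linarith
  have hf1m : Monotone f1 := fun a b hab => by
    refine mul_le_mul ?_ (hy hab) (h0 a) (hs0 b)
    have := max_le_max (h.mono hab) (le_refl (-2 : ℝ)); linarith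
  have hf10 : ∀ v, 0 ≤ f1 v := fun v => mul_nonneg (hs0 v) (h0 v)
  have hf1B : ∀ v, f1 v ≤ 3 * k := fun v => mul_le_mul (hs3 v) (hk v) (h0 v) (by norm_num)
  have hf3a : Antitone f3 := fun a b hab => mul_le_mul_of_nonneg_right (hranti hab) (by linarith)
  have hf30 : ∀ v, 0 ≤ f3 v := fun v => mul_nonneg (hr0 v) (by linarith)
  have hf3B : ∀ v, f3 v ≤ 2 * n * (2 * m) := fun v =>
    mul_le_mul_of_nonneg_right (hrT v) (by linarith)
  have hf4a : Antitone f4 := fun a b hab => by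
    refine mul_le_mul (hranti hab) (max_le_max ?_ le_rfl) (le_max_right _ _) (hr0 a)
    have := hy hab; linarith
  have hf40 : ∀ v, 0 ≤ f4 v := fun v => mul_nonneg (hr0 v) (le_max_right _ _)
  have hf43 : ∀ v, f4 v ≤ f3 v := fun v => by
    refine mul_le_mul_of_nonneg_left (max_le ?_ (by linarith)) (hr0 v)
    have := h0 v; linarith
  have hf4B : ∀ v, f4 v ≤ 2 * n * (2 * m) := fun v => (hf43 v).trans (hf3B v)
  have hdec : ∀ v, max (φ v) (-(2 * n)) * y v = f1 v - 2 * y v - f3 v + f4 v := fun v => by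
    have h1 : r v * y v = f3 v - f4 v := by
      rcases (hr0 v).eq_or_lt with h2 | h2
      · simp only [hf3, hf4, ← h2]; ring
      · have := hrpos v h2
        simp only [hf3, hf4]
        rw [max_eq_left (by linarith)]; ring
    have h2 : max (φ v) (-(2 * n)) = max (φ v) (-2) - r v := by simp only [hr]; ring
    rw [h2, sub_mul, h1]
    simp only [hf1]
    ring
  have hint : ∀ μ : Measure ℝ, IsFiniteMeasure μ → ∫ v, max (φ v) (-(2 * n)) * y v ∂μ
      = ∫ v, f1 v ∂μ - 2 * ∫ v, y v ∂μ - ∫ v, f3 v ∂μ + ∫ v, f4 v ∂μ := fun μ _ => by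
    have i1 := hf1m.integrable_of_bound (μ := μ) hf10 hf1B
    have i2 := (hy.integrable_of_bound (μ := μ) h0 hk).const_mul 2
    have i3 := hf3a.integrable_of_bound (μ := μ) hf30 hf3B
    have i4 := hf4a.integrable_of_bound (μ := μ) hf40 hf4B
    simp only [hdec]
    have i12 : Integrable (fun v => f1 v - 2 * y v) μ := i1.sub i2
    have i123 : Integrable (fun v => f1 v - 2 * y v - f3 v) μ := i12.sub i3
    have e1 := integral_add i123 i4
    have e2 := integral_sub i12 i3
    have e3 := integral_sub i1 i2
    rw [e1, e2, e3, integral_const_mul]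
  rw [hint E inferInstance, hint D inferInstance]
  have a1 := h.integral_mono_le hf1m hf10 hf1B
  have a1' := h.integral_mono_sub_le hf1m hf10 hf1B
  have a2 := h.integral_mono_le hy h0 hk
  have a2' := h.integral_mono_sub_le hy h0 hk
  have a3 := h.integral_anti_le hf3a hf30 hf3B
  have a3' := h.integral_anti_sub_le hf3a hf30 hf3B
  have a4 := h.integral_anti_le hf4a hf40 hf4B
  have a4' := h.integral_anti_sub_le hf4a hf40 hf4B
  have b1 : ∫ v, f1 v ∂D ≤ 3 * m := by
    rw [hmdef, ← integral_const_mul]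
    exact integral_mono (hf1m.integrable_of_bound hf10 hf1B)
      ((hy.integrable_of_bound h0 hk).const_mul 3)
      fun v => mul_le_mul_of_nonneg_right (hs3 v) (h0 v)
  have b3 : ∫ v, f3 v ∂E ≤ 2 * m := by
    simp only [hf3]
    rw [integral_mul_const]
    nlinarith
  have b4 : ∫ v, f4 v ∂E ≤ 2 * m :=
    (integral_mono (hf4a.integrable_of_bound hf40 hf4B)
      (hf3a.integrable_of_bound hf30 hf3B) hf43).trans b3
  have c1 := mul_le_mul_of_nonneg_left b1 hη
  have c3 := mul_le_mul_of_nonneg_left b3 hη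
  have c4 := mul_le_mul_of_nonneg_left b4 hη
  have e1 : η / n * (2 * n * (2 * m)) = 4 * (η * m) := by
    have := h.n_pos.ne'
    field_simp
    ring
  rw [e1] at a3' a4'
  have e2 : η / n * (3 * k) = 3 * (η / n * k) := by ring
  rw [e2] at a1'
  have hηm : 0 ≤ η * m := mul_nonneg hη hm
  rw [_root_.abs_le]
  constructor <;> linarith

end ShadedPair


/-! ### Trimming the very negative virtual values -/

/-- The weight trimmed from the value distribution `D` at `v`, at level `l` of the negative virtual
values. -/
noncomputable def levelTrim (σ : ℝ) (D : Measure ℝ) (φ : ℝ → ℝ) (l v : ℝ) : ENNReal :=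
  {w | φ w < -l}.indicator
    (topWeight (D.restrict {w | φ w < -l}) (ENNReal.ofReal (σ / √l))) v

/-- The total weight trimmed from `D` at `v`, over all levels above `T`. -/
noncomputable def trim (T σ : ℝ) (D : Measure ℝ) (φ : ℝ → ℝ) (v : ℝ) : ENNReal :=
  ∫⁻ l in Set.Ioi T, levelTrim σ D φ l v

/-- The part of the virtual value `φ v` below `-T`. -/
noncomputable def deepPart (T : ℝ) (φ : ℝ → ℝ) (v : ℝ) : ℝ := max (-φ v - T) 0

/-- The density with respect to `D` of the trimmed distribution. -/
noncomputable def trimDensity (T σ : ℝ) (D : Measure ℝ) (φ : ℝ → ℝ) (v : ℝ) : ℝ :=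
  1 - (trim T σ D φ v).toReal / (T + deepPart T φ v)

theorem measurable_levelTrim (σ : ℝ) (D : Measure ℝ) [IsFiniteMeasure D] {φ : ℝ → ℝ}
    (hφ : Measurable φ) : Measurable fun p : ℝ × ℝ => levelTrim σ D φ p.1 p.2 := by
  have hm1 : MeasurableSet {q : (ℝ × ℝ) × ℝ | q.1.2 < q.2 ∧ φ q.2 < -q.1.1} :=
    MeasurableSet.inter
      (measurableSet_lt (measurable_snd.comp measurable_fst) measurable_snd)
      (measurableSet_lt (hφ.comp measurable_snd) (measurable_fst.comp measurable_fst).neg)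
  have hm2 : MeasurableSet {q : (ℝ × ℝ) × ℝ | q.1.2 ≤ q.2 ∧ φ q.2 < -q.1.1} :=
    MeasurableSet.inter
      (measurableSet_le (measurable_snd.comp measurable_fst) measurable_snd)
      (measurableSet_lt (hφ.comp measurable_snd) (measurable_fst.comp measurable_fst).neg)
  have h1 : Measurable fun p : ℝ × ℝ => D.restrict {w | φ w < -p.1} (Set.Ioi p.2) := by
    have := measurable_measure_prodMk_left (ν := D) hm1
    convert this using 2 with p
    rw [Measure.restrict_apply measurableSet_Ioi]
    rfl
  have h2 : Measurable fun p : ℝ × ℝ => D.restrict {w | φ w < -p.1} (Set.Ici p.2) := by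
    have := measurable_measure_prodMk_left (ν := D) hm2
    convert this using 2 with p
    rw [Measure.restrict_apply measurableSet_Ici]
    rfl
  have h3 : Measurable fun p : ℝ × ℝ => ENNReal.ofReal (σ / √p.1) := by fun_prop
  have h4 : Measurable fun p : ℝ × ℝ =>
      topWeight (D.restrict {w | φ w < -p.1}) (ENNReal.ofReal (σ / √p.1)) p.2 :=
    Measurable.ite (measurableSet_le h1 h3) (measurable_const.min (h3.div h2)) measurable_const
  have h5 : MeasurableSet {p : ℝ × ℝ | φ p.2 < -p.1} :=
    measurableSet_lt (by fun_prop) (by fun_prop)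
  convert h4.indicator h5 using 2 with p
  by_cases hp : φ p.2 < -p.1
  · rw [Set.indicator_of_mem (show p ∈ {p : ℝ × ℝ | φ p.2 < -p.1} from hp), levelTrim,
      Set.indicator_of_mem (show p.2 ∈ {w | φ w < -p.1} from hp)]
  · rw [Set.indicator_of_notMem (show p ∉ {p : ℝ × ℝ | φ p.2 < -p.1} from hp), levelTrim,
      Set.indicator_of_notMem (show p.2 ∉ {w | φ w < -p.1} from hp)]

theorem measurable_level {φ : ℝ → ℝ} (hφ : Measurable φ) :
    Measurable fun p : ℝ × ℝ => {w | φ w < -p.1}.indicator (1 : ℝ → ENNReal) p.2 := by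
  have h5 : MeasurableSet {p : ℝ × ℝ | φ p.2 < -p.1} :=
    measurableSet_lt (by fun_prop) (by fun_prop)
  convert (measurable_const (a := (1 : ENNReal))).indicator h5 using 2 with p
  by_cases hp : φ p.2 < -p.1
  · rw [Set.indicator_of_mem (show p ∈ {p : ℝ × ℝ | φ p.2 < -p.1} from hp),
      Set.indicator_of_mem (show p.2 ∈ {w | φ w < -p.1} from hp)]; rfl
  · rw [Set.indicator_of_notMem (show p ∉ {p : ℝ × ℝ | φ p.2 < -p.1} from hp),
      Set.indicator_of_notMem (show p.2 ∉ {w | φ w < -p.1} from hp)]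

theorem measurable_trim (T σ : ℝ) (D : Measure ℝ) [IsFiniteMeasure D] {φ : ℝ → ℝ}
    (hφ : Measurable φ) : Measurable (trim T σ D φ) :=
  Measurable.lintegral_prod_right'
    (f := fun p : ℝ × ℝ => levelTrim σ D φ p.2 p.1)
    ((measurable_levelTrim σ D hφ).comp measurable_swap)

/-- Layer cake for the deep part: it is the length of the set of levels l above T with φ v < -l. -/
theorem lintegral_level_eq (T : ℝ) (φ : ℝ → ℝ) (v : ℝ) :
    ∫⁻ l in Set.Ioi T, {w | φ w < -l}.indicator (1 : ℝ → ENNReal) v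
      = ENNReal.ofReal (deepPart T φ v) := by
  have h1 : ∀ l, {w | φ w < -l}.indicator (1 : ℝ → ENNReal) v
      = (Set.Iio (-φ v)).indicator (fun _ => 1) l := fun l => by
    by_cases h : φ v < -l
    · rw [Set.indicator_of_mem (show v ∈ {w | φ w < -l} from h),
        Set.indicator_of_mem (show l ∈ Set.Iio (-φ v) from lt_neg_of_lt_neg h)]; rfl
    · rw [Set.indicator_of_notMem (show v ∉ {w | φ w < -l} from h),
        Set.indicator_of_notMem (show l ∉ Set.Iio (-φ v) from fun h' => h (lt_neg_of_lt_neg h'))]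
  simp only [h1]
  rw [lintegral_indicator measurableSet_Iio, setLIntegral_const, one_mul,
    Measure.restrict_apply measurableSet_Iio, Set.inter_comm, Set.Ioi_inter_Iio, Real.volume_Ioo,
    deepPart]
  rcases le_total (-φ v - T) 0 with h | h
  · rw [max_eq_right h, ENNReal.ofReal_of_nonpos h, ENNReal.ofReal_zero]
  · rw [max_eq_left h]

theorem levelTrim_le (σ : ℝ) (D : Measure ℝ) (φ : ℝ → ℝ) (l v : ℝ) :
    levelTrim σ D φ l v ≤ {w | φ w < -l}.indicator (1 : ℝ → ENNReal) v :=
  Set.indicator_le_indicator (topWeight_le_one _ _ _)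

theorem trim_le (T σ : ℝ) (D : Measure ℝ) (φ : ℝ → ℝ) (v : ℝ) :
    trim T σ D φ v ≤ ENNReal.ofReal (deepPart T φ v) := by
  rw [← lintegral_level_eq]
  exact lintegral_mono fun l => levelTrim_le σ D φ l v

theorem trim_ne_top (T σ : ℝ) (D : Measure ℝ) (φ : ℝ → ℝ) (v : ℝ) : trim T σ D φ v ≠ ⊤ :=
  ((trim_le T σ D φ v).trans_lt ENNReal.ofReal_lt_top).ne

theorem deepPart_nonneg (T : ℝ) (φ : ℝ → ℝ) (v : ℝ) : 0 ≤ deepPart T φ v := le_max_right _ _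

theorem toReal_trim_le (T σ : ℝ) (D : Measure ℝ) (φ : ℝ → ℝ) (v : ℝ) :
    (trim T σ D φ v).toReal ≤ deepPart T φ v :=
  ENNReal.toReal_le_of_le_ofReal (deepPart_nonneg _ _ _) (trim_le T σ D φ v)

theorem trimDensity_pos {T : ℝ} (hT : 0 < T) (σ : ℝ) (D : Measure ℝ) (φ : ℝ → ℝ) (v : ℝ) :
    0 < trimDensity T σ D φ v := by
  have h1 := toReal_trim_le T σ D φ v
  have h2 := deepPart_nonneg T φ v
  rw [trimDensity, sub_pos, div_lt_one (by linarith)]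
  linarith

theorem trimDensity_le_one {T : ℝ} (hT : 0 < T) (σ : ℝ) (D : Measure ℝ) (φ : ℝ → ℝ) (v : ℝ) :
    trimDensity T σ D φ v ≤ 1 := by
  have h2 := deepPart_nonneg T φ v
  have : 0 ≤ (trim T σ D φ v).toReal / (T + deepPart T φ v) :=
    div_nonneg ENNReal.toReal_nonneg (by linarith)
  rw [trimDensity]
  linarith

theorem measurable_deepPart (T : ℝ) {φ : ℝ → ℝ} (hφ : Measurable φ) :
    Measurable (deepPart T φ) := by
  unfold deepPart
  fun_prop

theorem measurable_trimDensity (T σ : ℝ) (D : Measure ℝ) [IsFiniteMeasure D] {φ : ℝ → ℝ}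
    (hφ : Measurable φ) : Measurable (trimDensity T σ D φ) :=
  measurable_const.sub ((measurable_trim T σ D hφ).ennreal_toReal.div
    (measurable_const.add (measurable_deepPart T hφ)))

/-- Below -T the denominator of the density is exactly -φ, so multiplying φ by the density adds back
exactly the trimmed weight. The density is chosen for this identity. -/
theorem trimDensity_mul {T : ℝ} (hT : 0 < T) (σ : ℝ) (D : Measure ℝ) (φ : ℝ → ℝ) (v : ℝ) :
    trimDensity T σ D φ v * φ v
      = max (φ v) (-T) - deepPart T φ v + (trim T σ D φ v).toReal := by
  rw [trimDensity]
  rcases le_total (-φ v - T) 0 with h | h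
  · have h1 := toReal_trim_le T σ D φ v
    have h3 : deepPart T φ v = 0 := max_eq_right h
    have h2 : (trim T σ D φ v).toReal = 0 :=
      le_antisymm (h3 ▸ h1) ENNReal.toReal_nonneg
    rw [h2, h3, max_eq_left (by linarith)]
    ring
  · have h3 : deepPart T φ v = -φ v - T := max_eq_left h
    rw [h3, max_eq_right (by linarith)]
    have : φ v ≠ 0 := by intro h0; rw [h0] at h; linarith
    have h4 : T + (-φ v - T) = -φ v := by ring
    rw [h4]
    field_simp
    ring

theorem lintegral_lintegral_mul_swap {W : ℝ → ℝ → ENNReal}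
    (hW : Measurable fun p : ℝ × ℝ => W p.1 p.2) (T : ℝ) (μ : Measure ℝ) [IsFiniteMeasure μ]
    {f : ℝ → ENNReal} (hf : Measurable f) :
    ∫⁻ v, (∫⁻ l in Set.Ioi T, W l v) * f v ∂μ = ∫⁻ l in Set.Ioi T, (∫⁻ v, W l v * f v ∂μ) := by
  have h1 : ∀ v, Measurable fun l => W l v := fun v =>
    hW.comp measurable_prodMk_right
  have h2 : ∀ v, (∫⁻ l in Set.Ioi T, W l v) * f v = ∫⁻ l in Set.Ioi T, W l v * f v := fun v =>
    (lintegral_mul_const _ (h1 v)).symm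
  simp_rw [h2]
  refine lintegral_lintegral_swap (f := fun v l => W l v * f v) ?_
  have : Measurable fun p : ℝ × ℝ => W p.2 p.1 * f p.1 :=
    (hW.comp measurable_swap).mul (hf.comp measurable_fst)
  exact this.aemeasurable

theorem lintegral_Ioi_div_sqrt_mul {T σ : ℝ} (hT : 0 < T) (hσ : 0 ≤ σ) :
    ∫⁻ l in Set.Ioi T, ENNReal.ofReal (σ / √l / l) = ENNReal.ofReal (2 * σ / √T) := by
  have h1 : ∀ l ∈ Set.Ioi T, σ / √l / l = σ * l ^ (-(3 / 2) : ℝ) := fun l hl => by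
    have hl0 : 0 < l := hT.trans hl
    rw [Real.rpow_neg hl0.le, div_div, div_eq_mul_inv]
    congr 2
    rw [Real.sqrt_eq_rpow, ← Real.rpow_add_one hl0.ne']
    norm_num
  have hi : IntegrableOn (fun l : ℝ => σ * l ^ (-(3 / 2) : ℝ)) (Set.Ioi T) :=
    (integrableOn_Ioi_rpow_of_lt (by norm_num) hT).const_mul σ
  rw [setLIntegral_congr_fun measurableSet_Ioi fun l hl => by rw [h1 l hl],
    ← ofReal_integral_eq_lintegral_ofReal hi]
  · congr 1
    rw [integral_const_mul, integral_Ioi_rpow_of_lt (by norm_num) hT, Real.sqrt_eq_rpow]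
    have : T ^ (-(3 / 2) + 1 : ℝ) = (T ^ (1 / 2 : ℝ))⁻¹ := by
      rw [← Real.rpow_neg hT.le]; norm_num
    rw [this]
    ring
  · refine (ae_restrict_iff' measurableSet_Ioi).2 (Filter.Eventually.of_forall fun l hl => ?_)
    exact mul_nonneg hσ (Real.rpow_nonneg (hT.trans hl).le _)

/-! ### What trimming achieves on very negative virtual values -/

namespace ShadedPair

variable {n η σ : ℝ} {D E : Measure ℝ} {φ : ℝ → ℝ}

/-- The negative part of φ has E-integral at most 1, so E(L) ≤ 1/l, and `close_low` improves to
σ/√l. This decay in l makes the errors summable over levels. -/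
theorem close_low_of_subset (h : ShadedPair n η σ D E φ) {l : ℝ} (hl : 0 < l) {L : Set ℝ}
    (hL : IsLowerSet L) (hsub : L ⊆ {v | φ v < -l}) : E.real L ≤ D.real L + σ / √l := by
  have := h.probE
  refine (h.close_low L hL).trans ?_
  have h1 : E.real L ≤ 1 / l := (measureReal_mono hsub).trans (h.measure_neg_lt_le hl)
  have h2 : √(E.real L) ≤ 1 / √l := by
    rw [← Real.sqrt_one, ← Real.sqrt_div zero_le_one]; exact Real.sqrt_le_sqrt (by simpa using h1)
  have := mul_le_mul_of_nonneg_left h2 h.σ_nonneg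
  rw [mul_one_div] at this
  linarith

/-- A slice of a lower set L by U is neither lower nor upper, so domination says nothing about it
directly. It is the difference of the lower sets L and L \ U; closeness is applied to one and
domination to the other. -/
theorem abs_level_sub_le (h : ShadedPair n η σ D E φ) {l : ℝ} (hl : 0 < l) {U : Set ℝ}
    (hU : IsUpperSet U) :
    D.real ({v | φ v < -l} ∩ U) ≤ E.real ({v | φ v < -l} ∩ U) + σ / √l ∧
      E.real ({v | φ v < -l} ∩ U) ≤ D.real ({v | φ v < -l} ∩ U) + σ / √l := by
  have := h.probD
  have := h.probE
  have hL := h.isLowerSet_neg_lt l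
  set L := {v | φ v < -l}
  have hLU : IsLowerSet (L \ U) := by
    rw [Set.sdiff_eq]; exact hL.inter hU.compl
  have e1 := measureReal_inter_add_sdiff (μ := D) (s := L) hU.measurableSet_real
  have e2 := measureReal_inter_add_sdiff (μ := E) (s := L) hU.measurableSet_real
  have a1 := h.close_low_of_subset hl hLU Set.sdiff_subset
  have a2 := h.close_low_of_subset hl hL subset_rfl
  have b1 := h.dom _ hL
  have b2 := h.dom _ hLU
  constructor <;> linarith

/-- On a slice D exceeds E by at most σ/√l, while trimming removes that much or the whole D-mass of
the slice. So trimmed D lies below E on all slices, and no decay or bound for z enters: this is what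
the competing allocation needs. -/
theorem lintegral_level_mul_le (h : ShadedPair n η σ D E φ) {l : ℝ} (hl : 0 < l) {z : ℝ → ℝ}
    (hz : Monotone z) (h0 : ∀ v, 0 ≤ z v) :
    ∫⁻ v, {w | φ w < -l}.indicator (1 : ℝ → ENNReal) v * ENNReal.ofReal (z v) ∂D
      ≤ ∫⁻ v, {w | φ w < -l}.indicator (1 : ℝ → ENNReal) v * ENNReal.ofReal (z v) ∂E
        + ∫⁻ v, levelTrim σ D φ l v * ENNReal.ofReal (z v) ∂D := by
  have := h.probD
  have := h.probE
  have hL := h.isLowerSet_neg_lt l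
  have hzm : Measurable fun v => ENNReal.ofReal (z v) := hz.measurable.ennreal_ofReal
  have e1 : ∀ μ : Measure ℝ,
      ∫⁻ v, {w | φ w < -l}.indicator (1 : ℝ → ENNReal) v * ENNReal.ofReal (z v) ∂μ
        = ∫⁻ v in {w | φ w < -l}, ENNReal.ofReal (z v) ∂μ := fun μ => by
    rw [← lintegral_indicator hL.measurableSet_real]
    congr 1
    ext v
    by_cases hv : v ∈ {w | φ w < -l}
    · simp [Set.indicator_of_mem hv]
    · simp [Set.indicator_of_notMem hv]
  set ρ := ENNReal.ofReal (σ / √l) with hρ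
  set κ := topWeight (D.restrict {w | φ w < -l}) ρ with hκ
  have hκm : Measurable κ := measurable_topWeight _ _
  have e2 : ∫⁻ v, levelTrim σ D φ l v * ENNReal.ofReal (z v) ∂D
      = ∫⁻ v, ENNReal.ofReal (z v) ∂((D.restrict {w | φ w < -l}).withDensity κ) := by
    rw [lintegral_withDensity_eq_lintegral_mul _ hκm hzm, ← lintegral_indicator hL.measurableSet_real]
    congr 1
    ext v
    by_cases hv : v ∈ {w | φ w < -l}
    · simp only [levelTrim, Set.indicator_of_mem hv]; rfl
    · simp only [levelTrim, Set.indicator_of_notMem hv, zero_mul]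
  rw [e1, e1, e2, ← lintegral_add_measure]
  refine lintegral_le_of_superlevel hz.measurable h0 fun u _ => ?_
  set U := {v | u < z v}
  have hU : IsUpperSet U := hz.isUpperSet_lt u
  have hUm := hU.measurableSet_real
  rw [Measure.add_apply, Measure.restrict_apply hUm, Measure.restrict_apply hUm,
    withDensity_apply _ hUm]
  have hmin := min_le_lintegral_topWeight (D.restrict {w | φ w < -l}) (ρ := ρ)
    ENNReal.ofReal_ne_top hU
  rw [Measure.restrict_apply hUm] at hmin
  refine le_trans ?_ (add_le_add_right hmin _)
  rcases le_total (D (U ∩ {w | φ w < -l})) ρ with hc | hc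
  · rw [min_eq_left hc]; exact le_add_self
  · rw [min_eq_right hc, Set.inter_comm]
    exact measure_le_of_real_le (div_nonneg h.σ_nonneg (Real.sqrt_nonneg _))
      (h.abs_level_sub_le hl hU).1

theorem lintegral_deepPart_mul (h : ShadedPair n η σ D E φ) (T : ℝ) (μ : Measure ℝ)
    [IsFiniteMeasure μ] {f : ℝ → ENNReal} (hf : Measurable f) :
    ∫⁻ v, ENNReal.ofReal (deepPart T φ v) * f v ∂μ
      = ∫⁻ l in Set.Ioi T, (∫⁻ v, {w | φ w < -l}.indicator (1 : ℝ → ENNReal) v * f v ∂μ) := by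
  rw [← lintegral_lintegral_mul_swap (measurable_level h.mono.measurable) T μ hf]
  simp only [lintegral_level_eq]

theorem deepPart_le (h : ShadedPair n η σ D E φ) {T : ℝ} (hT : 0 ≤ T) (v : ℝ) :
    deepPart T φ v ≤ |φ 0| := h.neg_part_le hT v

theorem integrable_mul_mono {ψ : ℝ → ℝ} (hψ : Measurable ψ) {C : ℝ}
    (hψ0 : ∀ v, 0 ≤ ψ v) (hψC : ∀ v, ψ v ≤ C) {z : ℝ → ℝ}
    (hz : Monotone z) (h0 : ∀ v, 0 ≤ z v) {B : ℝ} (hB : ∀ v, z v ≤ B) (μ : Measure ℝ)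
    [IsFiniteMeasure μ] : Integrable (fun v => ψ v * z v) μ :=
  Integrable.of_bound (hψ.mul hz.measurable).aestronglyMeasurable (C * B)
    (Filter.Eventually.of_forall fun v => by
      rw [Real.norm_of_nonneg (mul_nonneg (hψ0 v) (h0 v))]
      exact mul_le_mul (hψC v) (hB v) (h0 v) ((hψ0 v).trans (hψC v)))

theorem measurable_trim_toReal (h : ShadedPair n η σ D E φ) (T : ℝ) :
    Measurable fun v => (trim T σ D φ v).toReal := by
  have := h.probD
  exact (measurable_trim T σ D h.mono.measurable).ennreal_toReal

theorem integral_deepPart_mul_le (h : ShadedPair n η σ D E φ) {T : ℝ} (hT : 0 < T) {z : ℝ → ℝ}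
    (hz : Monotone z) (h0 : ∀ v, 0 ≤ z v) {B : ℝ} (hB : ∀ v, z v ≤ B) :
    ∫ v, deepPart T φ v * z v ∂D
      ≤ ∫ v, deepPart T φ v * z v ∂E + ∫ v, (trim T σ D φ v).toReal * z v ∂D := by
  have := h.probD
  have := h.probE
  have hzm : Measurable fun v => ENNReal.ofReal (z v) := hz.measurable.ennreal_ofReal
  have hgm := measurable_deepPart T h.mono.measurable
  have hg0 := deepPart_nonneg T φ
  have i1 := fun μ (_ : IsFiniteMeasure μ) =>
    integrable_mul_mono hgm hg0 (h.deepPart_le hT.le) hz h0 hB μ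
  have i2 := integrable_mul_mono (h.measurable_trim_toReal T) (fun _ => ENNReal.toReal_nonneg)
    (fun v => (toReal_trim_le T σ D φ v).trans (h.deepPart_le hT.le v)) hz h0 hB D
  have key : ∫⁻ v, ENNReal.ofReal (deepPart T φ v) * ENNReal.ofReal (z v) ∂D
      ≤ ∫⁻ v, ENNReal.ofReal (deepPart T φ v) * ENNReal.ofReal (z v) ∂E
        + ∫⁻ v, trim T σ D φ v * ENNReal.ofReal (z v) ∂D := by
    rw [h.lintegral_deepPart_mul T D hzm, h.lintegral_deepPart_mul T E hzm]
    simp only [trim]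
    rw [lintegral_lintegral_mul_swap (measurable_levelTrim σ D h.mono.measurable) T D hzm,
      ← lintegral_add_right]
    · exact setLIntegral_mono' measurableSet_Ioi fun l hl =>
        h.lintegral_level_mul_le (hT.trans hl) hz h0
    · exact Measurable.lintegral_prod_right' (f := fun p : ℝ × ℝ => levelTrim σ D φ p.1 p.2 *
        ENNReal.ofReal (z p.2)) ((measurable_levelTrim σ D h.mono.measurable).mul
        (hzm.comp measurable_snd))
  have e1 : ∀ μ : Measure ℝ, IsFiniteMeasure μ →
      ∫⁻ v, ENNReal.ofReal (deepPart T φ v) * ENNReal.ofReal (z v) ∂μ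
        = ENNReal.ofReal (∫ v, deepPart T φ v * z v ∂μ) := fun μ hμ => by
    rw [ofReal_integral_eq_lintegral_ofReal (i1 μ hμ)
      (Filter.Eventually.of_forall fun v => mul_nonneg (hg0 v) (h0 v))]
    simp only [ENNReal.ofReal_mul (hg0 _)]
  have e2 : ∫⁻ v, trim T σ D φ v * ENNReal.ofReal (z v) ∂D
      = ENNReal.ofReal (∫ v, (trim T σ D φ v).toReal * z v ∂D) := by
    rw [ofReal_integral_eq_lintegral_ofReal i2
      (Filter.Eventually.of_forall fun v => mul_nonneg ENNReal.toReal_nonneg (h0 v))]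
    simp only [ENNReal.ofReal_mul ENNReal.toReal_nonneg, ENNReal.ofReal_toReal (trim_ne_top _ _ _ _ _)]
  have p1 : 0 ≤ ∫ v, deepPart T φ v * z v ∂E := integral_nonneg fun v => mul_nonneg (hg0 v) (h0 v)
  have p2 : 0 ≤ ∫ v, (trim T σ D φ v).toReal * z v ∂D :=
    integral_nonneg fun v => mul_nonneg ENNReal.toReal_nonneg (h0 v)
  rw [e1 D inferInstance, e1 E inferInstance, e2, ← ENNReal.ofReal_add p1 p2] at key
  exact (ENNReal.ofReal_le_ofReal_iff (add_nonneg p1 p2)).1 key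

/-- For the optimal rule decay is available: where φ < -l it gives u ≤ Y/l, so u may be capped at
Y/l, and a discrepancy σ/√l between E and D costs at most (Y/l)(σ/√l), which is integrable in l. -/
theorem lintegral_level_mul_le' (h : ShadedPair n η σ D E φ) {l : ℝ} (hl : 0 < l) {u : ℝ → ℝ}
    (hu : Monotone u) (h0 : ∀ v, 0 ≤ u v) {Y : ℝ} (hY0 : 0 ≤ Y)
    (hY : ∀ v, φ v < -l → u v * (-φ v) ≤ Y) :
    ∫⁻ v, {w | φ w < -l}.indicator (1 : ℝ → ENNReal) v * ENNReal.ofReal (u v) ∂E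
      ≤ ∫⁻ v, {w | φ w < -l}.indicator (1 : ℝ → ENNReal) v * ENNReal.ofReal (u v) ∂D
        + ENNReal.ofReal (Y * (σ / √l / l)) := by
  have := h.probD
  have := h.probE
  have hL := h.isLowerSet_neg_lt l
  have hB : 0 ≤ Y / l := div_nonneg hY0 hl.le
  have hρ : 0 ≤ σ / √l := div_nonneg h.σ_nonneg (Real.sqrt_nonneg _)
  set f : ℝ → ℝ := fun v => min (u v) (Y / l) with hf
  have hfm : Monotone f := fun a b hab => min_le_min (hu hab) le_rfl
  have hf0 : ∀ v, 0 ≤ f v := fun v => le_min (h0 v) hB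
  have hfB : ∀ v, f v ≤ Y / l := fun v => min_le_right _ _
  have e1 : ∀ μ : Measure ℝ, IsFiniteMeasure μ →
      ∫⁻ v, {w | φ w < -l}.indicator (1 : ℝ → ENNReal) v * ENNReal.ofReal (u v) ∂μ
        = ENNReal.ofReal (∫ v, f v ∂(μ.restrict {w | φ w < -l})) := fun μ hμ => by
    rw [ofReal_integral_eq_lintegral_ofReal (hfm.integrable_of_bound hf0 hfB)
      (Filter.Eventually.of_forall hf0), ← lintegral_indicator hL.measurableSet_real]
    congr 1
    ext v
    by_cases hv : v ∈ {w | φ w < -l}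
    · have hφ : φ v < -l := hv
      simp only [Set.indicator_of_mem hv, Pi.one_apply, one_mul]
      have : u v ≤ Y / l := by
        rw [le_div_iff₀ hl]
        exact (mul_le_mul_of_nonneg_left (by linarith) (h0 v)).trans (hY v hφ)
      simp only [hf, min_eq_left this]
    · simp [Set.indicator_of_notMem hv]
  have key := integral_le_add_of_superlevel (μ := E.restrict {w | φ w < -l})
    (ν := D.restrict {w | φ w < -l}) hfm.measurable hf0 hfB hρ fun t _ => by
      have hU : IsUpperSet {x | t < f x} := hfm.isUpperSet_lt t
      rw [Measure.restrict_apply hU.measurableSet_real, Measure.restrict_apply hU.measurableSet_real,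
        Set.inter_comm]
      exact measure_le_of_real_le hρ (h.abs_level_sub_le hl hU).2
  rw [e1 E inferInstance, e1 D inferInstance,
    ← ENNReal.ofReal_add (integral_nonneg hf0) (by positivity)]
  refine ENNReal.ofReal_le_ofReal (key.trans (le_of_eq ?_))
  ring

theorem integral_deepPart_mul_le' (h : ShadedPair n η σ D E φ) {T : ℝ} (hT : 0 < T) {u : ℝ → ℝ}
    (hu : Monotone u) (h0 : ∀ v, 0 ≤ u v) {B : ℝ} (hB : ∀ v, u v ≤ B) {Y : ℝ} (hY0 : 0 ≤ Y)
    (hY : ∀ v, φ v < -T → u v * (-φ v) ≤ Y) :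
    ∫ v, deepPart T φ v * u v ∂E ≤ ∫ v, deepPart T φ v * u v ∂D + Y * (2 * σ / √T) := by
  have := h.probD
  have := h.probE
  have hum : Measurable fun v => ENNReal.ofReal (u v) := hu.measurable.ennreal_ofReal
  have hgm := measurable_deepPart T h.mono.measurable
  have hg0 := deepPart_nonneg T φ
  have i1 := fun μ (_ : IsFiniteMeasure μ) =>
    integrable_mul_mono hgm hg0 (h.deepPart_le hT.le) hu h0 hB μ
  have p2 : 0 ≤ Y * (2 * σ / √T) :=
    mul_nonneg hY0 (div_nonneg (mul_nonneg zero_le_two h.σ_nonneg) (Real.sqrt_nonneg _))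
  have key : ∫⁻ v, ENNReal.ofReal (deepPart T φ v) * ENNReal.ofReal (u v) ∂E
      ≤ ∫⁻ v, ENNReal.ofReal (deepPart T φ v) * ENNReal.ofReal (u v) ∂D
        + ENNReal.ofReal (Y * (2 * σ / √T)) := by
    rw [h.lintegral_deepPart_mul T D hum, h.lintegral_deepPart_mul T E hum, ENNReal.ofReal_mul hY0,
      ← lintegral_Ioi_div_sqrt_mul hT h.σ_nonneg, ← lintegral_const_mul' _ _ ENNReal.ofReal_ne_top,
      ← lintegral_add_right _ (by fun_prop)]
    refine setLIntegral_mono' measurableSet_Ioi fun l hl => ?_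
    rw [← ENNReal.ofReal_mul hY0]
    exact h.lintegral_level_mul_le' (hT.trans hl) hu h0 hY0 fun v hv =>
      hY v (hv.trans (neg_lt_neg hl))
  have e1 : ∀ μ : Measure ℝ, IsFiniteMeasure μ →
      ∫⁻ v, ENNReal.ofReal (deepPart T φ v) * ENNReal.ofReal (u v) ∂μ
        = ENNReal.ofReal (∫ v, deepPart T φ v * u v ∂μ) := fun μ hμ => by
    rw [ofReal_integral_eq_lintegral_ofReal (i1 μ hμ)
      (Filter.Eventually.of_forall fun v => mul_nonneg (hg0 v) (h0 v))]
    simp only [ENNReal.ofReal_mul (hg0 _)]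
  have p1 : 0 ≤ ∫ v, deepPart T φ v * u v ∂D := integral_nonneg fun v => mul_nonneg (hg0 v) (h0 v)
  rw [e1 D inferInstance, e1 E inferInstance, ← ENNReal.ofReal_add p1 p2] at key
  exact (ENNReal.ofReal_le_ofReal_iff (add_nonneg p1 p2)).1 key

theorem integrable_one_sub_trimDensity (h : ShadedPair n η σ D E φ) {T : ℝ} (hT : 0 < T) :
    Integrable (fun v => 1 - trimDensity T σ D φ v) D := by
  have := h.probD
  refine Integrable.of_bound (measurable_const.sub
    (measurable_trimDensity T σ D h.mono.measurable)).aestronglyMeasurable 1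
    (Filter.Eventually.of_forall fun v => ?_)
  have h1 := trimDensity_pos hT σ D φ v
  have h2 := trimDensity_le_one hT σ D φ v
  rw [Real.norm_of_nonneg (by linarith)]
  linarith

/-- The density removed is trim/(-φ). Level l contributes with 1/(-φ) ≤ 1/l and trims at most 2σ/√l,
so the total is at most 2σ times the integral of l^(-3/2) over l > T. -/
theorem integral_one_sub_trimDensity_le (h : ShadedPair n η σ D E φ) {T : ℝ} (hT : 0 < T) :
    ∫ v, (1 - trimDensity T σ D φ v) ∂D ≤ 2 * (2 * σ / √T) := by
  have := h.probD
  have hp : 0 ≤ 2 * (2 * σ / √T) :=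
    mul_nonneg zero_le_two (div_nonneg (mul_nonneg zero_le_two h.σ_nonneg) (Real.sqrt_nonneg _))
  have h1 : ∀ v, 0 ≤ 1 - trimDensity T σ D φ v := fun v => by
    have := trimDensity_le_one hT σ D φ v; linarith
  rw [← ENNReal.ofReal_le_ofReal_iff hp,
    ofReal_integral_eq_lintegral_ofReal (h.integrable_one_sub_trimDensity hT)
      (Filter.Eventually.of_forall h1)]
  have h2 : ∀ v, ENNReal.ofReal (1 - trimDensity T σ D φ v)
      ≤ ∫⁻ l in Set.Ioi T, levelTrim σ D φ l v * ENNReal.ofReal l⁻¹ := fun v => by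
    have hg := deepPart_nonneg T φ v
    have e : 1 - trimDensity T σ D φ v
        = (trim T σ D φ v).toReal * (T + deepPart T φ v)⁻¹ := by
      rw [trimDensity]; ring
    rw [e, ENNReal.ofReal_mul ENNReal.toReal_nonneg, ENNReal.ofReal_toReal (trim_ne_top _ _ _ _ _),
      trim, ← lintegral_mul_const' _ _ ENNReal.ofReal_ne_top]
    refine setLIntegral_mono' measurableSet_Ioi fun l hl => ?_
    by_cases hv : v ∈ {w | φ w < -l}
    · gcongr
      · exact hT.trans hl
      · have h3 : φ v < -l := hv
        have h4 : -φ v - T ≤ deepPart T φ v := le_max_left _ _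
        linarith
    · rw [levelTrim, Set.indicator_of_notMem hv, zero_mul, zero_mul]
  refine (lintegral_mono h2).trans ?_
  have hm : Measurable fun p : ℝ × ℝ => levelTrim σ D φ p.1 p.2 * ENNReal.ofReal p.1⁻¹ :=
    (measurable_levelTrim σ D h.mono.measurable).mul (by fun_prop)
  have h3 := lintegral_lintegral_mul_swap (W := fun l v => levelTrim σ D φ l v * ENNReal.ofReal l⁻¹)
    hm T D (f := fun _ => 1) measurable_const
  simp only [mul_one] at h3
  rw [h3, ENNReal.ofReal_mul zero_le_two, ← lintegral_Ioi_div_sqrt_mul hT h.σ_nonneg,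
    ← lintegral_const_mul' _ _ ENNReal.ofReal_ne_top]
  refine setLIntegral_mono' measurableSet_Ioi fun l hl => ?_
  have hl0 : 0 < l := hT.trans hl
  rw [lintegral_mul_const' _ _ ENNReal.ofReal_ne_top, div_eq_mul_inv (σ / √l) l,
    ENNReal.ofReal_mul (div_nonneg h.σ_nonneg (Real.sqrt_nonneg _)), ← mul_assoc]
  gcongr
  have hL := (h.isLowerSet_neg_lt l).measurableSet_real
  simp only [levelTrim]
  rw [lintegral_indicator hL]
  refine (lintegral_topWeight_le _ _).trans ?_
  simp

/-- Where anything is trimmed, trim equals the removed density times -φ, and u * (-φ) ≤ Y there. -/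
theorem integral_trim_mul_le (h : ShadedPair n η σ D E φ) {T : ℝ} (hT : 0 < T) {u : ℝ → ℝ}
    (hu : Monotone u) (h0 : ∀ v, 0 ≤ u v) {B : ℝ} (hB : ∀ v, u v ≤ B) {Y : ℝ}
    (hY : ∀ v, φ v < -T → u v * (-φ v) ≤ Y) :
    ∫ v, (trim T σ D φ v).toReal * u v ∂D ≤ Y * ∫ v, (1 - trimDensity T σ D φ v) ∂D := by
  have := h.probD
  rw [← integral_const_mul]
  refine integral_mono (integrable_mul_mono (h.measurable_trim_toReal T)
    (fun _ => ENNReal.toReal_nonneg)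
    (fun v => (toReal_trim_le T σ D φ v).trans (h.deepPart_le hT.le v)) hu h0 hB D)
    ((h.integrable_one_sub_trimDensity hT).const_mul Y) fun v => ?_
  have e : 1 - trimDensity T σ D φ v
      = (trim T σ D φ v).toReal / (T + deepPart T φ v) := by
    rw [trimDensity]; ring
  simp only [e]
  have h1 := toReal_trim_le T σ D φ v
  have ht0 : 0 ≤ (trim T σ D φ v).toReal := ENNReal.toReal_nonneg
  rcases le_or_gt (-φ v - T) 0 with hc | hc
  · have h3 : deepPart T φ v = 0 := max_eq_right hc
    have h2 : (trim T σ D φ v).toReal = 0 := le_antisymm (h3 ▸ h1) ht0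
    simp [h2]
  · have h3 : deepPart T φ v = -φ v - T := max_eq_left hc.le
    have h4 : T + (-φ v - T) = -φ v := by ring
    rw [h3, h4, mul_div_assoc', le_div_iff₀ (by linarith)]
    have := mul_le_mul_of_nonneg_left (hY v (by linarith)) ht0
    linarith

end ShadedPair


/-! ### Exchanging the trimmed distribution for the shaded one -/

namespace ShadedPair

variable {n η σ : ℝ} {D E : Measure ℝ} {φ : ℝ → ℝ}

/-- The reason for truncating at depth 2n: with σ of order η/√n, the removed mass per bidder is
O(η/n). -/
theorem div_sqrt_le (h : ShadedPair n η σ D E φ) : 2 * σ / √(2 * n) ≤ 2 * (η / n) := by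
  have hn := h.n_pos
  have h1 : √n ≤ √(2 * n) := Real.sqrt_le_sqrt (by linarith)
  have h2 : 0 < √n := Real.sqrt_pos.2 hn
  have h3 : √n * √n = n := Real.mul_self_sqrt hn.le
  calc 2 * σ / √(2 * n) ≤ 2 * σ / √n :=
        div_le_div_of_nonneg_left (mul_nonneg zero_le_two h.σ_nonneg) h2 h1
    _ ≤ 2 * (η / n) := by
      rw [mul_div_assoc]
      refine mul_le_mul_of_nonneg_left ?_ zero_le_two
      rw [div_le_div_iff₀ h2 hn]
      calc σ * n = σ * √n * √n := by rw [mul_assoc, h3]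
        _ ≤ η * √n := mul_le_mul_of_nonneg_right h.σ_le h2.le

theorem integral_one_sub_trimDensity_le' (h : ShadedPair n η σ D E φ) :
    ∫ v, (1 - trimDensity (2 * n) σ D φ v) ∂D ≤ 4 * (η / n) := by
  have hn := h.n_pos
  have h1 := h.integral_one_sub_trimDensity_le (T := 2 * n) (by linarith)
  have h2 := h.div_sqrt_le
  linarith

/-- The rule y' enters only through the one-sided trimming inequality, whereas y is moved between D
and E using its decay. The constant 12 is 2·2 from moving y plus 2·4 from the weight trimmed from y,
both with decay bound 2K. -/
theorem integral_deep_sub_le (h : ShadedPair n η σ D E φ) {y y' : ℝ → ℝ} (hy : Monotone y)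
    (hy' : Monotone y') {k : ℝ} (h0 : ∀ v, 0 ≤ y v) (hk : ∀ v, y v ≤ k)
    (hk' : ∀ v, y' v ≤ k) (hy0 : ∀ v, y 0 ≤ y v) (hy0' : ∀ v, y' 0 ≤ y' v) {K : ℝ} (hK0 : 0 ≤ K)
    (hK : ∀ v, φ v < -(2 * n) → -φ v * (y v - y 0) ≤ K)
    (hK' : φ 0 < -(2 * n) → -φ 0 * (y 0 - y' 0) ≤ K) :
    ∫ v, (-deepPart (2 * n) φ v + (trim (2 * n) σ D φ v).toReal) * (y v - y' v) ∂D
      ≤ ∫ v, -deepPart (2 * n) φ v * (y v - y' v) ∂E + 12 * K * (η / n) := by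
  have := h.probD
  have := h.probE
  have hn := h.n_pos
  have hT : 0 < 2 * n := by linarith
  have hc : 0 ≤ η / n := div_nonneg h.η_nonneg hn.le
  have hgm := measurable_deepPart (2 * n) h.mono.measurable
  have hg0 := deepPart_nonneg (2 * n) φ
  have htm := h.measurable_trim_toReal (2 * n)
  have ht0 : ∀ v, 0 ≤ (trim (2 * n) σ D φ v).toReal := fun _ => ENNReal.toReal_nonneg
  have htC := fun v => (toReal_trim_le (2 * n) σ D φ v).trans (h.deepPart_le hT.le v)
  by_cases hdeep : φ 0 < -(2 * n)
  · have hpos : 0 < -φ 0 := by linarith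
    -- A common shift leaves y - y' unchanged. This one makes z nonnegative by `hK'`, and costs u
    -- only another K in the decay bound because -φ v ≤ -φ 0.
    set κ := K / -φ 0 with hκ
    have hκ0 : 0 ≤ κ := div_nonneg hK0 hpos.le
    have hκφ : -φ 0 * κ = K := mul_div_cancel₀ K hpos.ne'
    set u : ℝ → ℝ := fun v => y v - y 0 + κ with hu
    set z : ℝ → ℝ := fun v => y' v - y 0 + κ with hz
    have hum : Monotone u := fun a b hab => by simp only [hu]; linarith [hy hab]
    have hzm : Monotone z := fun a b hab => by simp only [hz]; linarith [hy' hab]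
    have hu0 : ∀ v, 0 ≤ u v := fun v => by simp only [hu]; linarith [hy0 v]
    have hz0 : ∀ v, 0 ≤ z v := fun v => by
      have h1 := hK' hdeep
      rw [← hκφ] at h1
      have h2 := le_of_mul_le_mul_left h1 hpos
      simp only [hz]; linarith [hy0' v]
    have huB : ∀ v, u v ≤ k + κ := fun v => by simp only [hu]; linarith [hk v, h0 0]
    have hzB : ∀ v, z v ≤ k + κ := fun v => by simp only [hz]; linarith [hk' v, h0 0]
    have huY : ∀ v, φ v < -(2 * n) → u v * (-φ v) ≤ 2 * K := fun v hv => by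
      have h1 := hK v hv
      have h2 : κ * -φ v ≤ κ * -φ 0 := mul_le_mul_of_nonneg_left (by linarith [h.zero_le v]) hκ0
      simp only [hu]
      linarith
    have a1 := h.integral_deepPart_mul_le hT hzm hz0 hzB
    have a2 := h.integral_deepPart_mul_le' hT hum hu0 huB (by linarith : 0 ≤ 2 * K) huY
    have a3 := h.integral_trim_mul_le hT hum hu0 huB huY
    have a4 := h.integral_one_sub_trimDensity_le'
    have a5 := h.div_sqrt_le
    have b1 := mul_le_mul_of_nonneg_left a4 (by linarith : 0 ≤ 2 * K)
    have b2 := mul_le_mul_of_nonneg_left a5 (by linarith : 0 ≤ 2 * K)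
    have i1 := integrable_mul_mono hgm hg0 (h.deepPart_le hT.le) hum hu0 huB D
    have i2 := integrable_mul_mono hgm hg0 (h.deepPart_le hT.le) hzm hz0 hzB D
    have i3 := integrable_mul_mono htm ht0 htC hum hu0 huB D
    have i4 := integrable_mul_mono htm ht0 htC hzm hz0 hzB D
    have i5 := integrable_mul_mono hgm hg0 (h.deepPart_le hT.le) hum hu0 huB E
    have i6 := integrable_mul_mono hgm hg0 (h.deepPart_le hT.le) hzm hz0 hzB E
    have e1 : ∀ v, (-deepPart (2 * n) φ v + (trim (2 * n) σ D φ v).toReal) * (y v - y' v)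
        = deepPart (2 * n) φ v * z v - deepPart (2 * n) φ v * u v
          + ((trim (2 * n) σ D φ v).toReal * u v - (trim (2 * n) σ D φ v).toReal * z v) :=
      fun v => by simp only [hu, hz]; ring
    have e2 : ∀ v, -deepPart (2 * n) φ v * (y v - y' v)
        = deepPart (2 * n) φ v * z v - deepPart (2 * n) φ v * u v :=
      fun v => by simp only [hu, hz]; ring
    simp only [e1, e2]
    have f1 := integral_add (i2.sub i1) (i3.sub i4)
    simp only [Pi.sub_apply] at f1
    rw [f1, integral_sub i2 i1, integral_sub i3 i4, integral_sub i6 i5]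
    linarith
  -- If even φ 0 is not below -2n, nothing is deep and nothing is trimmed.
  · have hg : ∀ v, deepPart (2 * n) φ v = 0 := fun v => max_eq_right (by linarith [h.zero_le v])
    have ht : ∀ v, (trim (2 * n) σ D φ v).toReal = 0 := fun v =>
      le_antisymm (hg v ▸ toReal_trim_le (2 * n) σ D φ v) (ht0 v)
    simp only [hg, ht, neg_zero, add_zero, zero_mul, integral_zero, zero_add]
    positivity

/-- Split φ at -2n: the truncated part moves for y and y' separately with two-sided errors, and the
deep part is treated for the difference y - y'. -/
theorem integral_trimDensity_mul_le (h : ShadedPair n η σ D E φ) {y y' : ℝ → ℝ} (hy : Monotone y)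
    (hy' : Monotone y') {k : ℝ} (h0 : ∀ v, 0 ≤ y v) (hk : ∀ v, y v ≤ k) (h0' : ∀ v, 0 ≤ y' v)
    (hk' : ∀ v, y' v ≤ k) (hy0 : ∀ v, y 0 ≤ y v) (hy0' : ∀ v, y' 0 ≤ y' v) {K : ℝ} (hK0 : 0 ≤ K)
    (hK : ∀ v, φ v < -(2 * n) → -φ v * (y v - y 0) ≤ K)
    (hK' : φ 0 < -(2 * n) → -φ 0 * (y 0 - y' 0) ≤ K) :
    ∫ v, trimDensity (2 * n) σ D φ v * φ v * (y v - y' v) ∂D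
      ≤ ∫ v, φ v * (y v - y' v) ∂E + 9 * η * (∫ v, y v ∂D + ∫ v, y' v ∂D)
        + 6 * (η / n * k) + 12 * K * (η / n) := by
  have := h.probD
  have := h.probE
  have hn := h.n_pos
  have hT : 0 < 2 * n := by linarith
  have a := h.integral_deep_sub_le hy hy' h0 hk hk' hy0 hy0' hK0 hK hK'
  have b := _root_.abs_le.1 (h.abs_integral_trunc_sub_le hy h0 hk)
  have b' := _root_.abs_le.1 (h.abs_integral_trunc_sub_le hy' h0' hk')
  have hbd : ∀ v, |y v - y' v| ≤ k := fun v => _root_.abs_le.2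
    ⟨by linarith [h0 v, hk' v], by linarith [hk v, h0' v]⟩
  have hdm : Measurable fun v => y v - y' v := hy.measurable.sub hy'.measurable
  have hτm : Measurable fun v => max (φ v) (-(2 * n)) := h.mono.measurable.max measurable_const
  have hτb : ∀ v, |max (φ v) (-(2 * n))| ≤ 2 * n + 1 := fun v => _root_.abs_le.2
    ⟨by have := le_max_right (φ v) (-(2 * n)); linarith,
      max_le (by linarith [h.le_one v]) (by linarith)⟩
  have hgm := measurable_deepPart (2 * n) h.mono.measurable
  have hg0 := deepPart_nonneg (2 * n) φ
  have htm := h.measurable_trim_toReal (2 * n)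
  have ht0 : ∀ v, 0 ≤ (trim (2 * n) σ D φ v).toReal := fun _ => ENNReal.toReal_nonneg
  have htC := fun v => (toReal_trim_le (2 * n) σ D φ v).trans (h.deepPart_le hT.le v)
  have I : ∀ (μ : Measure ℝ) [IsFiniteMeasure μ] (f g : ℝ → ℝ) (A B : ℝ), Measurable f →
      Measurable g → (∀ v, |f v| ≤ A) → (∀ v, |g v| ≤ B) → Integrable (fun v => f v * g v) μ :=
    fun μ _ f g A B hf hg hA hB => Integrable.of_bound (hf.mul hg).aestronglyMeasurable (A * B)
      (Filter.Eventually.of_forall fun v => by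
        rw [norm_mul]
        exact mul_le_mul (hA v) (hB v) (abs_nonneg _) ((abs_nonneg _).trans (hA v)))
  have hyb : ∀ v, |y v| ≤ k := fun v => by rw [abs_of_nonneg (h0 v)]; exact hk v
  have hyb' : ∀ v, |y' v| ≤ k := fun v => by rw [abs_of_nonneg (h0' v)]; exact hk' v
  have hDb : ∀ v, |-deepPart (2 * n) φ v| ≤ |φ 0| := fun v => by
    rw [abs_neg, abs_of_nonneg (hg0 v)]; exact h.deepPart_le hT.le v
  have hDtb : ∀ v, |-deepPart (2 * n) φ v + (trim (2 * n) σ D φ v).toReal| ≤ |φ 0| := fun v =>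
    _root_.abs_le.2 ⟨by linarith [h.deepPart_le hT.le v, ht0 v],
      by linarith [toReal_trim_le (2 * n) σ D φ v, abs_nonneg (φ 0)]⟩
  have e1 : ∀ v, trimDensity (2 * n) σ D φ v * φ v * (y v - y' v)
      = max (φ v) (-(2 * n)) * y v - max (φ v) (-(2 * n)) * y' v
        + (-deepPart (2 * n) φ v + (trim (2 * n) σ D φ v).toReal) * (y v - y' v) := fun v => by
    rw [trimDensity_mul hT]; ring
  have e2 : ∀ v, φ v * (y v - y' v)
      = max (φ v) (-(2 * n)) * y v - max (φ v) (-(2 * n)) * y' v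
        + -deepPart (2 * n) φ v * (y v - y' v) := fun v => by
    have : φ v = max (φ v) (-(2 * n)) - deepPart (2 * n) φ v := by
      rw [deepPart]
      rcases le_total (-φ v - 2 * n) 0 with hc | hc
      · rw [max_eq_right hc, max_eq_left (by linarith)]; ring
      · rw [max_eq_left hc, max_eq_right (by linarith)]; ring
    nth_rewrite 1 [this]
    ring
  simp only [e1, e2]
  have j1 := fun (μ : Measure ℝ) (_ : IsFiniteMeasure μ) =>
    (I μ _ _ _ _ hτm hy.measurable hτb hyb).sub (I μ _ _ _ _ hτm hy'.measurable hτb hyb')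
  have f1 := integral_add (j1 D inferInstance) (I D _ _ _ _ (hgm.neg.add htm) hdm hDtb hbd)
  have f2 := integral_add (j1 E inferInstance) (I E _ _ _ _ hgm.neg hdm hDb hbd)
  simp only [Pi.sub_apply, Pi.add_apply, Pi.neg_apply] at f1 f2
  rw [f1, f2, integral_sub (I D _ _ _ _ hτm hy.measurable hτb hyb)
    (I D _ _ _ _ hτm hy'.measurable hτb hyb'), integral_sub (I E _ _ _ _ hτm hy.measurable hτb hyb)
    (I E _ _ _ _ hτm hy'.measurable hτb hyb')]
  linarith [b.1, b'.2]

end ShadedPair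


/-! ### Right derivatives of concave functions -/

/-- The right derivative of a concave function is the supremum of the slopes to the right, and a
supergradient. -/
theorem ConcaveOn.derivWithin_Ioi_spec {f : ℝ → ℝ} (hf : ConcaveOn ℝ (Set.Icc 0 1) f) {q c : ℝ}
    (hq : q ∈ Set.Ico (0 : ℝ) 1) (hc : ∀ t ∈ Set.Ioc q 1, f t - f q ≤ c * (t - q)) :
    (∀ t ∈ Set.Icc (0 : ℝ) 1, f t ≤ f q + derivWithin f (Set.Ioi q) q * (t - q)) ∧
      ∀ b, (∀ t ∈ Set.Ioc q 1, f t ≤ f q + b * (t - q)) → derivWithin f (Set.Ioi q) q ≤ b := by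
  have hqI : q ∈ Set.Icc (0 : ℝ) 1 := ⟨hq.1, hq.2.le⟩
  have hmem : ∀ t ∈ Set.Ioc q 1, t ∈ Set.Icc (0 : ℝ) 1 := fun t ht => ⟨hq.1.trans ht.1.le, ht.2⟩
  have hanti : AntitoneOn (slope f q) (Set.Ioc q 1) := by
    intro s hs t ht hst
    rw [slope_def_field, slope_def_field]
    rcases hst.eq_or_lt with h | h
    · rw [h]
    · have := hf.neg.secant_mono hqI (hmem s hs) (hmem t ht) hs.1.ne' ht.1.ne' hst
      simp only [Pi.neg_apply, ← neg_sub', neg_div] at this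
      linarith
  have hbdd : BddAbove (slope f q '' Set.Ioc q 1) := by
    refine ⟨c, ?_⟩
    rintro _ ⟨t, ht, rfl⟩
    rw [slope_def_field, div_le_iff₀ (sub_pos.2 ht.1)]
    exact hc t ht
  set d := sSup (slope f q '' Set.Ioc q 1) with hd
  have hle : ∀ t ∈ Set.Ioc q 1, slope f q t ≤ d := fun t ht => le_csSup hbdd ⟨t, ht, rfl⟩
  have hlim : Filter.Tendsto (slope f q) (nhdsWithin q (Set.Ioi q)) (nhds d) := by
    rw [tendsto_order]
    constructor
    · intro a ha
      obtain ⟨_, ⟨t, ht, rfl⟩, hat⟩ := exists_lt_of_lt_csSup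
        (Set.Nonempty.image _ (Set.nonempty_Ioc.2 hq.2)) ha
      filter_upwards [Ioc_mem_nhdsGT ht.1] with s hs
      exact hat.trans_le (hanti ⟨hs.1, hs.2.trans ht.2⟩ ht hs.2)
    · intro a ha
      filter_upwards [Ioc_mem_nhdsGT hq.2] with s hs
      exact (hle s hs).trans_lt ha
  have hder : HasDerivWithinAt f d (Set.Ioi q) q := by
    rw [hasDerivWithinAt_iff_tendsto_slope' (by simp)]
    exact hlim
  have hdw : derivWithin f (Set.Ioi q) q = d :=
    hder.derivWithin (uniqueDiffWithinAt_Ioi q)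
  rw [hdw]
  have h2 : ∀ b, (∀ t ∈ Set.Ioc q 1, f t ≤ f q + b * (t - q)) → d ≤ b := by
    intro b hb
    refine csSup_le (Set.Nonempty.image _ (Set.nonempty_Ioc.2 hq.2)) ?_
    rintro _ ⟨t, ht, rfl⟩
    rw [slope_def_field, div_le_iff₀ (sub_pos.2 ht.1)]
    linarith [hb t ht]
  refine ⟨fun t ht => ?_, h2⟩
  rcases lt_trichotomy t q with h | h | h
  · have h3 : d ≤ (f q - f t) / (q - t) := by
      refine h2 _ fun s hs => ?_
      have h4 := hf.slope_anti_adjacent ht (hmem s hs) h hs.1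
      rw [div_le_iff₀ (sub_pos.2 hs.1)] at h4
      linarith
    rw [le_div_iff₀ (sub_pos.2 h)] at h3
    linarith
  · simp [h]
  · have := hle t ⟨h, ht.2⟩
    rw [slope_def_field, div_le_iff₀ (sub_pos.2 h)] at this
    linarith

/-! ### Ironed revenue curves -/

section Hull

variable {F : ℝ → ℝ}

theorem valueAt_le {v q : ℝ} (hv : 0 ≤ v) (hq : quantileOf F v ≤ q) : valueAt F q ≤ v :=
  csInf_le ⟨0, fun _ h => h.1⟩ ⟨hv, hq⟩

theorem le_valueAt (h1 : quantileOf F 1 ≤ 0) {b q : ℝ} (hq : 0 ≤ q)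
    (hb : ∀ v, 0 ≤ v → quantileOf F v ≤ q → b ≤ v) : b ≤ valueAt F q :=
  le_csInf ⟨1, zero_le_one, h1.trans hq⟩ fun v hv => hb v hv.1 hv.2

theorem valueAt_nonneg (h1 : quantileOf F 1 ≤ 0) {q : ℝ} (hq : 0 ≤ q) : 0 ≤ valueAt F q :=
  le_valueAt h1 hq fun _ hv _ => hv

theorem valueAt_le_one (h1 : quantileOf F 1 ≤ 0) {q : ℝ} (hq : 0 ≤ q) : valueAt F q ≤ 1 :=
  valueAt_le zero_le_one (h1.trans hq)

theorem antitoneOn_valueAt (h1 : quantileOf F 1 ≤ 0) : AntitoneOn (valueAt F) (Set.Icc 0 1) :=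
  fun _ ha _ _ hab => le_valueAt h1 ha.1 fun _ hv hva => valueAt_le hv (hva.trans hab)

theorem revenueCurve_nonneg (h1 : quantileOf F 1 ≤ 0) {q : ℝ} (hq : 0 ≤ q) :
    0 ≤ revenueCurve F q := mul_nonneg hq (valueAt_nonneg h1 hq)

theorem revenueCurve_le (h1 : quantileOf F 1 ≤ 0) {q : ℝ} (hq : 0 ≤ q) : revenueCurve F q ≤ q :=
  mul_le_of_le_one_right hq (valueAt_le_one h1 hq)

theorem ae_mem_Icc_of_measure_eq_one {P : Measure ℝ} [IsProbabilityMeasure P]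
    (hP : P (Set.Icc 0 1) = 1) : ∀ᵐ t ∂P, t ∈ Set.Icc (0 : ℝ) 1 :=
  (prob_compl_eq_zero_iff measurableSet_Icc).2 hP

theorem integrable_id_of_measure_Icc {P : Measure ℝ} [IsProbabilityMeasure P]
    (hP : P (Set.Icc 0 1) = 1) : Integrable (fun t : ℝ => t) P :=
  Integrable.of_bound measurable_id.aestronglyMeasurable 1
    ((ae_mem_Icc_of_measure_eq_one hP).mono fun t ht => by
      rw [Real.norm_of_nonneg ht.1]; exact ht.2)

theorem integrable_revenueCurve (h1 : quantileOf F 1 ≤ 0) {P : Measure ℝ} [IsProbabilityMeasure P]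
    (hP : P (Set.Icc 0 1) = 1) : Integrable (revenueCurve F) P := by
  have hae := ae_mem_Icc_of_measure_eq_one hP
  have hr : P.restrict (Set.Icc 0 1) = P := Measure.restrict_eq_self_of_ae_mem hae
  have hm : AEMeasurable (valueAt F) P := by
    rw [← hr]
    exact aemeasurable_restrict_of_antitoneOn measurableSet_Icc (antitoneOn_valueAt h1)
  refine Integrable.of_bound (aemeasurable_id.mul hm).aestronglyMeasurable 1
    (hae.mono fun t ht => ?_)
  rw [Real.norm_of_nonneg (revenueCurve_nonneg h1 ht.1)]
  exact (revenueCurve_le h1 ht.1).trans ht.2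

theorem integral_revenueCurve_le (h1 : quantileOf F 1 ≤ 0) {a b q : ℝ}
    (h : ∀ t ∈ Set.Icc (0 : ℝ) 1, revenueCurve F t ≤ a + b * t) {P : Measure ℝ}
    [IsProbabilityMeasure P] (hP : P (Set.Icc 0 1) = 1) (hPq : ∫ t, t ∂P = q) :
    ∫ t, revenueCurve F t ∂P ≤ a + b * q := by
  have hi := integrable_id_of_measure_Icc hP
  calc ∫ t, revenueCurve F t ∂P ≤ ∫ t, (a + b * t) ∂P :=
        integral_mono_ae (integrable_revenueCurve h1 hP)
          ((integrable_const a).add (hi.const_mul b))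
          ((ae_mem_Icc_of_measure_eq_one hP).mono h)
    _ = a + b * q := by
      rw [integral_add (integrable_const a) (hi.const_mul b), integral_const_mul, hPq]
      simp

theorem mem_ironed_set (F : ℝ → ℝ) {q : ℝ} (hq : q ∈ Set.Icc (0 : ℝ) 1) :
    revenueCurve F q ∈ {r : ℝ | ∃ P : Measure ℝ, IsProbabilityMeasure P ∧ P (Set.Icc 0 1) = 1 ∧
      ∫ t, t ∂P = q ∧ ∫ t, revenueCurve F t ∂P = r} := by
  refine ⟨Measure.dirac q, inferInstance, ?_, ?_, ?_⟩
  · rw [Measure.dirac_apply' _ measurableSet_Icc, Set.indicator_of_mem hq]; rfl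
  · exact integral_dirac _ _
  · exact integral_dirac _ _

/-- An affine function integrates to its value at the mean, so every affine majorant of the revenue
curve bounds the ironed curve. The main upper bounds below come from choosing such majorants. -/
theorem ironedRevenueCurve_le_affine (h1 : quantileOf F 1 ≤ 0) {a b : ℝ}
    (h : ∀ t ∈ Set.Icc (0 : ℝ) 1, revenueCurve F t ≤ a + b * t) {q : ℝ}
    (hq : q ∈ Set.Icc (0 : ℝ) 1) : ironedRevenueCurve F q ≤ a + b * q := by
  refine csSup_le ⟨_, mem_ironed_set F hq⟩ ?_
  rintro _ ⟨P, hP, hP1, hPq, rfl⟩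
  exact integral_revenueCurve_le h1 h hP1 hPq

theorem bddAbove_ironed_set (h1 : quantileOf F 1 ≤ 0) (q : ℝ) :
    BddAbove {r : ℝ | ∃ P : Measure ℝ, IsProbabilityMeasure P ∧ P (Set.Icc 0 1) = 1 ∧
      ∫ t, t ∂P = q ∧ ∫ t, revenueCurve F t ∂P = r} := by
  refine ⟨0 + 1 * q, ?_⟩
  rintro _ ⟨P, hP, hP1, hPq, rfl⟩
  refine integral_revenueCurve_le h1 (fun t ht => ?_) hP1 hPq
  linarith [revenueCurve_le h1 ht.1]

theorem revenueCurve_le_ironed (h1 : quantileOf F 1 ≤ 0) {q : ℝ} (hq : q ∈ Set.Icc (0 : ℝ) 1) :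
    revenueCurve F q ≤ ironedRevenueCurve F q :=
  le_csSup (bddAbove_ironed_set h1 q) (mem_ironed_set F hq)

theorem ironedRevenueCurve_nonneg (h1 : quantileOf F 1 ≤ 0) {q : ℝ} (hq : q ∈ Set.Icc (0 : ℝ) 1) :
    0 ≤ ironedRevenueCurve F q :=
  (revenueCurve_nonneg h1 hq.1).trans (revenueCurve_le_ironed h1 hq)

theorem ironedRevenueCurve_le_self (h1 : quantileOf F 1 ≤ 0) {q : ℝ}
    (hq : q ∈ Set.Icc (0 : ℝ) 1) : ironedRevenueCurve F q ≤ q := by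
  have := ironedRevenueCurve_le_affine h1 (a := 0) (b := 1)
    (fun t ht => by linarith [revenueCurve_le h1 ht.1]) hq
  linarith

theorem ironedRevenueCurve_zero (h1 : quantileOf F 1 ≤ 0) : ironedRevenueCurve F 0 = 0 :=
  le_antisymm (ironedRevenueCurve_le_self h1 (by simp)) (ironedRevenueCurve_nonneg h1 (by simp))

/-- Mass at 0 makes the revenue curve vanish near quantile 1, so the line (1 - t)/c, which is 0 at t
= 1, is a majorant. -/
theorem ironedRevenueCurve_one (h1 : quantileOf F 1 ≤ 0) (h0 : quantileOf F 0 < 1) :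
    ironedRevenueCurve F 1 = 0 := by
  refine le_antisymm ?_ (ironedRevenueCurve_nonneg h1 (by simp))
  set c := 1 - quantileOf F 0 with hc
  have hc0 : 0 < c := sub_pos.2 h0
  have h := ironedRevenueCurve_le_affine h1 (a := 1 / c) (b := -(1 / c)) (q := 1) (fun t ht => ?_)
    (by simp)
  · linarith
  · have e : 1 / c + -(1 / c) * t = (1 - t) / c := by ring
    rw [e]
    rcases le_total (quantileOf F 0) t with h | h
    · have : valueAt F t ≤ 0 := valueAt_le le_rfl h
      have h2 : revenueCurve F t ≤ 0 := mul_nonpos_of_nonneg_of_nonpos ht.1 this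
      exact h2.trans (div_nonneg (by linarith [ht.2]) hc0.le)
    · refine ((revenueCurve_le h1 ht.1).trans ht.2).trans ?_
      rw [le_div_iff₀ hc0]
      linarith

theorem concaveOn_ironedRevenueCurve (h1 : quantileOf F 1 ≤ 0) :
    ConcaveOn ℝ (Set.Icc 0 1) (ironedRevenueCurve F) := by
  refine ⟨convex_Icc 0 1, fun x hx y hy a b ha hb hab => ?_⟩
  simp only [smul_eq_mul]
  have key : ∀ r ∈ {r : ℝ | ∃ P : Measure ℝ, IsProbabilityMeasure P ∧ P (Set.Icc 0 1) = 1 ∧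
      ∫ t, t ∂P = x ∧ ∫ t, revenueCurve F t ∂P = r}, ∀ r' ∈ {r : ℝ | ∃ P : Measure ℝ,
      IsProbabilityMeasure P ∧ P (Set.Icc 0 1) = 1 ∧
      ∫ t, t ∂P = y ∧ ∫ t, revenueCurve F t ∂P = r},
      a * r + b * r' ≤ ironedRevenueCurve F (a * x + b * y) := by
    rintro _ ⟨P, hP, hP1, hPx, rfl⟩ _ ⟨P', hP', hP1', hPy, rfl⟩
    have hab' : ENNReal.ofReal a + ENNReal.ofReal b = 1 := by
      rw [← ENNReal.ofReal_add ha hb, hab, ENNReal.ofReal_one]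
    have hi : ∀ f : ℝ → ℝ, Integrable f P → Integrable f P' →
        ∫ t, f t ∂(ENNReal.ofReal a • P + ENNReal.ofReal b • P')
          = a * ∫ t, f t ∂P + b * ∫ t, f t ∂P' := fun f hf hf' => by
      rw [integral_add_measure (hf.smul_measure ENNReal.ofReal_ne_top)
        (hf'.smul_measure ENNReal.ofReal_ne_top), integral_smul_measure, integral_smul_measure,
        ENNReal.toReal_ofReal ha, ENNReal.toReal_ofReal hb]
      rfl
    refine le_csSup (bddAbove_ironed_set h1 _)
      ⟨ENNReal.ofReal a • P + ENNReal.ofReal b • P', ⟨?_⟩, ?_, ?_, ?_⟩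
    · simp [hab']
    · simp [hP1, hP1', hab']
    · rw [hi _ (integrable_id_of_measure_Icc hP1) (integrable_id_of_measure_Icc hP1'), hPx, hPy]
    · exact hi _ (integrable_revenueCurve h1 hP1) (integrable_revenueCurve h1 hP1')
  -- The suprema at x and y are taken one at a time; a vanishing coefficient is treated separately
  -- so that one can divide by it otherwise.
  have hx' : ∀ r' ∈ {r : ℝ | ∃ P : Measure ℝ,
      IsProbabilityMeasure P ∧ P (Set.Icc 0 1) = 1 ∧
      ∫ t, t ∂P = y ∧ ∫ t, revenueCurve F t ∂P = r},
      a * ironedRevenueCurve F x + b * r' ≤ ironedRevenueCurve F (a * x + b * y) := by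
    intro r' hr'
    rcases ha.eq_or_lt with h | h
    · have := key _ (mem_ironed_set F hx) r' hr'
      rw [← h] at this ⊢
      linarith
    · have : ironedRevenueCurve F x ≤ (ironedRevenueCurve F (a * x + b * y) - b * r') / a := by
        refine csSup_le ⟨_, mem_ironed_set F hx⟩ fun r hr => ?_
        rw [le_div_iff₀ h]
        linarith [key r hr r' hr']
      rw [le_div_iff₀ h] at this
      linarith
  rcases hb.eq_or_lt with h | h
  · have := hx' _ (mem_ironed_set F hy)
    rw [← h] at this ⊢
    linarith
  · have : ironedRevenueCurve F y
        ≤ (ironedRevenueCurve F (a * x + b * y) - a * ironedRevenueCurve F x) / b := by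
      refine csSup_le ⟨_, mem_ironed_set F hy⟩ fun r hr => ?_
      rw [le_div_iff₀ h]
      linarith [hx' r hr]
    rw [le_div_iff₀ h] at this
    linarith

/-- By concavity slopes to the right of q are at most the slope over [0, q], which is at most 1
because the curve lies below the diagonal. -/
theorem ironedRevenueCurve_slope_le_one (h1 : quantileOf F 1 ≤ 0) {q t : ℝ} (hq : 0 ≤ q)
    (hqt : q < t) (ht : t ≤ 1) :
    ironedRevenueCurve F t - ironedRevenueCurve F q ≤ 1 * (t - q) := by
  rcases hq.eq_or_lt with h | h
  · rw [← h, ironedRevenueCurve_zero h1]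
    linarith [ironedRevenueCurve_le_self h1 (q := t) ⟨(hq.trans hqt.le), ht⟩]
  · have h2 := (concaveOn_ironedRevenueCurve h1).slope_anti_adjacent (x := 0) (y := q) (z := t)
      (by simp) ⟨hq.trans hqt.le, ht⟩ h hqt
    rw [ironedRevenueCurve_zero h1, sub_zero, sub_zero, div_le_iff₀ (sub_pos.2 hqt)] at h2
    refine h2.trans (mul_le_mul_of_nonneg_right ?_ (sub_pos.2 hqt).le)
    rw [div_le_one h]
    exact ironedRevenueCurve_le_self h1 ⟨hq, hqt.le.trans ht⟩

/-- The right derivative of the ironed revenue curve at `q`. -/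
noncomputable def ironedSlope (F : ℝ → ℝ) (q : ℝ) : ℝ :=
  derivWithin (ironedRevenueCurve F) (Set.Ioi q) q

theorem ironedRevenueCurve_le_add_slope (h1 : quantileOf F 1 ≤ 0) {q t : ℝ}
    (hq : q ∈ Set.Ico (0 : ℝ) 1) (ht : t ∈ Set.Icc (0 : ℝ) 1) :
    ironedRevenueCurve F t ≤ ironedRevenueCurve F q + ironedSlope F q * (t - q) :=
  ((concaveOn_ironedRevenueCurve h1).derivWithin_Ioi_spec hq fun _ h =>
    ironedRevenueCurve_slope_le_one h1 hq.1 h.1 h.2).1 t ht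

theorem ironedSlope_le (h1 : quantileOf F 1 ≤ 0) {q b : ℝ} (hq : q ∈ Set.Ico (0 : ℝ) 1)
    (hb : ∀ t ∈ Set.Ioc q 1, ironedRevenueCurve F t ≤ ironedRevenueCurve F q + b * (t - q)) :
    ironedSlope F q ≤ b :=
  ((concaveOn_ironedRevenueCurve h1).derivWithin_Ioi_spec hq fun _ h =>
    ironedRevenueCurve_slope_le_one h1 hq.1 h.1 h.2).2 b hb

theorem ironedSlope_le_one (h1 : quantileOf F 1 ≤ 0) {q : ℝ} (hq : q ∈ Set.Ico (0 : ℝ) 1) :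
    ironedSlope F q ≤ 1 :=
  ironedSlope_le h1 hq fun _ h => by
    linarith [ironedRevenueCurve_slope_le_one h1 hq.1 h.1 h.2]

theorem ironedSlope_anti (h1 : quantileOf F 1 ≤ 0) {q q' : ℝ} (hq : 0 ≤ q) (hqq : q ≤ q')
    (hq' : q' < 1) : ironedSlope F q' ≤ ironedSlope F q := by
  rcases hqq.eq_or_lt with h | h
  · rw [h]
  · refine ironedSlope_le h1 ⟨hq.trans hqq, hq'⟩ fun t ht => ?_
    have h2 := (concaveOn_ironedRevenueCurve h1).slope_anti_adjacent (x := q) (y := q') (z := t)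
      ⟨hq, hqq.trans hq'.le⟩ ⟨hq.trans (hqq.trans ht.1.le), ht.2⟩ h ht.1
    have h3 := ironedRevenueCurve_le_add_slope h1 ⟨hq, h.trans hq'⟩ (t := q')
      ⟨hq.trans hqq, hq'.le⟩
    have h4 : (ironedRevenueCurve F q' - ironedRevenueCurve F q) / (q' - q) ≤ ironedSlope F q := by
      rw [div_le_iff₀ (sub_pos.2 h)]; linarith
    have h5 := h2.trans h4
    rw [div_le_iff₀ (sub_pos.2 ht.1)] at h5
    linarith

/-- At q itself the value may drop below b, but at each t < q it is at least b. Concavity and the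
zero at 1 bound the curve at q by (1 - q)/(1 - t) times b t from below; then t tends to q. -/
theorem mul_le_ironedRevenueCurve (h1 : quantileOf F 1 ≤ 0) (h0 : quantileOf F 0 < 1) {b q : ℝ}
    (hb : 0 ≤ b) (hq : q ∈ Set.Icc (0 : ℝ) 1) (h : ∀ v, 0 ≤ v → v < b → q ≤ quantileOf F v) :
    b * q ≤ ironedRevenueCurve F q := by
  rcases hb.eq_or_lt with hb0 | hb0
  · rw [← hb0, zero_mul]; exact ironedRevenueCurve_nonneg h1 hq
  have hq1 : q < 1 := (h 0 le_rfl hb0).trans_lt h0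
  rcases hq.1.eq_or_lt with hq0 | hq0
  · rw [← hq0, mul_zero]; exact ironedRevenueCurve_nonneg h1 (by simp)
  have hlt : ∀ t ∈ Set.Ico 0 q, (1 - q) / (1 - t) * (b * t) ≤ ironedRevenueCurve F q := by
    intro t ht
    have htq : t < q := ht.2
    have ht1 : 0 < 1 - t := by linarith
    have e1 : b * t ≤ ironedRevenueCurve F t := by
      refine le_trans ?_ (revenueCurve_le_ironed h1 ⟨ht.1, by linarith⟩)
      rw [revenueCurve, mul_comm]
      refine mul_le_mul_of_nonneg_left (le_valueAt h1 ht.1 fun v hv hvq => ?_) ht.1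
      by_contra hvb
      exact absurd (h v hv (not_le.1 hvb)) (not_le.2 (hvq.trans_lt htq))
    have e2 := (concaveOn_ironedRevenueCurve h1).2 (show t ∈ Set.Icc (0 : ℝ) 1 from
      ⟨ht.1, by linarith⟩) (show (1 : ℝ) ∈ Set.Icc (0 : ℝ) 1 by simp)
      (show 0 ≤ (1 - q) / (1 - t) by apply div_nonneg <;> linarith)
      (show 0 ≤ (q - t) / (1 - t) by apply div_nonneg <;> linarith) (by field_simp; ring)
    simp only [smul_eq_mul] at e2
    rw [ironedRevenueCurve_one h1 h0, mul_zero, add_zero] at e2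
    have e3 : (1 - q) / (1 - t) * t + (q - t) / (1 - t) * 1 = q := by field_simp; ring
    rw [e3] at e2
    exact (mul_le_mul_of_nonneg_left e1 (by apply div_nonneg <;> linarith)).trans e2
  have hcont : Filter.Tendsto (fun t => (1 - q) / (1 - t) * (b * t)) (nhdsWithin q (Set.Iio q))
      (nhds ((1 - q) / (1 - q) * (b * q))) := by
    have : ContinuousAt (fun t => (1 - q) / (1 - t) * (b * t)) q := by
      have : 1 - q ≠ 0 := by linarith
      fun_prop (disch := assumption)
    exact this.tendsto.mono_left nhdsWithin_le_nhds
  rw [div_self (by linarith), one_mul] at hcont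
  refine le_of_tendsto hcont ?_
  filter_upwards [Ico_mem_nhdsLT hq0] with t ht
  exact hlt t ht

theorem revenueCurve_le_mul {s q : ℝ} (hs : 0 ≤ s) (hq0 : 0 ≤ q) (hq : quantileOf F s ≤ q) :
    revenueCurve F q ≤ s * q := by
  rw [mul_comm]
  exact mul_le_mul_of_nonneg_left (valueAt_le hs hq) hq0

/-- The ironed revenue curve is affine along an atom `s`. -/
theorem ironedRevenueCurve_le_of_atom (h1 : quantileOf F 1 ≤ 0) (h0 : quantileOf F 0 < 1) {s m : ℝ}
    (hs : 0 ≤ s) (hm : 0 < m) (hq : 0 ≤ quantileOf F s) (hqm : quantileOf F s + m ≤ 1)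
    (h : ∀ v, 0 ≤ v → v < s → quantileOf F s + m ≤ quantileOf F v) {t : ℝ}
    (ht : t ∈ Set.Icc (0 : ℝ) 1) :
    ironedRevenueCurve F t ≤ ironedRevenueCurve F (quantileOf F s)
      + (ironedRevenueCurve F (quantileOf F s + m) - ironedRevenueCurve F (quantileOf F s)) / m
        * (t - quantileOf F s) := by
  set q := quantileOf F s
  set G := ironedRevenueCurve F
  set c := (G (q + m) - G q) / m with hc
  have hcm : c * m = G (q + m) - G q := by rw [hc]; field_simp
  have hconc : ConcaveOn ℝ (Set.Icc 0 1) G := concaveOn_ironedRevenueCurve h1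
  have hqI : q ∈ Set.Icc (0 : ℝ) 1 := ⟨hq, by linarith⟩
  have hqmI : q + m ∈ Set.Icc (0 : ℝ) 1 := ⟨by linarith, hqm⟩
  have e1 : s * q ≤ G q := mul_le_ironedRevenueCurve h1 h0 hs hqI fun v hv hvs => by
    linarith [h v hv hvs]
  have e2 : s * (q + m) ≤ G (q + m) := mul_le_ironedRevenueCurve h1 h0 hs hqmI h
  have key := ironedRevenueCurve_le_affine h1 (a := G q - c * q) (b := c) (fun x hx => ?_) ht
  · linarith
  -- Outside [q, q + m] concavity puts the curve below the extended chord. Inside, the revenue curve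
  -- is at most s x, which lies below the chord since it does so at both ends.
  rcases lt_or_ge x q with hxq | hxq
  · refine (revenueCurve_le_ironed h1 hx).trans ?_
    have := hconc.slope_anti_adjacent hx hqmI hxq (by linarith : q < q + m)
    rw [add_sub_cancel_left, ← hc, le_div_iff₀ (sub_pos.2 hxq)] at this
    have h3 : ironedRevenueCurve F x = G x := rfl
    linarith
  rcases le_or_gt x (q + m) with hxm | hxm
  · refine (revenueCurve_le_mul hs hx.1 hxq).trans ?_
    have h3 : (q + m - x) * (s * q) + (x - q) * (s * (q + m))
        ≤ (q + m - x) * G q + (x - q) * G (q + m) :=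
      add_le_add (mul_le_mul_of_nonneg_left e1 (by linarith))
        (mul_le_mul_of_nonneg_left e2 (by linarith))
    have h4 : m * (s * x) ≤ m * (G q - c * q + c * x) := by
      have : m * (G q - c * q + c * x) = m * G q + (c * m) * (x - q) := by ring
      rw [this, hcm]
      linarith
    exact le_of_mul_le_mul_left h4 hm
  · refine (revenueCurve_le_ironed h1 hx).trans ?_
    have := hconc.slope_anti_adjacent hqI hx (by linarith : q < q + m) hxm
    rw [add_sub_cancel_left, ← hc, div_le_iff₀ (sub_pos.2 hxm)] at this
    have h3 : ironedRevenueCurve F x = G x := rfl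
    linarith

/-- Along an atom the ironed curve is affine, so virtual value times mass is an exact increment of
the curve; these increments telescope over atoms. -/
theorem ironedSlope_mul_atom (h1 : quantileOf F 1 ≤ 0) (h0 : quantileOf F 0 < 1) {s m : ℝ}
    (hs : 0 ≤ s) (hm : 0 ≤ m) (hq : 0 ≤ quantileOf F s) (hqm : quantileOf F s + m ≤ 1)
    (h : ∀ v, 0 ≤ v → v < s → quantileOf F s + m ≤ quantileOf F v) :
    ironedSlope F (quantileOf F s) * m
      = ironedRevenueCurve F (quantileOf F s + m) - ironedRevenueCurve F (quantileOf F s) := by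
  rcases hm.eq_or_lt with hm0 | hm0
  · rw [← hm0]; simp
  have hqI : quantileOf F s ∈ Set.Ico (0 : ℝ) 1 := ⟨hq, by linarith⟩
  refine le_antisymm ?_ ?_
  · have := ironedSlope_le h1 hqI (b := (ironedRevenueCurve F (quantileOf F s + m)
      - ironedRevenueCurve F (quantileOf F s)) / m) fun t ht =>
      ironedRevenueCurve_le_of_atom h1 h0 hs hm0 hq hqm h ⟨hq.trans ht.1.le, ht.2⟩
    rwa [le_div_iff₀ hm0] at this
  · have := ironedRevenueCurve_le_add_slope h1 hqI (t := quantileOf F s + m) ⟨by linarith, hqm⟩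
    rw [add_sub_cancel_left] at this
    linarith

/-- Where the ironed revenue curve has a corner, at the top `quantileOf F s + m` of an atom `s`, it
agrees with the revenue curve. -/
theorem ironedRevenueCurve_le_of_corner (h1 : quantileOf F 1 ≤ 0) (h0 : quantileOf F 0 < 1)
    {s m : ℝ} (hs : 0 ≤ s) (hm : 0 < m) (hq : 0 ≤ quantileOf F s) (hqm : quantileOf F s + m < 1)
    (h : ∀ v, 0 ≤ v → v < s → quantileOf F s + m ≤ quantileOf F v)
    (hcorner : ironedSlope F (quantileOf F s + m) < ironedSlope F (quantileOf F s)) :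
    ironedRevenueCurve F (quantileOf F s + m) ≤ s * (quantileOf F s + m) := by
  set G := ironedRevenueCurve F with hG
  set Q := quantileOf F s + m with hQ
  set d := ironedSlope F Q with hd
  set e := ironedSlope F (quantileOf F s) with he
  have hQI : Q ∈ Set.Ico (0 : ℝ) 1 := ⟨by linarith, hqm⟩
  have hem : e * m = G Q - G (quantileOf F s) := ironedSlope_mul_atom h1 h0 hs hm.le hq hqm.le h
  have hleft : ∀ t ∈ Set.Icc (0 : ℝ) 1, G t ≤ G Q + e * (t - Q) := fun t ht => by
    have := ironedRevenueCurve_le_add_slope h1 (q := quantileOf F s) ⟨hq, by linarith⟩ ht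
    simp only [← hG, ← he] at this
    have h2 : e * (t - Q) = e * (t - quantileOf F s) - e * m := by rw [hQ]; ring
    rw [h2, hem]
    linarith
  have hright : ∀ t ∈ Set.Icc (0 : ℝ) 1, G t ≤ G Q + d * (t - Q) := fun t ht =>
    ironedRevenueCurve_le_add_slope h1 hQI ht
  by_contra hcon
  rw [not_le] at hcon
  -- If G exceeded s * Q at the corner, a line of slope strictly between d and e passing κ below G Q
  -- would still majorize the revenue curve: within r of Q because that curve is at most s x,
  -- farther away because of the two supporting lines. This would force G Q ≤ G Q - κ.
  set γ := G Q - s * Q with hγ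
  have hγ0 : 0 < γ := sub_pos.2 hcon
  set c := (d + e) / 2 with hc
  have hce : 0 < e - c := by rw [hc]; linarith
  have hdc : 0 < c - d := by rw [hc]; linarith
  set r := min m (γ / (2 * (|s - c| + 1))) with hr
  have hA : 0 < |s - c| + 1 := by positivity
  have hr0 : 0 < r := lt_min hm (by positivity)
  have hrγ : |s - c| * r ≤ γ / 2 := by
    have h2 : r ≤ γ / (2 * (|s - c| + 1)) := min_le_right _ _
    rw [le_div_iff₀ (by positivity)] at h2
    nlinarith [abs_nonneg (s - c)]
  set κ := min (γ / 2) (min ((e - c) * r) ((c - d) * r)) with hκ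
  have hκ0 : 0 < κ := lt_min (by linarith) (lt_min (by positivity) (by positivity))
  have hκ1 : κ ≤ γ / 2 := min_le_left _ _
  have hκ2 : κ ≤ (e - c) * r := (min_le_right _ _).trans (min_le_left _ _)
  have hκ3 : κ ≤ (c - d) * r := (min_le_right _ _).trans (min_le_right _ _)
  have key := ironedRevenueCurve_le_affine h1 (a := G Q - κ - c * Q) (b := c) (fun x hx => ?_)
    (q := Q) ⟨hQI.1, hQI.2.le⟩
  · simp only [← hG] at key
    linarith
  rcases lt_or_ge x (Q - r) with hx1 | hx1
  · refine (revenueCurve_le_ironed h1 hx).trans ((hleft x hx).trans ?_)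
    have : (e - c) * r ≤ (e - c) * (Q - x) := mul_le_mul_of_nonneg_left (by linarith) hce.le
    linarith
  rcases le_or_gt x (Q + r) with hx2 | hx2
  · have hrm : r ≤ m := min_le_left _ _
    refine (revenueCurve_le_mul hs hx.1 (by linarith : quantileOf F s ≤ x)).trans ?_
    have h3 : (s - c) * (x - Q) ≤ γ / 2 := by
      calc (s - c) * (x - Q) ≤ |(s - c) * (x - Q)| := le_abs_self _
        _ = |s - c| * |x - Q| := abs_mul _ _
        _ ≤ |s - c| * r := mul_le_mul_of_nonneg_left
            (abs_le.2 ⟨by linarith, by linarith⟩) (abs_nonneg _)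
        _ ≤ γ / 2 := hrγ
    linarith
  · refine (revenueCurve_le_ironed h1 hx).trans ((hright x hx).trans ?_)
    have : (c - d) * r ≤ (c - d) * (x - Q) := mul_le_mul_of_nonneg_left (by linarith) hdc.le
    linarith

end Hull


/-! ### Finitely supported value distributions -/

/-- `m` assigns masses to a finite set `S ∋ 0` of values in the unit interval. -/
structure IsAtomicMass (S : Finset ℝ) (m : ℝ → ℝ) : Prop where
  zero_mem : 0 ∈ S
  mem_Icc : ∀ s ∈ S, s ∈ Set.Icc (0 : ℝ) 1
  nonneg : ∀ s, 0 ≤ m s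
  sum_eq_one : ∑ s ∈ S, m s = 1
  zero_pos : 0 < m 0

/-- The CDF of the distribution with masses `m` on `S`. -/
noncomputable def atomicCDF (S : Finset ℝ) (m : ℝ → ℝ) (v : ℝ) : ℝ := ∑ s ∈ S with s ≤ v, m s

/-- The distribution with masses `m` on `S`. -/
noncomputable def atomicMeasure (S : Finset ℝ) (m : ℝ → ℝ) : Measure ℝ :=
  ∑ s ∈ S, ENNReal.ofReal (m s) • Measure.dirac s

/-- The projection of the real line to the unit interval. -/
noncomputable def clampUnit (v : ℝ) : ℝ := max 0 (min v 1)

theorem clampUnit_mem (v : ℝ) : clampUnit v ∈ Set.Icc (0 : ℝ) 1 :=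
  ⟨le_max_left _ _, max_le zero_le_one (min_le_right _ _)⟩

theorem clampUnit_of_mem {v : ℝ} (hv : v ∈ Set.Icc (0 : ℝ) 1) : clampUnit v = v := by
  rw [clampUnit, min_eq_left hv.2, max_eq_right hv.1]

theorem monotone_clampUnit : Monotone clampUnit := fun _ _ h =>
  max_le_max le_rfl (min_le_min h le_rfl)

theorem Finset.exists_masses (S : Finset ℝ) {f : ℝ → ℝ} (hf : Monotone f) (h0 : ∀ v, 0 ≤ f v) :
    ∃ m : ℝ → ℝ, (∀ s, 0 ≤ m s) ∧ ∀ t ∈ S, ∑ s ∈ S with s ≤ t, m s = f t := by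
  induction S using Finset.induction_on_max with
  | empty => exact ⟨fun _ => 0, fun _ => le_rfl, by simp⟩
  | insert a S ha ih =>
    obtain ⟨m, hm, hS⟩ := ih
    have haS : a ∉ S := fun h => lt_irrefl a (ha a h)
    have hle : ∑ s ∈ S, m s ≤ f a := by
      rcases S.eq_empty_or_nonempty with h | h
      · simp [h, h0]
      · have h1 := hS _ (S.max'_mem h)
        rw [Finset.filter_true_of_mem fun s hs => S.le_max' s hs] at h1
        rw [h1]
        exact hf (ha _ (S.max'_mem h)).le
    refine ⟨Function.update m a (f a - ∑ s ∈ S, m s), fun s => ?_, fun t ht => ?_⟩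
    · rcases eq_or_ne s a with h | h
      · rw [h, Function.update_self]; linarith
      · rw [Function.update_of_ne h]; exact hm s
    · have hupd : ∀ T ⊆ S, ∑ s ∈ T, Function.update m a (f a - ∑ s ∈ S, m s) s = ∑ s ∈ T, m s :=
        fun T hT => Finset.sum_congr rfl fun s hs =>
          Function.update_of_ne (fun h => haS (by rw [← h]; exact hT hs)) _ _
      rcases Finset.mem_insert.1 ht with h | h
      · rw [h, Finset.filter_true_of_mem, Finset.sum_insert haS, hupd S subset_rfl,
          Function.update_self]
        · ring
        · intro s hs
          rcases Finset.mem_insert.1 hs with h2 | h2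
          · exact h2.le
          · exact (ha s h2).le
      · rw [Finset.filter_insert, if_neg (not_le.2 (ha t h)), hupd _ (Finset.filter_subset _ _)]
        exact hS t h

theorem atomicCDF_eq_of_step {S : Finset ℝ} {m f : ℝ → ℝ}
    (hm : ∀ t ∈ S, ∑ s ∈ S with s ≤ t, m s = f t)
    (hf : ∀ v w, v ≤ w → (∀ s ∈ S, s ≤ w → s ≤ v) → f v = f w) {v : ℝ}
    (hv : ∃ s ∈ S, s ≤ v) : atomicCDF S m v = f v := by
  obtain ⟨s0, hs0, hs0v⟩ := hv
  have hne : (S.filter (· ≤ v)).Nonempty := ⟨s0, Finset.mem_filter.2 ⟨hs0, hs0v⟩⟩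
  set t := (S.filter (· ≤ v)).max' hne
  have ht := Finset.mem_filter.1 ((S.filter (· ≤ v)).max'_mem hne)
  have hmax : ∀ s ∈ S, s ≤ v → s ≤ t := fun s hs hsv =>
    Finset.le_max' _ _ (Finset.mem_filter.2 ⟨hs, hsv⟩)
  rw [← hf t v ht.2 hmax, ← hm t ht.1, atomicCDF]
  congr 1
  ext s
  simp only [Finset.mem_filter]
  exact ⟨fun h => ⟨h.1, hmax s h.1 h.2⟩, fun h => ⟨h.1, h.2.trans ht.2⟩⟩

namespace IsAtomicMass

variable {S : Finset ℝ} {m : ℝ → ℝ}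

theorem integral_eq (h : IsAtomicMass S m) (f : ℝ → ℝ) :
    ∫ v, f v ∂(atomicMeasure S m) = ∑ s ∈ S, m s * f s := by
  rw [atomicMeasure, integral_finsetSum_measure]
  · refine Finset.sum_congr rfl fun s _ => ?_
    rw [integral_smul_measure, integral_dirac, ENNReal.toReal_ofReal (h.nonneg s), smul_eq_mul]
  · intro s _
    exact (integrable_dirac (by simp)).smul_measure ENNReal.ofReal_ne_top

theorem apply_eq (h : IsAtomicMass S m) {A : Set ℝ} [DecidablePred (· ∈ A)] (hA : MeasurableSet A) :
    atomicMeasure S m A = ENNReal.ofReal (∑ s ∈ S with s ∈ A, m s) := by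
  rw [atomicMeasure, Measure.finsetSum_apply, ENNReal.ofReal_sum_of_nonneg fun s _ => h.nonneg s,
    Finset.sum_filter]
  refine Finset.sum_congr rfl fun s _ => ?_
  rw [Measure.smul_apply, Measure.dirac_apply' _ hA, smul_eq_mul]
  by_cases hs : s ∈ A <;> simp [hs]

theorem real_eq (h : IsAtomicMass S m) {A : Set ℝ} [DecidablePred (· ∈ A)] (hA : MeasurableSet A) :
    (atomicMeasure S m).real A = ∑ s ∈ S with s ∈ A, m s := by
  rw [Measure.real, h.apply_eq hA,
    ENNReal.toReal_ofReal (Finset.sum_nonneg fun s _ => h.nonneg s)]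

theorem isProbabilityMeasure (h : IsAtomicMass S m) : IsProbabilityMeasure (atomicMeasure S m) := by
  classical
  refine ⟨?_⟩
  rw [h.apply_eq MeasurableSet.univ]
  simp [h.sum_eq_one]

theorem real_Iic (h : IsAtomicMass S m) (v : ℝ) :
    (atomicMeasure S m).real (Set.Iic v) = atomicCDF S m v := by
  classical
  rw [h.real_eq measurableSet_Iic]
  simp [atomicCDF]

theorem quantileOf_eq (h : IsAtomicMass S m) (v : ℝ) :
    quantileOf (atomicCDF S m) v = ∑ s ∈ S with v < s, m s := by
  rw [quantileOf, atomicCDF, ← h.sum_eq_one,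
    ← Finset.sum_filter_add_sum_filter_not S (fun s => s ≤ v) m]
  simp only [not_le]
  ring

theorem quantileOf_nonneg (h : IsAtomicMass S m) (v : ℝ) : 0 ≤ quantileOf (atomicCDF S m) v := by
  rw [h.quantileOf_eq]
  exact Finset.sum_nonneg fun s _ => h.nonneg s

theorem antitone_quantileOf (h : IsAtomicMass S m) : Antitone (quantileOf (atomicCDF S m)) :=
  fun a b hab => by
    rw [h.quantileOf_eq, h.quantileOf_eq]
    refine Finset.sum_le_sum_of_subset_of_nonneg (fun s hs => ?_) fun s _ _ => h.nonneg s
    simp only [Finset.mem_filter] at hs ⊢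
    exact ⟨hs.1, hab.trans_lt hs.2⟩

theorem quantileOf_one (h : IsAtomicMass S m) : quantileOf (atomicCDF S m) 1 ≤ 0 := by
  rw [h.quantileOf_eq, Finset.filter_false_of_mem fun s hs => not_lt.2 (h.mem_Icc s hs).2]
  simp

theorem quantileOf_add_le_of_lt (h : IsAtomicMass S m) {s v : ℝ} (hs : s ∈ S) (hv : v < s) :
    quantileOf (atomicCDF S m) s + m s ≤ quantileOf (atomicCDF S m) v := by
  rw [h.quantileOf_eq, h.quantileOf_eq, add_comm,
    ← Finset.sum_insert (by simp : s ∉ S.filter (s < ·))]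
  refine Finset.sum_le_sum_of_subset_of_nonneg (fun t ht => ?_) fun s _ _ => h.nonneg s
  rw [Finset.mem_insert, Finset.mem_filter] at ht
  rw [Finset.mem_filter]
  rcases ht with ht | ht
  · exact ht ▸ ⟨hs, hv⟩
  · exact ⟨ht.1, hv.trans ht.2⟩

theorem quantileOf_le_one (h : IsAtomicMass S m) (v : ℝ) : quantileOf (atomicCDF S m) v ≤ 1 := by
  rw [h.quantileOf_eq, ← h.sum_eq_one]
  exact Finset.sum_le_sum_of_subset_of_nonneg (Finset.filter_subset _ _) fun s _ _ => h.nonneg s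

theorem quantileOf_add_le_one (h : IsAtomicMass S m) {s : ℝ} (hs : s ∈ S) :
    quantileOf (atomicCDF S m) s + m s ≤ 1 :=
  (h.quantileOf_add_le_of_lt hs (sub_one_lt s)).trans (h.quantileOf_le_one _)

theorem quantileOf_lt_one (h : IsAtomicMass S m) {v : ℝ} (hv : 0 ≤ v) :
    quantileOf (atomicCDF S m) v < 1 :=
  (h.antitone_quantileOf hv).trans_lt
    (lt_of_lt_of_le (lt_add_of_pos_right _ h.zero_pos) (h.quantileOf_add_le_one h.zero_mem))

theorem quantileOf_mem (h : IsAtomicMass S m) {v : ℝ} (hv : 0 ≤ v) :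
    quantileOf (atomicCDF S m) v ∈ Set.Ico (0 : ℝ) 1 :=
  ⟨h.quantileOf_nonneg v, h.quantileOf_lt_one hv⟩

/-- The clamp avoids negative values, whose quantile is 1: there the right derivative looks outside
[0, 1] and concavity gives no control. -/
theorem monotone_virtualValue (h : IsAtomicMass S m) :
    Monotone fun v => ironedVirtualValue (atomicCDF S m) (clampUnit v) := fun a _ hab =>
  ironedSlope_anti h.quantileOf_one (h.quantileOf_nonneg _)
    (h.antitone_quantileOf (monotone_clampUnit hab)) (h.quantileOf_lt_one (clampUnit_mem a).1)

theorem virtualValue_le_one (h : IsAtomicMass S m) (v : ℝ) :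
    ironedVirtualValue (atomicCDF S m) (clampUnit v) ≤ 1 :=
  ironedSlope_le_one h.quantileOf_one (h.quantileOf_mem (clampUnit_mem v).1)

theorem virtualValue_zero_le (h : IsAtomicMass S m) (v : ℝ) :
    ironedVirtualValue (atomicCDF S m) (clampUnit 0)
      ≤ ironedVirtualValue (atomicCDF S m) (clampUnit v) :=
  ironedSlope_anti h.quantileOf_one (h.quantileOf_nonneg _)
    (h.antitone_quantileOf (by
      rw [clampUnit_of_mem (by simp)]; exact (clampUnit_mem v).1))
    (h.quantileOf_lt_one (clampUnit_mem 0).1)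

theorem virtualValue_congr (h : IsAtomicMass S m) {v w : ℝ} (hvw : v ≤ w)
    (hS : ∀ s ∈ S, s ≤ w → s ≤ v) :
    ironedVirtualValue (atomicCDF S m) v = ironedVirtualValue (atomicCDF S m) w := by
  have : quantileOf (atomicCDF S m) v = quantileOf (atomicCDF S m) w := by
    rw [h.quantileOf_eq, h.quantileOf_eq]
    congr 1
    ext s
    simp only [Finset.mem_filter]
    exact ⟨fun hs => ⟨hs.1, lt_of_not_ge fun hsw => absurd (hS s hs.1 hsw) (not_le.2 hs.2)⟩,
      fun hs => ⟨hs.1, hvw.trans_lt hs.2⟩⟩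
  rw [ironedVirtualValue, ironedVirtualValue, this]

/-- Adding atoms from the top down, each contributes the increment of the ironed curve over its
quantile interval. -/
theorem sum_virtualValue (h : IsAtomicMass S m) (T : Finset ℝ) (hT : T ⊆ S)
    (hup : ∀ s ∈ T, ∀ t ∈ S, s ≤ t → t ∈ T) :
    ∑ s ∈ T, m s * ironedVirtualValue (atomicCDF S m) s
      = ironedRevenueCurve (atomicCDF S m) (∑ s ∈ T, m s) := by
  induction T using Finset.induction_on_min with
  | empty => simp [ironedRevenueCurve_zero h.quantileOf_one]
  | insert a T ha ih =>
    have haT : a ∉ T := fun h => lt_irrefl a (ha a h)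
    have haS : a ∈ S := hT (Finset.mem_insert_self a T)
    have hTS : T ⊆ S := (Finset.subset_insert a T).trans hT
    have hup' : ∀ s ∈ T, ∀ t ∈ S, s ≤ t → t ∈ T := fun s hs t ht hst =>
      (Finset.mem_insert.1 (hup s (Finset.mem_insert_of_mem hs) t ht hst)).resolve_left
        fun h => absurd (ha s hs) (not_lt.2 (h ▸ hst))
    have hq : quantileOf (atomicCDF S m) a = ∑ s ∈ T, m s := by
      rw [h.quantileOf_eq]
      congr 1
      ext t
      simp only [Finset.mem_filter]
      exact ⟨fun ht => (Finset.mem_insert.1 (hup a (Finset.mem_insert_self a T) t ht.1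
        ht.2.le)).resolve_left ht.2.ne', fun ht => ⟨hTS ht, ha t ht⟩⟩
    have key := ironedSlope_mul_atom h.quantileOf_one (h.quantileOf_lt_one le_rfl)
      (h.mem_Icc a haS).1 (h.nonneg a) (h.quantileOf_nonneg a) (h.quantileOf_add_le_one haS)
      fun v _ hv => h.quantileOf_add_le_of_lt haS hv
    rw [Finset.sum_insert haT, Finset.sum_insert haT, ih hTS hup', ← hq, add_comm (m a) (quantileOf _ _)]
    have e : ironedVirtualValue (atomicCDF S m) a
        = ironedSlope (atomicCDF S m) (quantileOf (atomicCDF S m) a) := rfl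
    rw [e]
    linarith

theorem setIntegral_virtualValue (h : IsAtomicMass S m) {U : Set ℝ} (hU : IsUpperSet U) :
    ∫ v in U, ironedVirtualValue (atomicCDF S m) (clampUnit v) ∂(atomicMeasure S m)
      = ironedRevenueCurve (atomicCDF S m) ((atomicMeasure S m).real U) := by
  classical
  rw [h.real_eq hU.measurableSet_real, ← h.sum_virtualValue (S.filter (· ∈ U))
    (Finset.filter_subset _ _), ← integral_indicator hU.measurableSet_real, h.integral_eq,
    Finset.sum_filter]
  · refine Finset.sum_congr rfl fun s hs => ?_
    by_cases hsU : s ∈ U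
    · rw [Set.indicator_of_mem hsU, if_pos hsU, clampUnit_of_mem (h.mem_Icc s hs)]
    · rw [Set.indicator_of_notMem hsU, if_neg hsU, mul_zero]
  · intro s hs t ht hst
    simp only [Finset.mem_filter] at hs ⊢
    exact ⟨ht, hU hst hs.2⟩

theorem postedPrice_mul_le (h : IsAtomicMass S m) {U : Set ℝ} (hU : IsUpperSet U) :
    postedPrice U * (atomicMeasure S m).real U
      ≤ ∫ v in U, ironedVirtualValue (atomicCDF S m) (clampUnit v) ∂(atomicMeasure S m) := by
  classical
  have := h.isProbabilityMeasure
  rw [h.setIntegral_virtualValue hU]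
  refine mul_le_ironedRevenueCurve h.quantileOf_one (h.quantileOf_lt_one le_rfl)
    (postedPrice_nonneg U) ⟨measureReal_nonneg, measureReal_le_one⟩ fun v hv hvb => ?_
  have hvU : v ∉ U := fun hvU => by
    refine absurd hvb (not_lt.2 ?_)
    calc volume.real (Set.Ioo 0 1 \ U) ≤ volume.real (Set.Ioo 0 v) := by
          refine measureReal_mono (fun w hw => ⟨hw.1.1, lt_of_not_ge fun hvw => hw.2 (hU hvw hvU)⟩)
            (by simp)
      _ = v := by simp [Measure.real, hv]
  rw [h.real_eq hU.measurableSet_real, h.quantileOf_eq]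
  refine Finset.sum_le_sum_of_subset_of_nonneg (fun s hs => ?_) fun s _ _ => h.nonneg s
  simp only [Finset.mem_filter] at hs ⊢
  exact ⟨hs.1, lt_of_not_ge fun hsv => hvU (hU hsv hs.2)⟩

/-- Saturation forces U to begin exactly at its lowest atom b, so the price is b, and forces φ to
jump there. The ironed curve then has a corner at the mass Q of U, where it is at most b * Q. -/
theorem le_postedPrice_mul (h : IsAtomicMass S m) {U : Set ℝ} (hU : IsUpperSet U)
    (hsat : ∀ v w, ironedVirtualValue (atomicCDF S m) (clampUnit v)
      = ironedVirtualValue (atomicCDF S m) (clampUnit w) → v ∈ U → w ∈ U) :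
    ∫ v in U, ironedVirtualValue (atomicCDF S m) (clampUnit v) ∂(atomicMeasure S m)
      ≤ postedPrice U * (atomicMeasure S m).real U := by
  classical
  have := h.isProbabilityMeasure
  have h1 := h.quantileOf_one
  have h0 := h.quantileOf_lt_one le_rfl
  rw [h.setIntegral_virtualValue hU, h.real_eq hU.measurableSet_real]
  set Q := ∑ s ∈ S with s ∈ U, m s with hQ
  have hQ0 : 0 ≤ Q := Finset.sum_nonneg fun s _ => h.nonneg s
  rcases (S.filter (· ∈ U)).eq_empty_or_nonempty with he | hne
  · rw [hQ, he, Finset.sum_empty, ironedRevenueCurve_zero h1, mul_zero]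
  set b := (S.filter (· ∈ U)).min' hne with hb
  have hbmem := Finset.mem_filter.1 ((S.filter (· ∈ U)).min'_mem hne)
  have hbS : b ∈ S := hbmem.1
  have hbU : b ∈ U := hbmem.2
  have hbmin : ∀ s ∈ S, s ∈ U → b ≤ s := fun s hs hsU =>
    Finset.min'_le _ _ (Finset.mem_filter.2 ⟨hs, hsU⟩)
  have hbI := h.mem_Icc b hbS
  have hQb : Q = quantileOf (atomicCDF S m) b + m b := by
    rw [h.quantileOf_eq, add_comm, ← Finset.sum_insert (by simp : b ∉ S.filter (b < ·)), hQ]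
    congr 1
    ext s
    simp only [Finset.mem_filter, Finset.mem_insert]
    constructor
    · rintro ⟨hs, hsU⟩
      rcases (hbmin s hs hsU).eq_or_lt with hc | hc
      · exact Or.inl hc.symm
      · exact Or.inr ⟨hs, hc⟩
    · rintro (hc | hc)
      · exact hc ▸ ⟨hbS, hbU⟩
      · exact ⟨hc.1, hU hc.2.le hbU⟩
  -- With b = 0 the set U contains all the mass, and the ironed curve vanishes at 1.
  rcases hbI.1.eq_or_lt with hb0 | hb0
  · have : Q = 1 := by
      rw [hQ, Finset.filter_true_of_mem, h.sum_eq_one]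
      exact fun s hs => hU (hb0 ▸ (h.mem_Icc s hs).1) hbU
    rw [this, ironedRevenueCurve_one h1 h0, mul_one]
    exact postedPrice_nonneg U
  have hne' : (S.filter (· < b)).Nonempty := ⟨0, Finset.mem_filter.2 ⟨h.zero_mem, hb0⟩⟩
  set b' := (S.filter (· < b)).max' hne' with hb'
  have hbmem' := Finset.mem_filter.1 ((S.filter (· < b)).max'_mem hne')
  have hbS' : b' ∈ S := hbmem'.1
  have hbb' : b' < b := hbmem'.2
  have hbmax' : ∀ s ∈ S, s < b → s ≤ b' := fun s hs hsb =>
    Finset.le_max' _ _ (Finset.mem_filter.2 ⟨hs, hsb⟩)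
  have hbI' := h.mem_Icc b' hbS'
  have hbU' : b' ∉ U := fun hc => absurd (hbmin b' hbS' hc) (not_le.2 hbb')
  have hbelow : ∀ v, v < b → v ∉ U := fun v hvb hvU => by
    rcases le_total v b' with hc | hc
    · exact hbU' (hU hc hvU)
    · have hvI : v ∈ Set.Icc (0 : ℝ) 1 := ⟨hbI'.1.trans hc, hvb.le.trans hbI.2⟩
      -- No atom lies strictly between b' and b, so v has the virtual value of b'; were v in U,
      -- saturation would put b' in U.
      refine hbU' (hsat v b' ?_ hvU)
      rw [clampUnit_of_mem hvI, clampUnit_of_mem hbI']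
      exact (h.virtualValue_congr hc fun s hs hsv => hbmax' s hs (hsv.trans_lt hvb)).symm
  have hprice : b ≤ postedPrice U := by
    calc b = volume.real (Set.Ioo 0 b) := by simp [Measure.real, hbI.1]
      _ ≤ volume.real (Set.Ioo 0 1 \ U) := by
        refine measureReal_mono (fun w hw => ⟨⟨hw.1, hw.2.trans_le hbI.2⟩, hbelow w hw.2⟩) ?_
        exact ((measure_mono Set.sdiff_subset).trans_lt
          (by simp : volume (Set.Ioo (0 : ℝ) 1) < ⊤)).ne
  refine le_trans ?_ (mul_le_mul_of_nonneg_right hprice hQ0)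
  have hQb' : Q = quantileOf (atomicCDF S m) b' := by
    rw [h.quantileOf_eq, hQ]
    congr 1
    ext s
    simp only [Finset.mem_filter]
    exact ⟨fun hs => ⟨hs.1, lt_of_not_ge fun hc => hbU' (hU hc hs.2)⟩,
      fun hs => ⟨hs.1, hU (le_of_not_gt fun hc => absurd (hbmax' s hs.1 hc) (not_le.2 hs.2)) hbU⟩⟩
  have hlt : ironedSlope (atomicCDF S m) Q
      < ironedSlope (atomicCDF S m) (quantileOf (atomicCDF S m) b) := by
    rw [hQb']
    refine lt_of_le_of_ne (ironedSlope_anti h1 (h.quantileOf_nonneg _)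
      (h.antitone_quantileOf hbb'.le) (h.quantileOf_lt_one hbI'.1)) fun hc => hbU' ?_
    refine hsat b b' ?_ hbU
    rw [clampUnit_of_mem hbI, clampUnit_of_mem hbI']
    exact hc.symm
  have hm : 0 < m b := by
    refine (h.nonneg b).lt_of_ne fun hc => ?_
    rw [hQb, ← hc, add_zero] at hlt
    exact lt_irrefl _ hlt
  rw [hQb]
  refine ironedRevenueCurve_le_of_corner h1 h0 hbI.1 hm (h.quantileOf_nonneg b) ?_
    (fun v _ hv => h.quantileOf_add_le_of_lt hbS hv) (hQb ▸ hlt)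
  rw [← hQb, hQb']
  exact h.quantileOf_lt_one hbI'.1

end IsAtomicMass


/-! ### Concentration of empirical frequencies -/

theorem Real.exp_le_cubic {u : ℝ} (hu : |u| ≤ 1) :
    Real.exp u ≤ 1 + u + u ^ 2 / 2 + 2 / 9 * |u| ^ 3 := by
  have h := (abs_le.1 (Real.exp_bound hu (n := 3) (by norm_num))).2
  norm_num [Finset.sum_range_succ, Nat.factorial] at h
  linarith

/-- After centring by exp(-θp) both exponents are at most 1 in size and the linear Taylor terms
cancel. The cubic terms are absorbed by p² + (1 - p)² ≤ 1. -/
theorem bernoulli_exp_le {p θ : ℝ} (hp0 : 0 ≤ p) (hp1 : p ≤ 1) (hθ0 : 0 ≤ θ) (hθ1 : θ ≤ 1) :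
    1 - p + p * Real.exp (-θ)
      ≤ Real.exp (-(θ * p) + θ ^ 2 * (p * (1 - p)) / 2 + 2 / 9 * θ ^ 3 * (p * (1 - p))) := by
  have h1 : θ * p ≤ 1 := mul_le_one₀ hθ1 hp0 hp1
  have h2 : θ * (1 - p) ≤ 1 := mul_le_one₀ hθ1 (by linarith) (by linarith)
  have a1 : 0 ≤ θ * p := mul_nonneg hθ0 hp0
  have a2 : 0 ≤ θ * (1 - p) := mul_nonneg hθ0 (by linarith)
  have e1 := Real.exp_le_cubic (u := θ * p) (by rw [abs_of_nonneg a1]; exact h1)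
  have e2 := Real.exp_le_cubic (u := -(θ * (1 - p))) (by rw [abs_neg, abs_of_nonneg a2]; exact h2)
  rw [abs_of_nonneg a1] at e1
  rw [abs_neg, abs_of_nonneg a2] at e2
  have hv : 0 ≤ p * (1 - p) := mul_nonneg hp0 (by linarith)
  have key : (1 - p) * Real.exp (θ * p) + p * Real.exp (-(θ * (1 - p)))
      ≤ 1 + θ ^ 2 * (p * (1 - p)) / 2 + 2 / 9 * θ ^ 3 * (p * (1 - p)) := by
    have f1 := mul_le_mul_of_nonneg_left e1 (by linarith : 0 ≤ 1 - p)
    have f2 := mul_le_mul_of_nonneg_left e2 hp0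
    have f3 : 0 ≤ θ ^ 3 * (p * (1 - p)) * (2 * (p * (1 - p))) := by positivity
    nlinarith
  have e3 : 1 - p + p * Real.exp (-θ) = Real.exp (-(θ * p))
      * ((1 - p) * Real.exp (θ * p) + p * Real.exp (-(θ * (1 - p)))) := by
    rw [mul_add, mul_left_comm, mul_left_comm (Real.exp (-(θ * p))), ← Real.exp_add, ← Real.exp_add]
    have : -(θ * p) + θ * p = 0 := by ring
    rw [this]
    have : -(θ * p) + -(θ * (1 - p)) = -θ := by ring
    rw [this, Real.exp_zero, mul_one]
  rw [e3, add_assoc, Real.exp_add]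
  refine mul_le_mul_of_nonneg_left (key.trans ?_) (Real.exp_nonneg _)
  have := Real.add_one_le_exp (θ ^ 2 * (p * (1 - p)) / 2 + 2 / 9 * θ ^ 3 * (p * (1 - p)))
  linarith

/-- The exponent θ = d/(v + d) minimizes -θd + θ²(v + d)/2. Using v + d instead of v keeps θ ≤ 1 and
leaves room for the cubic term. -/
theorem bernoulli_exp_le' {p d v : ℝ} (hp0 : 0 ≤ p) (hp1 : p ≤ 1) (hd : 0 < d)
    (hv : v = p * (1 - p)) :
    Real.exp (d / (v + d) * (p - d)) * (1 - p + p * Real.exp (-(d / (v + d))))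
      ≤ Real.exp (-(d ^ 2 / (2 * (v + d)))) := by
  have hv0 : 0 ≤ v := hv ▸ mul_nonneg hp0 (by linarith)
  have hvd : 0 < v + d := by linarith
  set θ := d / (v + d) with hθ
  have hθ0 : 0 ≤ θ := div_nonneg hd.le hvd.le
  have hθ1 : θ ≤ 1 := (div_le_one hvd).2 (by linarith)
  have hθd : θ * (v + d) = d := div_mul_cancel₀ _ hvd.ne'
  refine (mul_le_mul_of_nonneg_left (bernoulli_exp_le hp0 hp1 hθ0 hθ1) (Real.exp_nonneg _)).trans ?_
  rw [← Real.exp_add, ← hv, Real.exp_le_exp]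
  have e1 : d ^ 2 / (2 * (v + d)) = θ * d / 2 := by rw [hθ]; field_simp
  rw [e1]
  have k1 : θ * v ≤ d := by nlinarith
  have k2 : 0 ≤ θ * (θ * (d - θ * v)) := by
    have : 0 ≤ d - θ * v := by linarith
    positivity
  have k3 : θ ^ 3 * v = θ ^ 2 * d - θ ^ 2 * (θ * d) := by
    have : θ ^ 3 * v = θ ^ 2 * (θ * (v + d)) - θ ^ 2 * (θ * d) := by ring
    rw [this, hθd]
  have k4 : θ ^ 2 * v = θ * d - θ * (θ * d) := by
    have : θ ^ 2 * v = θ * (θ * (v + d)) - θ * (θ * d) := by ring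
    rw [this, hθd]
  have k5 : 0 ≤ θ ^ 2 * (θ * d) := by positivity
  nlinarith [mul_nonneg (mul_nonneg hθ0 hθ0) hd.le]

theorem integral_exp_neg_indicator {Ω : Type*} [MeasurableSpace Ω] (ν : Measure Ω)
    [IsProbabilityMeasure ν] {A : Set Ω} (hA : MeasurableSet A) (θ : ℝ) :
    ∫ w, Real.exp (-(θ * A.indicator (fun _ => (1 : ℝ)) w)) ∂ν
      = 1 - ν.real A + ν.real A * Real.exp (-θ) := by
  have e : ∀ w, Real.exp (-(θ * A.indicator (fun _ => (1 : ℝ)) w))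
      = 1 - A.indicator (fun _ => (1 : ℝ)) w + Real.exp (-θ) * A.indicator (fun _ => (1 : ℝ)) w :=
    fun w => by by_cases h : w ∈ A <;> simp [h]
  have hi : Integrable (A.indicator (fun _ => (1 : ℝ))) ν :=
    (integrable_const (1 : ℝ)).indicator hA
  simp only [e]
  have h1 := integral_add ((integrable_const (1 : ℝ)).sub hi) (hi.const_mul (Real.exp (-θ)))
  simp only [Pi.sub_apply] at h1
  rw [h1, integral_sub (integrable_const _) hi, integral_const_mul, integral_indicator hA]
  simp [mul_comm]

/-- The number of samples in `A`. -/
noncomputable def sampleCount {Ω : Type*} {N : ℕ} (A : Set Ω) (S : Fin N → Ω) : ℝ :=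
  ∑ j, A.indicator (fun _ => (1 : ℝ)) (S j)

theorem measurable_sampleCount {Ω : Type*} [MeasurableSpace Ω] {N : ℕ} {A : Set Ω}
    (hA : MeasurableSet A) : Measurable (sampleCount (N := N) A) :=
  Finset.measurable_sum _ fun j _ =>
    (measurable_const.indicator hA).comp (measurable_pi_apply j)

theorem sampleCount_nonneg {Ω : Type*} {N : ℕ} (A : Set Ω) (S : Fin N → Ω) :
    0 ≤ sampleCount A S :=
  Finset.sum_nonneg fun _ _ => Set.indicator_nonneg (fun _ _ => zero_le_one) _

theorem sampleCount_mono {Ω : Type*} {N : ℕ} {A B : Set Ω} (h : A ⊆ B) (S : Fin N → Ω) :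
    sampleCount A S ≤ sampleCount B S :=
  Finset.sum_le_sum fun _ _ => Set.indicator_le_indicator_of_subset h (fun _ => zero_le_one) _

theorem sampleCount_eq_card {Ω : Type*} {N : ℕ} (A : Set Ω) (S : Fin N → Ω) :
    sampleCount A S = (Nat.card {j // S j ∈ A} : ℝ) := by
  classical
  rw [Nat.card_eq_fintype_card, Fintype.card_subtype, sampleCount]
  simp [Set.indicator_apply]

theorem sampleCount_add_compl {Ω : Type*} {N : ℕ} (A : Set Ω) (S : Fin N → Ω) :
    sampleCount A S + sampleCount Aᶜ S = N := by
  classical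
  rw [sampleCount, sampleCount, ← Finset.sum_add_distrib]
  have : ∀ j, A.indicator (fun _ => (1 : ℝ)) (S j) + Aᶜ.indicator (fun _ => (1 : ℝ)) (S j) = 1 :=
    fun j => by by_cases h : S j ∈ A <;> simp [h]
  simp [this]

/-- Chernoff's bound, with the deviation expressed through the variance x(1 - x) at the observed
frequency instead of p(1 - p), as the definition of the shaded CDF requires. -/
theorem measure_sampleCount_le {Ω : Type*} [MeasurableSpace Ω] (ν : Measure Ω)
    [IsProbabilityMeasure ν] {A : Set Ω} (hA : MeasurableSet A) (N : ℕ) {x Λ : ℝ} (hx0 : 0 ≤ x)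
    (hΛ : 0 < Λ) (hd : x + √(2 * x * (1 - x) * Λ) + 4 * Λ ≤ ν.real A) :
    (Measure.pi fun _ : Fin N => ν) {S | sampleCount A S ≤ N * x}
      ≤ ENNReal.ofReal (Real.exp (-(N * Λ))) := by
  set p := ν.real A with hp
  have hp0 : 0 ≤ p := measureReal_nonneg
  have hp1 : p ≤ 1 := measureReal_le_one
  set d := p - x with hddef
  have hs : 0 ≤ √(2 * x * (1 - x) * Λ) := Real.sqrt_nonneg _
  have hdl : √(2 * x * (1 - x) * Λ) + 4 * Λ ≤ d := by linarith
  have hd0 : 0 < d := by linarith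
  set v := p * (1 - p) with hv
  have hv0 : 0 ≤ v := mul_nonneg hp0 (by linarith)
  set θ := d / (v + d) with hθ
  have hvd : 0 < v + d := by linarith
  -- With s the square root, v ≤ x(1 - x) + d gives 2Λ(v + d) ≤ s² + 4Λd ≤ d(s + 4Λ) ≤ d². This is
  -- where the 4 is used.
  have hrate : Λ ≤ d ^ 2 / (2 * (v + d)) := by
    rw [le_div_iff₀ (by linarith)]
    have h1 : √(2 * x * (1 - x) * Λ) * √(2 * x * (1 - x) * Λ) = 2 * x * (1 - x) * Λ :=
      Real.mul_self_sqrt (mul_nonneg (mul_nonneg (by linarith) (by linarith)) hΛ.le)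
    have h2 : √(2 * x * (1 - x) * Λ) * √(2 * x * (1 - x) * Λ)
        ≤ d * √(2 * x * (1 - x) * Λ) := mul_le_mul_of_nonneg_right (by linarith) hs
    have h3 : d * (√(2 * x * (1 - x) * Λ) + 4 * Λ) ≤ d * d :=
      mul_le_mul_of_nonneg_left hdl hd0.le
    have h4 : v ≤ x * (1 - x) + d := by
      have : v = x * (1 - x) + d * (1 - p - x) := by rw [hv, hddef]; ring
      rw [this]
      have : d * (1 - p - x) ≤ d * 1 := mul_le_mul_of_nonneg_left (by linarith) hd0.le
      linarith
    have h5 : Λ * v ≤ Λ * (x * (1 - x) + d) := mul_le_mul_of_nonneg_left h4 hΛ.le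
    nlinarith
  have hfm : Measurable fun S : Fin N → Ω => Real.exp (-(θ * sampleCount A S)) :=
    ((measurable_sampleCount hA).const_mul θ).neg.exp
  have hint : Integrable (fun S : Fin N → Ω => Real.exp (-(θ * sampleCount A S)))
      (Measure.pi fun _ : Fin N => ν) :=
    Integrable.of_bound hfm.aestronglyMeasurable 1 (Filter.Eventually.of_forall fun S => by
      rw [Real.norm_of_nonneg (Real.exp_nonneg _), Real.exp_le_one_iff, neg_nonpos]
      exact mul_nonneg (div_nonneg hd0.le hvd.le) (sampleCount_nonneg A S))
  have hexp : ∫ S, Real.exp (-(θ * sampleCount A S)) ∂(Measure.pi fun _ : Fin N => ν)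
      = (1 - p + p * Real.exp (-θ)) ^ N := by
    have h := integral_fintype_prod_eq_pow (ι := Fin N) (μ := ν)
      (fun w => Real.exp (-(θ * A.indicator (fun _ => (1 : ℝ)) w)))
    rw [integral_exp_neg_indicator ν hA, Fintype.card_fin] at h
    rw [← h]
    congr 1
    ext S
    rw [← Real.exp_sum, sampleCount, Finset.mul_sum, Finset.sum_neg_distrib]
  have hmark := mul_meas_ge_le_integral_of_nonneg
    (Filter.Eventually.of_forall fun S : Fin N → Ω => Real.exp_nonneg (-(θ * sampleCount A S)))
    hint (Real.exp (-(θ * (N * x))))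
  have hset : {S : Fin N → Ω | Real.exp (-(θ * (N * x))) ≤ Real.exp (-(θ * sampleCount A S))}
      = {S | sampleCount A S ≤ N * x} := by
    have hθ0 : 0 < θ := div_pos hd0 hvd
    ext S
    simp only [Set.mem_ofPred_eq]
    rw [Real.exp_le_exp, neg_le_neg_iff, mul_le_mul_iff_right₀ hθ0]
  rw [hset, hexp] at hmark
  have hone : Real.exp (θ * x) * (1 - p + p * Real.exp (-θ)) ≤ Real.exp (-Λ) := by
    have h1 := bernoulli_exp_le' hp0 hp1 hd0 hv
    have h2 : p - d = x := by rw [hddef]; ring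
    rw [← hθ, h2] at h1
    exact h1.trans (Real.exp_le_exp.2 (neg_le_neg hrate))
  have hfin : (Measure.pi fun _ : Fin N => ν).real {S | sampleCount A S ≤ N * x}
      ≤ Real.exp (-(N * Λ)) := by
    have h1 : 0 < Real.exp (θ * (N * x)) := Real.exp_pos _
    have h2 := mul_le_mul_of_nonneg_left hmark h1.le
    rw [← mul_assoc, ← Real.exp_add, add_neg_cancel, Real.exp_zero, one_mul] at h2
    refine h2.trans ?_
    have h3 : Real.exp (θ * (N * x)) = Real.exp (θ * x) ^ N := by
      rw [← Real.exp_nat_mul]; ring_nf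
    have h4 : Real.exp (-(N * Λ)) = Real.exp (-Λ) ^ N := by
      rw [← Real.exp_nat_mul]; ring_nf
    rw [h3, h4, ← mul_pow]
    refine pow_le_pow_left₀ (mul_nonneg (Real.exp_nonneg _) ?_) hone N
    have := mul_nonneg hp0 (Real.exp_nonneg (-θ))
    linarith
  rw [← ENNReal.ofReal_toReal (measure_ne_top (Measure.pi fun _ : Fin N => ν) _)]
  exact ENNReal.ofReal_le_ofReal hfin

/-- Simultaneous concentration for a decreasing family of events. -/
theorem measure_exists_sampleCount_lt {Ω : Type*} [MeasurableSpace Ω] (ν : Measure Ω)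
    [IsProbabilityMeasure ν] {A : ℝ → Set Ω} (hA : ∀ v, MeasurableSet (A v)) (hanti : Antitone A)
    {N : ℕ} (hN : 0 < N) {Λ : ℝ} (hΛ : 0 < Λ) :
    (Measure.pi fun _ : Fin N => ν) {S | ∃ v,
        sampleCount (A v) S / N + √(2 * (sampleCount (A v) S / N)
          * (1 - sampleCount (A v) S / N) * Λ) + 4 * Λ < ν.real (A v)}
      ≤ N * ENNReal.ofReal (Real.exp (-(N * Λ))) := by
  set P := Measure.pi fun _ : Fin N => ν
  have hNr : (0 : ℝ) < N := by exact_mod_cast hN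
  set a : ℕ → ℝ := fun l => l / N + √(2 * (l / N : ℝ) * (1 - l / N) * Λ) + 4 * Λ with ha
  -- Sort by the observed count l. For fixed l the dangerous v form a lower set along which counts
  -- decrease, so the event is an increasing union of single-threshold events and obeys the same
  -- bound. Only the N possible counts enter the union bound, not the thresholds.
  set B : ℕ → Set (Fin N → Ω) := fun l =>
    {S | ∃ v, a l < ν.real (A v) ∧ sampleCount (A v) S ≤ N * (l / N : ℝ)} with hB
  have hsub : {S : Fin N → Ω | ∃ v, sampleCount (A v) S / N + √(2 * (sampleCount (A v) S / N)
      * (1 - sampleCount (A v) S / N) * Λ) + 4 * Λ < ν.real (A v)}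
      ⊆ ⋃ l ∈ Finset.range N, B l := by
    rintro S ⟨v, hv⟩
    rw [sampleCount_eq_card] at hv
    set l := Nat.card {j // S j ∈ A v} with hl
    -- At count N the band already reaches beyond 1, so no violation is possible.
    have hlN : l < N := by
      by_contra hc
      have h1 : (1 : ℝ) ≤ l / N := by
        rw [le_div_iff₀ hNr, one_mul]; exact_mod_cast not_lt.1 hc
      have h2 : ν.real (A v) ≤ 1 := measureReal_le_one
      have h3 := Real.sqrt_nonneg (2 * (l / N : ℝ) * (1 - l / N) * Λ)
      linarith
    simp only [Set.mem_iUnion, Finset.mem_range]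
    refine ⟨l, hlN, v, hv, ?_⟩
    rw [sampleCount_eq_card, mul_div_cancel₀ _ hNr.ne']
  have hBl : ∀ l ∈ Finset.range N, P (B l) ≤ ENNReal.ofReal (Real.exp (-(N * Λ))) := by
    intro l hl
    have hx0 : (0 : ℝ) ≤ l / N := by positivity
    have hx1 : (l / N : ℝ) ≤ 1 := by
      rw [div_le_one hNr]; exact_mod_cast (Finset.mem_range.1 hl).le
    set V : Set ℝ := {v | a l < ν.real (A v)} with hV
    have hVl : IsLowerSet V := fun x y hyx hx =>
      lt_of_lt_of_le hx (measureReal_mono (hanti hyx))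
    rcases V.eq_empty_or_nonempty with hVe | hVne
    · have : B l = ∅ := by
        ext S
        simp only [hB, Set.mem_ofPred_eq, Set.mem_empty_iff_false, iff_false]
        rintro ⟨v, hv, _⟩
        have : v ∈ V := hv
        rw [hVe] at this
        exact this
      rw [this]
      simp
    · obtain ⟨u, hu, huV, hUn⟩ := hVl.exists_seq_iUnion_Iic hVne
      have hsub2 : B l ⊆ ⋃ r, {S | sampleCount (A (u r)) S ≤ N * (l / N : ℝ)} := by
        rintro S ⟨v, hv, hc⟩
        have hvV : v ∈ V := hv
        rw [← hUn, Set.mem_iUnion] at hvV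
        obtain ⟨r, hr⟩ := hvV
        exact Set.mem_iUnion.2 ⟨r, (sampleCount_mono (hanti hr) S).trans hc⟩
      have hmono : Monotone fun r => {S : Fin N → Ω | sampleCount (A (u r)) S ≤ N * (l / N : ℝ)} :=
        fun r r' hr S (hS : _ ≤ _) => (sampleCount_mono (hanti (hu hr)) S).trans hS
      refine (measure_mono hsub2).trans ?_
      rw [hmono.measure_iUnion]
      exact iSup_le fun r => measure_sampleCount_le ν (hA _) N hx0 hΛ (le_of_lt (huV r))
  calc P _ ≤ P (⋃ l ∈ Finset.range N, B l) := measure_mono hsub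
    _ ≤ ∑ l ∈ Finset.range N, P (B l) := measure_biUnion_finset_le _ _
    _ ≤ ∑ _l ∈ Finset.range N, ENNReal.ofReal (Real.exp (-(N * Λ))) := Finset.sum_le_sum hBl
    _ = N * ENNReal.ofReal (Real.exp (-(N * Λ))) := by simp

theorem empiricalCDF_eq_sampleCount {n N : ℕ} (S : Fin N → Fin n → ℝ) (i : Fin n) (v : ℝ) :
    empiricalCDF S i v = sampleCount {w : Fin n → ℝ | w i ≤ v} S / N := by
  rw [sampleCount_eq_card]
  rfl

/-- With probability at least `1 - δ`, all samples are in the unit interval and all empirical CDFs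
are close to the true ones. -/
theorem measure_bad_samples_le {n N : ℕ} (hn : 0 < n) (hN : 0 < N) (D : Fin n → Measure ℝ)
    [∀ i, IsProbabilityMeasure (D i)] (hD : ∀ i, D i (Set.Icc 0 1) = 1) {δ : ℝ} (hδ : 0 < δ)
    (hδ1 : δ < 1) :
    (Measure.pi fun _ : Fin N => Measure.pi D) {S | ¬((∀ j i, S j i ∈ Set.Icc (0 : ℝ) 1) ∧
      ∀ i v, |(D i).real (Set.Iic v) - empiricalCDF S i v|
        ≤ √(2 * empiricalCDF S i v * (1 - empiricalCDF S i v) * (Real.log (2 * n * N / δ) / N))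
          + 4 * (Real.log (2 * n * N / δ) / N))} ≤ ENNReal.ofReal δ := by
  have hNr : (0 : ℝ) < N := by exact_mod_cast hN
  have hnr : (0 : ℝ) < n := by exact_mod_cast hn
  have hn1 : (1 : ℝ) ≤ n := by exact_mod_cast hn
  have hN1 : (1 : ℝ) ≤ N := by exact_mod_cast hN
  set Λ := Real.log (2 * n * N / δ) / N with hΛdef
  have hpos : 0 < 2 * n * N / δ := by positivity
  have hΛ : 0 < Λ := by
    refine div_pos (Real.log_pos ?_) hNr
    rw [lt_div_iff₀ hδ]
    nlinarith
  -- The union bound runs over two tails, n bidders and N counts, hence the 2nN inside the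
  -- logarithm.
  have hexp : Real.exp (-(N * Λ)) = δ / (2 * n * N) := by
    rw [hΛdef, mul_div_cancel₀ _ hNr.ne', Real.exp_neg, Real.exp_log hpos, inv_div]
  set P := Measure.pi fun _ : Fin N => Measure.pi D with hP
  set B0 : Set (Fin N → Fin n → ℝ) := {S | ¬ ∀ j i, S j i ∈ Set.Icc (0 : ℝ) 1} with hB0
  set U1 : Fin n → Set (Fin N → Fin n → ℝ) := fun i => {S | ∃ v,
      sampleCount {w : Fin n → ℝ | v < w i} S / N
        + √(2 * (sampleCount {w : Fin n → ℝ | v < w i} S / N)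
          * (1 - sampleCount {w : Fin n → ℝ | v < w i} S / N) * Λ) + 4 * Λ
        < (Measure.pi D).real {w : Fin n → ℝ | v < w i}} with hU1
  -- The threshold is negated so that the lower rays form a decreasing family too.
  set U2 : Fin n → Set (Fin N → Fin n → ℝ) := fun i => {S | ∃ v,
      sampleCount {w : Fin n → ℝ | w i ≤ -v} S / N
        + √(2 * (sampleCount {w : Fin n → ℝ | w i ≤ -v} S / N)
          * (1 - sampleCount {w : Fin n → ℝ | w i ≤ -v} S / N) * Λ) + 4 * Λ
        < (Measure.pi D).real {w : Fin n → ℝ | w i ≤ -v}} with hU2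
  have m1 : ∀ i, P (U1 i) ≤ N * ENNReal.ofReal (Real.exp (-(N * Λ))) := fun i =>
    measure_exists_sampleCount_lt (Measure.pi D) (A := fun v => {w : Fin n → ℝ | v < w i})
      (fun v => measurableSet_lt measurable_const (measurable_pi_apply i))
      (fun a b hab w (hw : b < w i) => lt_of_le_of_lt hab hw) hN hΛ
  have m2 : ∀ i, P (U2 i) ≤ N * ENNReal.ofReal (Real.exp (-(N * Λ))) := fun i =>
    measure_exists_sampleCount_lt (Measure.pi D) (A := fun v => {w : Fin n → ℝ | w i ≤ -v})
      (fun v => measurableSet_le (measurable_pi_apply i) measurable_const)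
      (fun a b hab w (hw : w i ≤ -b) => hw.trans (neg_le_neg hab)) hN hΛ
  have m0 : P B0 = 0 := by
    have hae : ∀ j i, ∀ᵐ S ∂P, S j i ∈ Set.Icc (0 : ℝ) 1 := fun j i => by
      have h1 := ae_mem_Icc_of_measure_eq_one (hD i)
      have h2 := (measurePreserving_eval D i).quasiMeasurePreserving.ae h1
      exact (measurePreserving_eval (fun _ : Fin N => Measure.pi D) j).quasiMeasurePreserving.ae h2
    have := ae_all_iff.2 fun j => ae_all_iff.2 (hae j)
    exact ae_iff.1 this
  have hp : ∀ i (A : Set ℝ), MeasurableSet A → (Measure.pi D).real {w | w i ∈ A} = (D i).real A :=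
    fun i A hA => (measurePreserving_eval D i).measureReal_preimage hA.nullMeasurableSet
  have hsub : {S : Fin N → Fin n → ℝ | ¬((∀ j i, S j i ∈ Set.Icc (0 : ℝ) 1) ∧
      ∀ i v, |(D i).real (Set.Iic v) - empiricalCDF S i v|
        ≤ √(2 * empiricalCDF S i v * (1 - empiricalCDF S i v) * Λ) + 4 * Λ)}
      ⊆ B0 ∪ ⋃ i ∈ Finset.univ, (U1 i ∪ U2 i) := by
    intro S hS
    by_contra hc
    simp only [Set.mem_union, Set.mem_iUnion, not_or, not_exists, Finset.mem_univ,
      forall_true_left] at hc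
    obtain ⟨hc0, hc1⟩ := hc
    refine hS ⟨not_not.1 hc0, fun i v => ?_⟩
    have h1 : ¬ S ∈ U1 i := (hc1 i).1
    have h2 : ¬ S ∈ U2 i := (hc1 i).2
    simp only [hU1, hU2, Set.mem_ofPred_eq, not_exists, not_lt] at h1 h2
    have h1 := h1 v
    have h2 := h2 (-v)
    rw [neg_neg] at h2
    have e1 : sampleCount {w : Fin n → ℝ | v < w i} S / N = 1 - empiricalCDF S i v := by
      have := sampleCount_add_compl {w : Fin n → ℝ | w i ≤ v} S
      have hcompl : {w : Fin n → ℝ | w i ≤ v}ᶜ = {w | v < w i} := by ext w; simp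
      rw [hcompl] at this
      rw [empiricalCDF_eq_sampleCount, eq_sub_iff_add_eq, ← add_div, add_comm, this,
        div_self hNr.ne']
    have e2 : (Measure.pi D).real {w : Fin n → ℝ | v < w i} = 1 - (D i).real (Set.Iic v) := by
      rw [← probReal_compl_eq_one_sub measurableSet_Iic, Set.compl_Iic]
      exact hp i (Set.Ioi v) measurableSet_Ioi
    have e3 : (Measure.pi D).real {w : Fin n → ℝ | w i ≤ v} = (D i).real (Set.Iic v) :=
      hp i (Set.Iic v) measurableSet_Iic
    rw [e1, e2] at h1
    rw [← empiricalCDF_eq_sampleCount, e3] at h2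
    have e4 : 2 * (1 - empiricalCDF S i v) * (1 - (1 - empiricalCDF S i v)) * Λ
        = 2 * empiricalCDF S i v * (1 - empiricalCDF S i v) * Λ := by ring
    rw [e4] at h1
    rw [abs_le]
    constructor <;> linarith
  calc P _ ≤ P (B0 ∪ ⋃ i ∈ Finset.univ, (U1 i ∪ U2 i)) := measure_mono hsub
    _ ≤ P B0 + P (⋃ i ∈ Finset.univ, (U1 i ∪ U2 i)) := measure_union_le _ _
    _ ≤ 0 + ∑ i : Fin n, (P (U1 i) + P (U2 i)) := by
      rw [m0]
      exact add_le_add le_rfl ((measure_biUnion_finset_le _ _).trans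
        (Finset.sum_le_sum fun i _ => measure_union_le _ _))
    _ ≤ 0 + ∑ i : Fin n, (N * ENNReal.ofReal (Real.exp (-(N * Λ)))
          + N * ENNReal.ofReal (Real.exp (-(N * Λ)))) :=
      add_le_add le_rfl (Finset.sum_le_sum fun i _ => add_le_add (m1 i) (m2 i))
    _ = ENNReal.ofReal δ := by
      rw [hexp, zero_add, Finset.sum_const, Finset.card_univ, Fintype.card_fin, ← two_mul,
        nsmul_eq_mul, ← ENNReal.ofReal_natCast n, ← ENNReal.ofReal_natCast N,
        ← ENNReal.ofReal_ofNat 2, ← ENNReal.ofReal_mul hNr.le, ← ENNReal.ofReal_mul (by norm_num),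
        ← ENNReal.ofReal_mul hnr.le]
      congr 1
      field_simp


/-! ### The dominated empirical distribution -/

/-- The upper end of the confidence interval around an empirical frequency `e`. -/
noncomputable def upperBand (Λ e : ℝ) : ℝ := min 1 (e + √(2 * e * (1 - e) * Λ) + 4 * Λ)

/-- Write e' as the convex combination r e + (1 - r)·1. The square root at e' is at least r times
that at e, so the band at e' is at least r A + (1 - r)·1 ≥ A for A the band at e, capped at 1. -/
theorem upperBand_mono {Λ e e' : ℝ} (hΛ : 0 ≤ Λ) (h0 : 0 ≤ e) (hee : e ≤ e') (h1 : e' ≤ 1) :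
    upperBand Λ e ≤ upperBand Λ e' := by
  rcases hee.eq_or_lt with h | h
  · rw [h]
  have hpos : 0 < 1 - e := by linarith
  set r := (1 - e') / (1 - e) with hr
  have hr0 : 0 ≤ r := div_nonneg (by linarith) hpos.le
  have hr1 : r ≤ 1 := (div_le_one hpos).2 (by linarith)
  have hre : r * (1 - e) = 1 - e' := div_mul_cancel₀ _ hpos.ne'
  set s := √(2 * e * (1 - e) * Λ) with hs
  have hs2 : s * s = 2 * e * (1 - e) * Λ :=
    Real.mul_self_sqrt (mul_nonneg (mul_nonneg (by linarith) hpos.le) hΛ)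
  have hs' : r * s ≤ √(2 * e' * (1 - e') * Λ) := by
    refine Real.le_sqrt_of_sq_le ?_
    have e1 : (r * s) ^ 2 = 2 * (r * e) * (1 - e') * Λ := by
      rw [← hre]
      linear_combination r ^ 2 * hs2
    rw [e1]
    have : r * e ≤ e' := (mul_le_of_le_one_left h0 hr1).trans hee
    refine mul_le_mul_of_nonneg_right (mul_le_mul_of_nonneg_right ?_ (by linarith)) hΛ
    linarith
  refine le_min (min_le_left _ _) ?_
  set A := upperBand Λ e with hA
  have hA1 : A ≤ 1 := min_le_left _ _
  have hA2 : A ≤ e + s + 4 * Λ := min_le_right _ _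
  have k1 : r * A ≤ r * (e + s + 4 * Λ) := mul_le_mul_of_nonneg_left hA2 hr0
  have k2 : (1 - r) * A ≤ (1 - r) * 1 := mul_le_mul_of_nonneg_left hA1 (by linarith)
  have k3 : 0 ≤ (1 - r) * (4 * Λ) := mul_nonneg (by linarith) (by linarith)
  linarith

theorem upperBand_sub_le {Λ e b : ℝ}
    (h : |b - e| ≤ √(2 * e * (1 - e) * Λ) + 4 * Λ) :
    upperBand Λ e - b ≤ 2 * √(2 * e * (1 - e) * Λ) + 8 * Λ := by
  have h1 : upperBand Λ e ≤ e + √(2 * e * (1 - e) * Λ) + 4 * Λ := min_le_right _ _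
  have h2 := (abs_le.1 h).1
  linarith

/-- Both e and 4Λ are at most the upper band A, so each error term is a multiple of √(ΛA). The
constant is 7 = 2·(3/2) + 4, whence the 49 = 7² below. -/
theorem upperBand_sub_le_sqrt {Λ e b : ℝ} (hΛ : 0 ≤ Λ) (hΛ1 : Λ ≤ 1 / 4) (he0 : 0 ≤ e)
    (he1 : e ≤ 1) (h : |b - e| ≤ √(2 * e * (1 - e) * Λ) + 4 * Λ) :
    upperBand Λ e - b ≤ 7 * (√Λ * √(upperBand Λ e)) := by
  refine (upperBand_sub_le h).trans ?_
  set A := upperBand Λ e with hA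
  have hs := Real.sqrt_nonneg (2 * e * (1 - e) * Λ)
  have hA1 : e ≤ A := le_min he1 (by linarith)
  have hA2 : 4 * Λ ≤ A := le_min (by linarith) (by linarith)
  have k1 : √(2 * e * (1 - e) * Λ) ≤ 3 / 2 * (√Λ * √A) := by
    rw [Real.sqrt_le_left (by positivity), mul_pow, mul_pow, Real.sq_sqrt hΛ,
      Real.sq_sqrt (he0.trans hA1)]
    have : 2 * e * (1 - e) ≤ 2 * A := by nlinarith
    nlinarith [mul_le_mul_of_nonneg_right this hΛ, mul_nonneg hΛ (he0.trans hA1)]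
  have k2 : 2 * Λ ≤ √Λ * √A := by
    rw [← Real.sqrt_mul hΛ]
    refine Real.le_sqrt_of_sq_le ?_
    nlinarith
  linarith

/-- By AM-GM, 2s ≤ t(1 - e) + 2Λ/t. Taking t = 1 replaces 1 - e by a multiple of 1 - b up to O(Λ);
taking t = η/2 produces the factor η, and the rest is at most η/n because 49nΛ ≤ η². -/
theorem upperBand_sub_le_linear {Λ e b η n : ℝ} (hn : 1 ≤ n) (hη0 : 0 < η) (hη1 : η ≤ 1)
    (hηΛ : 49 * n * Λ ≤ η ^ 2) (hΛ : 0 ≤ Λ) (he0 : 0 ≤ e) (he1 : e ≤ 1)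
    (h : |b - e| ≤ √(2 * e * (1 - e) * Λ) + 4 * Λ) :
    upperBand Λ e - b ≤ η * (1 - b) + η / n := by
  refine (upperBand_sub_le h).trans ?_
  set s := √(2 * e * (1 - e) * Λ) with hs
  have hs0 : 0 ≤ s := Real.sqrt_nonneg _
  have hs2 : s ^ 2 ≤ 2 * (1 - e) * Λ := by
    rw [hs, Real.sq_sqrt (mul_nonneg (mul_nonneg (by linarith) (by linarith)) hΛ)]
    refine mul_le_mul_of_nonneg_right ?_ hΛ
    nlinarith
  have hamgm : ∀ t, 0 < t → 2 * s ≤ t * (1 - e) + 2 * Λ / t := fun t ht => by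
    have h1 : 0 ≤ t * (1 - e) + 2 * Λ / t :=
      add_nonneg (mul_nonneg ht.le (by linarith)) (div_nonneg (by linarith) ht.le)
    refine abs_le_of_sq_le_sq' ?_ h1 |>.2
    have h2 : (t * (1 - e) + 2 * Λ / t) ^ 2
        = (t * (1 - e) - 2 * Λ / t) ^ 2 + 4 * (2 * (1 - e) * Λ) := by
      field_simp; ring
    rw [h2]
    nlinarith [sq_nonneg (t * (1 - e) - 2 * Λ / t)]
  have h1e : 1 - e ≤ 2 * (1 - b) + 10 * Λ := by
    have a1 := hamgm 1 one_pos
    have a2 := (abs_le.1 h).2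
    linarith
  have a3 := hamgm (η / 2) (by linarith)
  have a4 : η / 2 * (1 - e) ≤ η / 2 * (2 * (1 - b) + 10 * Λ) :=
    mul_le_mul_of_nonneg_left h1e (by linarith)
  have a5 : 2 * Λ / (η / 2) = 4 * Λ / η := by field_simp; ring
  rw [a5] at a3
  have hn0 : 0 < n := by linarith
  have hΛn : Λ ≤ η ^ 2 / (49 * n) := by
    rw [le_div_iff₀ (by linarith)]; linarith
  have a6 : 4 * Λ / η ≤ 4 / 49 * (η / n) := by
    rw [div_le_iff₀ hη0]
    calc 4 * Λ ≤ 4 * (η ^ 2 / (49 * n)) := by linarith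
      _ = 4 / 49 * (η / n) * η := by field_simp
  have a7 : Λ ≤ 1 / 49 * (η / n) := by
    calc Λ ≤ η * (1 / 49 * (η / n)) := hΛn.trans (le_of_eq (by field_simp))
      _ ≤ 1 * (1 / 49 * (η / n)) := mul_le_mul_of_nonneg_right hη1 (by positivity)
      _ = _ := one_mul _
  have a8 : η * Λ ≤ Λ := mul_le_of_le_one_left hΛ hη1
  have a9 : 0 ≤ η / n := by positivity
  linarith

theorem le_upperBand {Λ e b : ℝ} (hb1 : b ≤ 1)
    (h : |b - e| ≤ √(2 * e * (1 - e) * Λ) + 4 * Λ) : b ≤ upperBand Λ e :=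
  le_min hb1 (by linarith [(abs_le.1 h).2])

section Empirical

variable {n N : ℕ}

theorem empiricalCDF_eq_card (S : Fin N → Fin n → ℝ) (i : Fin n) (v : ℝ) :
    empiricalCDF S i v = ((Finset.univ.filter fun j => S j i ≤ v).card : ℝ) / N := by
  classical
  rw [empiricalCDF, Nat.card_eq_fintype_card, Fintype.card_subtype]

theorem empiricalCDF_nonneg (S : Fin N → Fin n → ℝ) (i : Fin n) (v : ℝ) :
    0 ≤ empiricalCDF S i v := by
  rw [empiricalCDF]; positivity

theorem empiricalCDF_mono (S : Fin N → Fin n → ℝ) (i : Fin n) : Monotone (empiricalCDF S i) :=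
  fun a b hab => by
    rw [empiricalCDF_eq_card, empiricalCDF_eq_card]
    gcongr

theorem empiricalCDF_le_one (S : Fin N → Fin n → ℝ) (i : Fin n) (v : ℝ) :
    empiricalCDF S i v ≤ 1 := by
  rw [empiricalCDF_eq_card]
  refine div_le_one_of_le₀ ?_ (Nat.cast_nonneg N)
  have := Finset.card_filter_le (Finset.univ : Finset (Fin N)) fun j => S j i ≤ v
  rw [Finset.card_univ, Fintype.card_fin] at this
  exact_mod_cast this

theorem empiricalCDF_eq_one (hN : 0 < N) {S : Fin N → Fin n → ℝ} {i : Fin n} {v : ℝ}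
    (h : ∀ j, S j i ≤ v) : empiricalCDF S i v = 1 := by
  rw [empiricalCDF_eq_card, Finset.filter_true_of_mem fun j _ => h j, Finset.card_univ,
    Fintype.card_fin, div_self]
  exact_mod_cast hN.ne'

theorem dominatedEmpiricalCDF_of_neg (δ : ℝ) (S : Fin N → Fin n → ℝ) (i : Fin n) {v : ℝ}
    (hv : v < 0) : dominatedEmpiricalCDF δ S i v = 0 := if_pos hv

theorem dominatedEmpiricalCDF_of_nonneg (δ : ℝ) (S : Fin N → Fin n → ℝ) (i : Fin n) {v : ℝ}
    (hv : 0 ≤ v) : dominatedEmpiricalCDF δ S i v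
      = upperBand (Real.log (2 * n * N / δ) / N) (empiricalCDF S i v) := by
  rw [dominatedEmpiricalCDF, if_neg (not_lt.2 hv), upperBand,
    mul_div_assoc (2 * empiricalCDF S i v * (1 - empiricalCDF S i v)),
    mul_div_assoc 4 (Real.log (2 * n * N / δ))]

theorem upperBand_nonneg {Λ e : ℝ} (hΛ : 0 ≤ Λ) (he : 0 ≤ e) : 0 ≤ upperBand Λ e :=
  le_min zero_le_one (by positivity)

/-- The dominated empirical distribution of a bidder, if the sample is good. -/
theorem exists_isAtomicMass_dominatedEmpiricalCDF (hN : 0 < N) {δ : ℝ} {S : Fin N → Fin n → ℝ}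
    {i : Fin n} (hS : ∀ j, S j i ∈ Set.Icc (0 : ℝ) 1) (hΛ : 0 < Real.log (2 * n * N / δ) / N) :
    ∃ (T : Finset ℝ) (m : ℝ → ℝ), IsAtomicMass T m ∧
      atomicCDF T m = dominatedEmpiricalCDF δ S i := by
  classical
  set f := dominatedEmpiricalCDF δ S i with hf
  set Λ := Real.log (2 * n * N / δ) / N with hΛdef
  -- Jumps occur at the samples and at 0: the shading always puts positive mass at 0, sampled or
  -- not, and the ironed curve vanishes at 1 because of it.
  set T : Finset ℝ := insert 0 (Finset.univ.image fun j => S j i) with hT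
  have hf0 : ∀ v, 0 ≤ f v := fun v => by
    rcases lt_or_ge v 0 with h | h
    · rw [hf, dominatedEmpiricalCDF_of_neg δ S i h]
    · rw [hf, dominatedEmpiricalCDF_of_nonneg δ S i h]
      exact upperBand_nonneg hΛ.le (empiricalCDF_nonneg S i v)
  have hfm : Monotone f := fun v w hvw => by
    rcases lt_or_ge v 0 with h | h
    · rw [hf, dominatedEmpiricalCDF_of_neg δ S i h]; exact hf0 w
    · rw [hf, dominatedEmpiricalCDF_of_nonneg δ S i h,
        dominatedEmpiricalCDF_of_nonneg δ S i (h.trans hvw)]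
      exact upperBand_mono hΛ.le (empiricalCDF_nonneg S i v) (empiricalCDF_mono S i hvw)
        (empiricalCDF_le_one S i w)
  have h0T : (0 : ℝ) ∈ T := Finset.mem_insert_self _ _
  have hTI : ∀ s ∈ T, s ∈ Set.Icc (0 : ℝ) 1 := fun s hs => by
    rcases Finset.mem_insert.1 hs with h | h
    · rw [h]; simp
    · obtain ⟨j, _, rfl⟩ := Finset.mem_image.1 h
      exact hS j
  have hstep : ∀ v w, v ≤ w → (∀ s ∈ T, s ≤ w → s ≤ v) → f v = f w := fun v w hvw h => by
    rcases lt_or_ge w 0 with hw | hw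
    · rw [hf, dominatedEmpiricalCDF_of_neg δ S i hw,
        dominatedEmpiricalCDF_of_neg δ S i (hvw.trans_lt hw)]
    · have hv : 0 ≤ v := h 0 h0T hw
      rw [hf, dominatedEmpiricalCDF_of_nonneg δ S i hw, dominatedEmpiricalCDF_of_nonneg δ S i hv,
        empiricalCDF_eq_card, empiricalCDF_eq_card]
      congr 4
      ext j
      simp only [Finset.mem_filter, Finset.mem_univ, true_and]
      exact ⟨fun hj => hj.trans hvw, h _ (Finset.mem_insert_of_mem
        (Finset.mem_image_of_mem _ (Finset.mem_univ j)))⟩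
  obtain ⟨m, hm0, hm⟩ := T.exists_masses hfm hf0
  have hcdf : ∀ v, 0 ≤ v → atomicCDF T m v = f v := fun v hv =>
    atomicCDF_eq_of_step hm hstep ⟨0, h0T, hv⟩
  refine ⟨T, m, ⟨h0T, hTI, hm0, ?_, ?_⟩, ?_⟩
  · have h1 := hcdf 1 zero_le_one
    rw [atomicCDF, Finset.filter_true_of_mem fun s hs => (hTI s hs).2, hf,
      dominatedEmpiricalCDF_of_nonneg δ S i zero_le_one, empiricalCDF_eq_one hN fun j => (hS j).2]
      at h1
    rw [h1, upperBand, ← hΛdef]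
    have : 0 ≤ √(2 * 1 * (1 - 1) * Λ) := Real.sqrt_nonneg _
    exact min_eq_left (by linarith)
  · have h1 := hm 0 h0T
    have h2 : T.filter (· ≤ 0) = {0} := by
      ext s
      simp only [Finset.mem_filter, Finset.mem_singleton]
      exact ⟨fun hs => le_antisymm hs.2 (hTI s hs.1).1, fun hs => ⟨hs ▸ h0T, hs.le⟩⟩
    rw [h2, Finset.sum_singleton] at h1
    rw [h1, hf, dominatedEmpiricalCDF_of_nonneg δ S i le_rfl]
    refine lt_min one_pos ?_
    have h3 := empiricalCDF_nonneg S i 0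
    have h4 := Real.sqrt_nonneg (2 * empiricalCDF S i 0 * (1 - empiricalCDF S i 0) * Λ)
    linarith
  · ext v
    rcases lt_or_ge v 0 with hv | hv
    · rw [hf, dominatedEmpiricalCDF_of_neg δ S i hv, atomicCDF, Finset.filter_false_of_mem,
        Finset.sum_empty]
      exact fun s hs => not_le.2 (hv.trans_le (hTI s hs).1)
    · exact hcdf v hv

/-- Finiteness gives measurability of the auction even though the tie-breaking rule is an arbitrary
function. -/
theorem IsAtomicMass.finite_range_virtualValue {T : Finset ℝ} {m : ℝ → ℝ} (h : IsAtomicMass T m) :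
    (Set.range fun v => ironedVirtualValue (atomicCDF T m) (clampUnit v)).Finite := by
  refine (T.finite_toSet.image (ironedVirtualValue (atomicCDF T m))).subset ?_
  rintro _ ⟨v, rfl⟩
  have hc := clampUnit_mem v
  set c := clampUnit v
  have hne : (T.filter (· ≤ c)).Nonempty := ⟨0, Finset.mem_filter.2 ⟨h.zero_mem, hc.1⟩⟩
  have ht := Finset.mem_filter.1 ((T.filter (· ≤ c)).max'_mem hne)
  exact ⟨_, ht.1, h.virtualValue_congr ht.2 fun s hs hsc =>
    Finset.le_max' _ _ (Finset.mem_filter.2 ⟨hs, hsc⟩)⟩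

theorem IsLowerSet.le_of_forall_Iic {D E : Measure ℝ} [IsFiniteMeasure D] [IsFiniteMeasure E]
    {f : ℝ × ℝ → ℝ} (hf : Continuous f) (h0 : 0 ≤ f (0, 0))
    (h : ∀ v, 0 ≤ f (D.real (Set.Iic v), E.real (Set.Iic v))) {L : Set ℝ} (hL : IsLowerSet L) :
    0 ≤ f (D.real L, E.real L) := by
  rcases L.eq_empty_or_nonempty with rfl | hne
  · simpa using h0
  · obtain ⟨u, _, hu⟩ := hL.exists_seq_tendsto_measure hne
    refine ge_of_tendsto' (x := Filter.atTop)
      ((hf.tendsto _).comp ((hu D inferInstance).prodMk_nhds (hu E inferInstance))) fun r => h (u r)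

theorem exists_shadedPair (hN : 0 < N) {δ : ℝ} {S : Fin N → Fin n → ℝ}
    {i : Fin n} (hS : ∀ j, S j i ∈ Set.Icc (0 : ℝ) 1) (hΛ : 0 < Real.log (2 * n * N / δ) / N)
    {D : Measure ℝ} [IsProbabilityMeasure D] (hD : D (Set.Icc 0 1) = 1)
    (hgood : ∀ v, |D.real (Set.Iic v) - empiricalCDF S i v|
      ≤ √(2 * empiricalCDF S i v * (1 - empiricalCDF S i v) * (Real.log (2 * n * N / δ) / N))
        + 4 * (Real.log (2 * n * N / δ) / N))
    {η : ℝ} (hη0 : 0 < η) (hη1 : η ≤ 1) (hn : (1 : ℝ) ≤ n)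
    (hηΛ : 49 * n * (Real.log (2 * n * N / δ) / N) ≤ η ^ 2) :
    (Set.range fun v => ironedVirtualValue (dominatedEmpiricalCDF δ S i) (clampUnit v)).Finite ∧
    ∃ E, ShadedPair n η (η / √n) D E
      fun v => ironedVirtualValue (dominatedEmpiricalCDF δ S i) (clampUnit v) := by
  obtain ⟨T, m, hT, hcdf⟩ := exists_isAtomicMass_dominatedEmpiricalCDF hN hS hΛ
  have := hT.isProbabilityMeasure
  set Λ := Real.log (2 * n * N / δ) / N with hΛdef
  have hE : ∀ v, (atomicMeasure T m).real (Set.Iic v) = dominatedEmpiricalCDF δ S i v := fun v => by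
    rw [hT.real_Iic, hcdf]
  have hDneg : ∀ v, v < 0 → D.real (Set.Iic v) = 0 := fun v hv => by
    rw [measureReal_eq_zero_iff]
    refine measure_mono_null (fun w hw => ?_) ((prob_compl_eq_zero_iff measurableSet_Icc).2 hD)
    exact fun hc => absurd (hc.1.trans hw) (not_le.2 hv)
  have hn0 : (0 : ℝ) < n := by linarith
  have hsn : 0 < √(n : ℝ) := Real.sqrt_pos.2 hn0
  have hΛn : Λ ≤ η ^ 2 / (49 * n) := by
    rw [le_div_iff₀ (by linarith)]; linarith
  have hΛ1 : Λ ≤ 1 / 4 := by nlinarith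
  -- The square-root error constant 7√Λ is at most σ = η/√n: this is 49nΛ ≤ η² after taking roots.
  have hσ : 7 * √Λ ≤ η / √n := by
    rw [le_div_iff₀ hsn, mul_assoc, ← Real.sqrt_mul hΛ.le]
    have : √(Λ * n) ≤ η / 7 := by
      rw [Real.sqrt_le_left (by linarith)]
      linarith
    linarith
  have he0 := empiricalCDF_nonneg S i
  have he1 := empiricalCDF_le_one S i
  rw [← hcdf]
  refine ⟨hT.finite_range_virtualValue, atomicMeasure T m, ‹_›, ‹_›, hD, hT.monotone_virtualValue,
    hT.virtualValue_le_one, hT.virtualValue_zero_le, hn, hη0.le, by positivity,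
    (div_mul_cancel₀ _ hsn.ne').le, ?_, ?_, ?_, fun U hU => hT.postedPrice_mul_le hU,
    fun U hU hsat => hT.le_postedPrice_mul hU hsat⟩
  · intro L hL
    have := hL.le_of_forall_Iic (D := D) (E := atomicMeasure T m) (f := fun p => p.2 - p.1)
      (by fun_prop) (by simp) fun v => ?_
    · exact sub_nonneg.1 this
    · rw [hE]
      rcases lt_or_ge v 0 with hv | hv
      · rw [hDneg v hv, dominatedEmpiricalCDF_of_neg δ S i hv]; simp
      · rw [dominatedEmpiricalCDF_of_nonneg δ S i hv]
        exact sub_nonneg.2 (le_upperBand measureReal_le_one (hgood v))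
  · intro L hL
    have := hL.le_of_forall_Iic (D := D) (E := atomicMeasure T m)
      (f := fun p => p.1 + η / √n * √p.2 - p.2) (by fun_prop) (by simp) fun v => ?_
    · simp only at this; linarith
    · rw [hE]
      rcases lt_or_ge v 0 with hv | hv
      · rw [hDneg v hv, dominatedEmpiricalCDF_of_neg δ S i hv]; simp
      · rw [dominatedEmpiricalCDF_of_nonneg δ S i hv]
        have h1 := upperBand_sub_le_sqrt hΛ.le hΛ1 (he0 v) (he1 v) (hgood v)
        have h2 := mul_le_mul_of_nonneg_right hσ (Real.sqrt_nonneg (upperBand Λ (empiricalCDF S i v)))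
        simp only
        linarith
  · intro L hL
    have hc := probReal_compl_eq_one_sub (μ := D) hL.measurableSet_real
    rw [hc]
    have := hL.le_of_forall_Iic (D := D) (E := atomicMeasure T m)
      (f := fun p => p.1 + η * (1 - p.1) + η / n - p.2) (by fun_prop)
      (by simp only [zero_add, sub_zero, mul_one]; positivity) fun v => ?_
    · simp only at this; linarith
    · rw [hE]
      rcases lt_or_ge v 0 with hv | hv
      · rw [hDneg v hv, dominatedEmpiricalCDF_of_neg δ S i hv]
        simp only [zero_add, sub_zero, mul_one]
        positivity
      · rw [dominatedEmpiricalCDF_of_nonneg δ S i hv]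
        have h1 := upperBand_sub_le_linear hn hη0 hη1 hηΛ hΛ.le (he0 v) (he1 v) (hgood v)
        simp only
        linarith

end Empirical


/-! ### Resampling one coordinate -/

section Resample

variable {n : ℕ} (D : Fin n → Measure ℝ) [∀ i, IsProbabilityMeasure (D i)]

theorem measurable_update_prod (i : Fin n) :
    Measurable fun p : (Fin n → ℝ) × ℝ => Function.update p.1 i p.2 := by
  refine measurable_pi_lambda _ fun j => ?_
  by_cases h : j = i
  · subst h
    simpa using measurable_snd
  · simp only [Function.update_of_ne h]
    exact (measurable_pi_apply j).comp measurable_fst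

theorem measurable_update_const (i : Fin n) (t : ℝ) :
    Measurable fun v : Fin n → ℝ => Function.update v i t :=
  (measurable_update_prod i).comp (measurable_id.prodMk measurable_const)

theorem measurePreserving_update (i : Fin n) :
    MeasurePreserving (fun p : (Fin n → ℝ) × ℝ => Function.update p.1 i p.2)
      ((Measure.pi D).prod (D i)) (Measure.pi D) := by
  refine ⟨measurable_update_prod i, (Measure.pi_eq fun s hs => ?_).symm⟩
  rw [Measure.map_apply (measurable_update_prod i) (MeasurableSet.univ_pi hs)]
  have h : (fun p : (Fin n → ℝ) × ℝ => Function.update p.1 i p.2) ⁻¹' Set.univ.pi s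
      = (Set.univ.pi (Function.update s i Set.univ)) ×ˢ s i := by
    ext p
    simp only [Set.mem_preimage, Set.mem_pi, Set.mem_univ, forall_true_left, Set.mem_prod]
    constructor
    · intro hp
      refine ⟨fun j => ?_, by simpa using hp i⟩
      by_cases hj : j = i
      · subst hj; simp
      · simpa [Function.update_of_ne hj] using hp j
    · rintro ⟨h1, h2⟩ j
      by_cases hj : j = i
      · subst hj; simpa using h2
      · simpa [Function.update_of_ne hj] using h1 j
  rw [h, Measure.prod_prod, Measure.pi_pi]
  rw [← Finset.mul_prod_erase _ _ (Finset.mem_univ i),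
    ← Finset.mul_prod_erase _ (fun j => D j (s j)) (Finset.mem_univ i)]
  simp only [Function.update_self, measure_univ, one_mul]
  rw [mul_comm]
  congr 1
  refine Finset.prod_congr rfl fun j hj => ?_
  rw [Function.update_of_ne (Finset.ne_of_mem_erase hj)]

theorem integrable_pi_of_bound {f : (Fin n → ℝ) → ℝ} (hf : Measurable f) {B : ℝ}
    (hB : ∀ v, |f v| ≤ B) : Integrable f (Measure.pi D) :=
  Integrable.of_bound hf.aestronglyMeasurable B (Filter.Eventually.of_forall hB)

theorem integral_pi_eq_update (i : Fin n) {f : (Fin n → ℝ) → ℝ} (hf : Measurable f) {B : ℝ}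
    (hB : ∀ v, |f v| ≤ B) :
    ∫ v, f v ∂(Measure.pi D) = ∫ v, (∫ t, f (Function.update v i t) ∂(D i)) ∂(Measure.pi D) := by
  have hm := measurePreserving_update D i
  have hi : Integrable (fun p : (Fin n → ℝ) × ℝ => f (Function.update p.1 i p.2))
      ((Measure.pi D).prod (D i)) :=
    Integrable.of_bound (hf.comp (measurable_update_prod i)).aestronglyMeasurable B
      (Filter.Eventually.of_forall fun p => hB _)
  rw [← integral_prod _ hi]
  conv_lhs => rw [← hm.map_eq]
  exact integral_map hm.measurable.aemeasurable hf.aestronglyMeasurable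

theorem integral_pi_eq_update' (i : Fin n) {f : (Fin n → ℝ) → ℝ} (hf : Measurable f) {B : ℝ}
    (hB : ∀ v, |f v| ≤ B) :
    ∫ v, f v ∂(Measure.pi D) = ∫ t, (∫ v, f (Function.update v i t) ∂(Measure.pi D)) ∂(D i) := by
  rw [integral_pi_eq_update D i hf hB]
  refine integral_integral_swap ?_
  exact Integrable.of_bound (hf.comp (measurable_update_prod i)).aestronglyMeasurable B
      (Filter.Eventually.of_forall fun p => hB _)

theorem ae_mem_valueProfiles (hD : ∀ i, D i (Set.Icc 0 1) = 1) :
    ∀ᵐ v ∂(Measure.pi D), v ∈ valueProfiles n :=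
  ae_all_iff.2 fun i => (measurePreserving_eval D i).quasiMeasurePreserving.ae
    (ae_mem_Icc_of_measure_eq_one (hD i))

end Resample

/-! ### Interim allocations -/

/-- A bounded allocation rule which is monotone in the bidder's own value. -/
structure MonotoneAlloc {n : ℕ} (k : ℝ) (z : (Fin n → ℝ) → Fin n → ℝ) : Prop where
  meas : ∀ i, Measurable fun v => z v i
  nonneg : ∀ v i, 0 ≤ z v i
  sum_le : ∀ v, ∑ i, z v i ≤ k
  mono : ∀ v i, Monotone fun t => z (Function.update v i t) i
  -- For negative t this does not follow from monotonicity; it holds for rules that clamp the values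
  -- to [0, 1].
  zero_le : ∀ v i t, z (Function.update v i 0) i ≤ z (Function.update v i t) i

/-- The product of the weights of all bidders but `i`. -/
noncomputable def otherWeight {n : ℕ} (ω : Fin n → ℝ → ℝ) (i : Fin n) (v : Fin n → ℝ) : ℝ :=
  ∏ j ∈ Finset.univ.erase i, ω j (v j)

/-- The interim allocation of bidder `i`, where the values of the others are weighted by `ω`. -/
noncomputable def interim {n : ℕ} (D : Fin n → Measure ℝ) (ω : Fin n → ℝ → ℝ)
    (z : (Fin n → ℝ) → Fin n → ℝ) (i : Fin n) (t : ℝ) : ℝ :=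
  ∫ v, otherWeight ω i v * z (Function.update v i t) i ∂(Measure.pi D)

/-- The payment that Myerson's formula assigns to the allocation rule `z`. -/
noncomputable def expostPay {n : ℕ} (z : (Fin n → ℝ) → Fin n → ℝ) (i : Fin n) (v : Fin n → ℝ) : ℝ :=
  myersonPay (fun s => z (Function.update v i s) i) (clampUnit (v i))

theorem measurable_clampUnit : Measurable clampUnit := monotone_clampUnit.measurable

section Weights

variable {n : ℕ} {ω : Fin n → ℝ → ℝ}

theorem otherWeight_nonneg (h0 : ∀ i v, 0 ≤ ω i v) (i : Fin n) (v : Fin n → ℝ) :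
    0 ≤ otherWeight ω i v := Finset.prod_nonneg fun j _ => h0 j (v j)

theorem otherWeight_le_one (h0 : ∀ i v, 0 ≤ ω i v) (h1 : ∀ i v, ω i v ≤ 1) (i : Fin n)
    (v : Fin n → ℝ) : otherWeight ω i v ≤ 1 :=
  Finset.prod_le_one (fun j _ => h0 j (v j)) fun j _ => h1 j (v j)

theorem measurable_otherWeight (hm : ∀ i, Measurable (ω i)) (i : Fin n) :
    Measurable (otherWeight ω i) :=
  Finset.measurable_prod _ fun j _ => (hm j).comp (measurable_pi_apply j)

theorem otherWeight_update (i : Fin n) (v : Fin n → ℝ) (t : ℝ) :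
    otherWeight ω i (Function.update v i t) = otherWeight ω i v :=
  Finset.prod_congr rfl fun j hj => by rw [Function.update_of_ne (Finset.ne_of_mem_erase hj)]

theorem mul_otherWeight (i : Fin n) (v : Fin n → ℝ) :
    ω i (v i) * otherWeight ω i v = ∏ j, ω j (v j) :=
  Finset.mul_prod_erase _ (fun j => ω j (v j)) (Finset.mem_univ i)

theorem one_sub_prod_le {ι : Type*} (s : Finset ι) {f : ι → ℝ} (h0 : ∀ i, 0 ≤ f i)
    (h1 : ∀ i, f i ≤ 1) : 1 - ∏ i ∈ s, f i ≤ ∑ i ∈ s, (1 - f i) := by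
  classical
  induction s using Finset.induction_on with
  | empty => simp
  | insert a s ha ih =>
    rw [Finset.prod_insert ha, Finset.sum_insert ha]
    have h2 : ∏ i ∈ s, f i ≤ 1 := Finset.prod_le_one (fun i _ => h0 i) fun i _ => h1 i
    have h3 : 0 ≤ ∏ i ∈ s, f i := Finset.prod_nonneg fun i _ => h0 i
    nlinarith [h0 a, h1 a]

theorem one_sub_otherWeight_le (h0 : ∀ i v, 0 ≤ ω i v) (h1 : ∀ i v, ω i v ≤ 1) (i : Fin n)
    (v : Fin n → ℝ) : 1 - otherWeight ω i v ≤ ∑ j, (1 - ω j (v j)) :=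
  (one_sub_prod_le _ (fun j => h0 j (v j)) fun j => h1 j (v j)).trans
    (Finset.sum_le_sum_of_subset_of_nonneg (Finset.erase_subset _ _)
      fun j _ _ => sub_nonneg.2 (h1 j (v j)))

end Weights

namespace MonotoneAlloc

variable {n : ℕ} {k : ℝ} {z : (Fin n → ℝ) → Fin n → ℝ}

theorem le (h : MonotoneAlloc k z) (v : Fin n → ℝ) (i : Fin n) : z v i ≤ k :=
  (Finset.single_le_sum (fun j _ => h.nonneg v j) (Finset.mem_univ i)).trans (h.sum_le v)

theorem abs_le (h : MonotoneAlloc k z) (v : Fin n → ℝ) (i : Fin n) : |z v i| ≤ k := by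
  rw [abs_of_nonneg (h.nonneg v i)]; exact h.le v i

theorem measurable_update (h : MonotoneAlloc k z) (i : Fin n) (t : ℝ) (j : Fin n) :
    Measurable fun v => z (Function.update v i t) j :=
  (h.meas j).comp (measurable_update_const i t)

theorem measurable_expostPay (h : MonotoneAlloc k z) (i : Fin n) :
    Measurable (expostPay z i) := by
  have e : expostPay z i = fun v => clampUnit (v i) * z (Function.update v i (clampUnit (v i))) i
      - ∫ s, {p : (Fin n → ℝ) × ℝ | 0 < p.2 ∧ p.2 ≤ clampUnit (p.1 i)}.indicator
        (fun p => z (Function.update p.1 i p.2) i) (v, s) := by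
    ext v
    rw [expostPay, myersonPay, intervalIntegral.integral_of_le (clampUnit_mem _).1,
      ← integral_indicator measurableSet_Ioc]
    rfl
  rw [e]
  have hc : Measurable fun v : Fin n → ℝ => clampUnit (v i) :=
    measurable_clampUnit.comp (measurable_pi_apply i)
  have hu := (h.meas i).comp (measurable_update_prod i)
  have hS : MeasurableSet {p : (Fin n → ℝ) × ℝ | 0 < p.2 ∧ p.2 ≤ clampUnit (p.1 i)} :=
    MeasurableSet.inter (measurableSet_lt measurable_const measurable_snd)
      (measurableSet_le measurable_snd (hc.comp measurable_fst))
  refine (hc.mul (hu.comp (measurable_id.prodMk hc))).sub ?_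
  exact ((hu.indicator hS).stronglyMeasurable.integral_prod_right').measurable

theorem expostPay_nonneg (h : MonotoneAlloc k z) (i : Fin n) (v : Fin n → ℝ) :
    0 ≤ expostPay z i v :=
  myersonPay_nonneg (h.mono v i) (fun _ => h.nonneg _ _) (fun _ => h.le _ _) (clampUnit_mem _)

theorem expostPay_le (h : MonotoneAlloc k z) (i : Fin n) (v : Fin n → ℝ) :
    expostPay z i v ≤ z (Function.update v i (clampUnit (v i))) i := by
  have h1 : 0 ≤ ∫ s in (0 : ℝ)..(clampUnit (v i)), z (Function.update v i s) i :=
    intervalIntegral.integral_nonneg (clampUnit_mem _).1 fun _ _ => h.nonneg _ _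
  have h2 := mul_le_of_le_one_left (h.nonneg (Function.update v i (clampUnit (v i))) i)
    (clampUnit_mem (v i)).2
  rw [expostPay, myersonPay]
  linarith

theorem abs_expostPay_le (h : MonotoneAlloc k z) (i : Fin n) (v : Fin n → ℝ) :
    |expostPay z i v| ≤ k := by
  rw [abs_of_nonneg (h.expostPay_nonneg i v)]
  exact (h.expostPay_le i v).trans (h.le _ _)

theorem interim_nonneg (h : MonotoneAlloc k z) (D : Fin n → Measure ℝ) {ω : Fin n → ℝ → ℝ}
    (h0 : ∀ i v, 0 ≤ ω i v) (i : Fin n) (t : ℝ) : 0 ≤ interim D ω z i t :=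
  integral_nonneg fun v => mul_nonneg (otherWeight_nonneg h0 i v) (h.nonneg _ _)

variable {D : Fin n → Measure ℝ} [∀ i, IsProbabilityMeasure (D i)] {ω : Fin n → ℝ → ℝ}

theorem integrable_interim (h : MonotoneAlloc k z) (hm : ∀ i, Measurable (ω i))
    (h0 : ∀ i v, 0 ≤ ω i v) (h1 : ∀ i v, ω i v ≤ 1) (i : Fin n) (t : ℝ) :
    Integrable (fun v => otherWeight ω i v * z (Function.update v i t) i) (Measure.pi D) :=
  integrable_pi_of_bound D ((measurable_otherWeight hm i).mul (h.measurable_update i t i)) (B := k)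
    fun v => by
      rw [abs_of_nonneg (mul_nonneg (otherWeight_nonneg h0 i v) (h.nonneg _ _))]
      exact (mul_le_of_le_one_left (h.nonneg _ _) (otherWeight_le_one h0 h1 i v)).trans (h.le _ _)

theorem interim_le (h : MonotoneAlloc k z) (hm : ∀ i, Measurable (ω i))
    (h0 : ∀ i v, 0 ≤ ω i v) (h1 : ∀ i v, ω i v ≤ 1) (i : Fin n) (t : ℝ) :
    interim D ω z i t ≤ k := by
  have := integral_mono (h.integrable_interim (D := D) hm h0 h1 i t) (integrable_const k) fun v =>
    (mul_le_of_le_one_left (h.nonneg _ _) (otherWeight_le_one h0 h1 i v)).trans (h.le _ _)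
  rw [integral_const, probReal_univ, one_smul] at this
  exact this

theorem interim_le_of_le (h : MonotoneAlloc k z) (hm : ∀ i, Measurable (ω i))
    (h0 : ∀ i v, 0 ≤ ω i v) (h1 : ∀ i v, ω i v ≤ 1) (i : Fin n) {s t : ℝ}
    (hst : ∀ v, z (Function.update v i s) i ≤ z (Function.update v i t) i) :
    interim D ω z i s ≤ interim D ω z i t :=
  integral_mono (h.integrable_interim (D := D) hm h0 h1 i s) (h.integrable_interim hm h0 h1 i t)
    fun v => mul_le_mul_of_nonneg_left (hst v) (otherWeight_nonneg h0 i v)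

theorem interim_mono (h : MonotoneAlloc k z) (hm : ∀ i, Measurable (ω i))
    (h0 : ∀ i v, 0 ≤ ω i v) (h1 : ∀ i v, ω i v ≤ 1) (i : Fin n) :
    Monotone (interim D ω z i) := fun _ _ hst =>
  h.interim_le_of_le hm h0 h1 i fun v => h.mono v i hst

theorem integral_mul_interim (h : MonotoneAlloc k z) (hm : ∀ i, Measurable (ω i))
    (h0 : ∀ i v, 0 ≤ ω i v) (h1 : ∀ i v, ω i v ≤ 1) (i : Fin n) {g : ℝ → ℝ} (hg : Measurable g)
    {B : ℝ} (hB : ∀ t, |g t| ≤ B) :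
    ∫ t, g t * interim D ω z i t ∂(D i)
      = ∫ v, otherWeight ω i v * (g (v i) * z v i) ∂(Measure.pi D) := by
  rw [integral_pi_eq_update' D i (f := fun v => otherWeight ω i v * (g (v i) * z v i))
    (B := 1 * (B * k))
    ((measurable_otherWeight hm i).mul ((hg.comp (measurable_pi_apply i)).mul (h.meas i)))]
  · refine integral_congr_ae (Filter.Eventually.of_forall fun t => ?_)
    simp only [interim]
    rw [← integral_const_mul]
    refine integral_congr_ae (Filter.Eventually.of_forall fun v => ?_)
    simp only [otherWeight_update, Function.update_self]
    ring
  · intro v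
    rw [abs_mul, abs_mul, abs_of_nonneg (otherWeight_nonneg h0 i v)]
    have hB0 : 0 ≤ B := (abs_nonneg _).trans (hB 0)
    exact mul_le_mul (otherWeight_le_one h0 h1 i v)
      (mul_le_mul (hB _) (h.abs_le v i) (abs_nonneg _) hB0)
      (mul_nonneg (abs_nonneg _) (abs_nonneg _)) zero_le_one

/-- Myerson's formula is linear in the allocation rule, so averaging over the other bidders commutes
with it; their weights do not involve coordinate i. -/
theorem integral_myersonPay_interim (h : MonotoneAlloc k z) (hm : ∀ i, Measurable (ω i))
    (h0 : ∀ i v, 0 ≤ ω i v) (h1 : ∀ i v, ω i v ≤ 1) (hD : ∀ i, D i (Set.Icc 0 1) = 1) (i : Fin n) :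
    ∫ t, myersonPay (interim D ω z i) t ∂(D i)
      = ∫ v, otherWeight ω i v * expostPay z i v ∂(Measure.pi D) := by
  have hk : 0 ≤ k := (h.nonneg 0 i).trans (h.le 0 i)
  rw [integral_pi_eq_update' D i (f := fun v => otherWeight ω i v * expostPay z i v) (B := 1 * k)
    ((measurable_otherWeight hm i).mul (h.measurable_expostPay i))]
  · refine integral_congr_ae ((ae_mem_Icc_of_measure_eq_one (hD i)).mono fun t ht => ?_)
    simp only [otherWeight_update]
    have e1 : ∀ v, otherWeight ω i v * expostPay z i (Function.update v i t)
        = t * (otherWeight ω i v * z (Function.update v i t) i)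
          - ∫ s in Set.Ioc 0 t, otherWeight ω i v * z (Function.update v i s) i := fun v => by
      rw [expostPay, myersonPay, Function.update_self, clampUnit_of_mem ht,
        intervalIntegral.integral_of_le ht.1, integral_const_mul]
      simp only [Function.update_idem]
      ring
    have hjoint : Integrable (fun p : (Fin n → ℝ) × ℝ =>
        otherWeight ω i p.1 * z (Function.update p.1 i p.2) i)
        ((Measure.pi D).prod (volume.restrict (Set.Ioc 0 t))) := by
      refine Integrable.of_bound (((measurable_otherWeight hm i).comp measurable_fst).mul
        ((h.meas i).comp (measurable_update_prod i))).aestronglyMeasurable k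
        (Filter.Eventually.of_forall fun p => ?_)
      rw [Real.norm_of_nonneg (mul_nonneg (otherWeight_nonneg h0 i _) (h.nonneg _ _))]
      exact (mul_le_of_le_one_left (h.nonneg _ _) (otherWeight_le_one h0 h1 i _)).trans (h.le _ _)
    simp only [e1]
    rw [integral_sub ((h.integrable_interim hm h0 h1 i t).const_mul t) hjoint.integral_prod_left,
      integral_const_mul, integral_integral_swap hjoint, myersonPay,
      intervalIntegral.integral_of_le ht.1]
    rfl
  · intro v
    rw [abs_mul, abs_of_nonneg (otherWeight_nonneg h0 i v)]
    exact mul_le_mul (otherWeight_le_one h0 h1 i v) (h.abs_expostPay_le i v) (abs_nonneg _)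
      zero_le_one

theorem sum_integral_interim_le (h : MonotoneAlloc k z) (hm : ∀ i, Measurable (ω i))
    (h0 : ∀ i v, 0 ≤ ω i v) (h1 : ∀ i v, ω i v ≤ 1) :
    ∑ i, ∫ t, interim D ω z i t ∂(D i) ≤ k := by
  have hi : ∀ i, Integrable (fun v => otherWeight ω i v * (1 * z v i)) (Measure.pi D) := fun i =>
    integrable_pi_of_bound D ((measurable_otherWeight hm i).mul (measurable_const.mul (h.meas i)))
      (B := k) fun v => by
        rw [one_mul, abs_of_nonneg (mul_nonneg (otherWeight_nonneg h0 i v) (h.nonneg _ _))]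
        exact (mul_le_of_le_one_left (h.nonneg _ _) (otherWeight_le_one h0 h1 i _)).trans (h.le _ _)
  have e : ∀ i, ∫ t, interim D ω z i t ∂(D i)
      = ∫ v, otherWeight ω i v * (1 * z v i) ∂(Measure.pi D) := fun i => by
    rw [← h.integral_mul_interim hm h0 h1 i (g := fun _ => 1) measurable_const (B := 1) (by simp)]
    simp only [one_mul]
  simp only [e]
  rw [← integral_finsetSum _ fun i _ => hi i]
  have := integral_mono (integrable_finsetSum _ fun i _ => hi i) (integrable_const k) fun v =>
    (Finset.sum_le_sum fun i _ => by
      rw [one_mul]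
      exact mul_le_of_le_one_left (h.nonneg v i) (otherWeight_le_one h0 h1 i v)).trans (h.sum_le v)
  simpa using this

theorem integral_expostPay_ge (h : MonotoneAlloc k z) (hm : ∀ i, Measurable (ω i))
    (h0 : ∀ i v, 0 ≤ ω i v) (h1 : ∀ i v, ω i v ≤ 1) (hD : ∀ i, D i (Set.Icc 0 1) = 1) (i : Fin n) :
    ∫ t, myersonPay (interim D ω z i) t ∂(D i) ≤ ∫ v, expostPay z i v ∂(Measure.pi D) := by
  rw [h.integral_myersonPay_interim hm h0 h1 hD i]
  refine integral_mono (integrable_pi_of_bound D ((measurable_otherWeight hm i).mul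
    (h.measurable_expostPay i)) (B := k) fun v => ?_)
    (integrable_pi_of_bound D (h.measurable_expostPay i) (h.abs_expostPay_le i)) fun v =>
    mul_le_of_le_one_left (h.expostPay_nonneg i v) (otherWeight_le_one h0 h1 i v)
  rw [abs_mul, abs_of_nonneg (otherWeight_nonneg h0 i v)]
  exact (mul_le_of_le_one_left (abs_nonneg _) (otherWeight_le_one h0 h1 i v)).trans
    (h.abs_expostPay_le i v)

/-- The weights lose at most a fraction ∑ (1 - ω j) of each payment. Payments are bounded by
allocations, whose sum is at most k, so the loss is k times the removed mass with no further factor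
n. -/
theorem sum_integral_expostPay_le (h : MonotoneAlloc k z) (hm : ∀ i, Measurable (ω i))
    (h0 : ∀ i v, 0 ≤ ω i v) (h1 : ∀ i v, ω i v ≤ 1) (hD : ∀ i, D i (Set.Icc 0 1) = 1) :
    ∑ i, ∫ v, expostPay z i v ∂(Measure.pi D)
      ≤ ∑ i, ∫ t, myersonPay (interim D ω z i) t ∂(D i)
        + k * ∑ j, ∫ t, (1 - ω j t) ∂(D j) := by
  have hW : ∀ i, Integrable (fun v => otherWeight ω i v * expostPay z i v) (Measure.pi D) :=
    fun i => integrable_pi_of_bound D ((measurable_otherWeight hm i).mul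
      (h.measurable_expostPay i)) (B := k) fun v => by
        rw [abs_mul, abs_of_nonneg (otherWeight_nonneg h0 i v)]
        exact (mul_le_of_le_one_left (abs_nonneg _) (otherWeight_le_one h0 h1 i v)).trans
          (h.abs_expostPay_le i v)
  have hP : ∀ i, Integrable (expostPay z i) (Measure.pi D) :=
    fun i => integrable_pi_of_bound D (h.measurable_expostPay i) (h.abs_expostPay_le i)
  have hω1 : ∀ j, Integrable (fun v : Fin n → ℝ => 1 - ω j (v j)) (Measure.pi D) := fun j =>
    integrable_pi_of_bound D (measurable_const.sub ((hm j).comp (measurable_pi_apply j))) (B := 1)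
      fun v => by rw [abs_of_nonneg (sub_nonneg.2 (h1 _ _))]; linarith [h0 j (v j)]
  have e : ∀ j, ∫ t, (1 - ω j t) ∂(D j) = ∫ v, (1 - ω j (v j)) ∂(Measure.pi D) := fun j => by
    conv_lhs => rw [← (measurePreserving_eval D j).map_eq]
    exact integral_map (measurable_pi_apply j).aemeasurable
      (measurable_const.sub (hm j)).aestronglyMeasurable
  simp only [e, h.integral_myersonPay_interim hm h0 h1 hD]
  rw [← integral_finsetSum _ fun i _ => hP i, ← integral_finsetSum _ fun i _ => hW i,
    ← integral_finsetSum _ fun i _ => hω1 i, ← integral_const_mul,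
    ← integral_add (integrable_finsetSum _ fun i _ => hW i)
      ((integrable_finsetSum _ fun i _ => hω1 i).const_mul k)]
  refine integral_mono_ae (integrable_finsetSum _ fun i _ => hP i)
    ((integrable_finsetSum _ fun i _ => hW i).add
      ((integrable_finsetSum _ fun i _ => hω1 i).const_mul k))
    ((ae_mem_valueProfiles D hD).mono fun v hv => ?_)
  set s := ∑ j, (1 - ω j (v j)) with hs
  have hs0 : 0 ≤ s := Finset.sum_nonneg fun j _ => sub_nonneg.2 (h1 _ _)
  have h2 : ∀ i, expostPay z i v ≤ otherWeight ω i v * expostPay z i v + s * z v i := fun i => by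
    have h3 := mul_le_mul_of_nonneg_right (one_sub_otherWeight_le h0 h1 i v)
      (h.expostPay_nonneg i v)
    have h4 := h.expostPay_le i v
    rw [clampUnit_of_mem (hv i), Function.update_eq_self] at h4
    have h5 := mul_le_mul_of_nonneg_left h4 hs0
    linarith
  calc ∑ i, expostPay z i v ≤ ∑ i, (otherWeight ω i v * expostPay z i v + s * z v i) :=
        Finset.sum_le_sum fun i _ => h2 i
    _ = ∑ i, otherWeight ω i v * expostPay z i v + s * ∑ i, z v i := by
      rw [Finset.sum_add_distrib, Finset.mul_sum]
    _ ≤ ∑ i, otherWeight ω i v * expostPay z i v + k * s := by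
      have := mul_le_mul_of_nonneg_left (h.sum_le v) hs0
      linarith

end MonotoneAlloc


/-! ### Welfare maximizers and truthful auctions -/

section Welfare

variable {n : ℕ} {X : Set (Fin n → ℝ)} {a : (Fin n → ℝ) → Fin n → ℝ}

theorem sum_update_mul (w x : Fin n → ℝ) (i : Fin n) (t : ℝ) :
    ∑ j, Function.update w i t j * x j = t * x i + ∑ j ∈ Finset.univ.erase i, w j * x j := by
  rw [← Finset.add_sum_erase _ _ (Finset.mem_univ i), Function.update_self]
  congr 1
  exact Finset.sum_congr rfl fun j hj => by
    rw [Function.update_of_ne (Finset.ne_of_mem_erase hj)]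

/-- Add the optimality of each of the two allocations against the other; all terms except those of
bidder i cancel. -/
theorem IsWelfareMaximizer.mono (ha : IsWelfareMaximizer X a) (w : Fin n → ℝ) (i : Fin n) {s t : ℝ}
    (hst : s ≤ t) : a (Function.update w i s) i ≤ a (Function.update w i t) i := by
  rcases hst.eq_or_lt with h | h
  · rw [h]
  have h1 := (ha (Function.update w i s)).2 _ (ha (Function.update w i t)).1
  have h2 := (ha (Function.update w i t)).2 _ (ha (Function.update w i s)).1
  rw [sum_update_mul, sum_update_mul] at h1 h2
  have h3 : 0 ≤ (t - s) * (a (Function.update w i t) i - a (Function.update w i s) i) := by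
    linarith
  exact sub_nonneg.1 ((mul_nonneg_iff_of_pos_left (sub_pos.2 h)).1 h3)

/-- The allocation rule that applies `a` to the virtual values `φ i (v i)`. -/
def virtualAlloc (φ : Fin n → ℝ → ℝ) (a : (Fin n → ℝ) → Fin n → ℝ) (v : Fin n → ℝ) : Fin n → ℝ :=
  a fun i => φ i (v i)

theorem apply_update_eq (φ : Fin n → ℝ → ℝ) (v : Fin n → ℝ) (i : Fin n) (t : ℝ) :
    (fun j => φ j (Function.update v i t j))
      = Function.update (fun j => φ j (v j)) i (φ i t) := by
  ext j
  by_cases h : j = i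
  · subst h; simp
  · simp [Function.update_of_ne h]

/-- As `a` need not be measurable, the rule is realized as an image of a simple function. -/
theorem measurable_virtualAlloc {φ : Fin n → ℝ → ℝ} (hm : ∀ i, Measurable (φ i))
    (hfin : ∀ i, (Set.range (φ i)).Finite) (a : (Fin n → ℝ) → Fin n → ℝ) :
    Measurable (virtualAlloc φ a) := by
  have hg : Measurable fun v : Fin n → ℝ => fun i => φ i (v i) :=
    measurable_pi_lambda _ fun i => (hm i).comp (measurable_pi_apply i)
  have hr : (Set.range fun v : Fin n → ℝ => fun i => φ i (v i)).Finite := by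
    refine (Set.Finite.pi' hfin).subset ?_
    rintro _ ⟨v, rfl⟩ i
    exact ⟨v i, rfl⟩
  let g : SimpleFunc (Fin n → ℝ) (Fin n → ℝ) :=
    ⟨fun v i => φ i (v i), fun x => hg (measurableSet_singleton x), hr⟩
  exact (g.map a).measurable

theorem monotoneAlloc_virtualAlloc (ha : IsWelfareMaximizer X a) (hX : ∀ x ∈ X, ∀ i, 0 ≤ x i)
    {k : ℝ} (hk : ∀ x ∈ X, ∑ i, x i ≤ k) {φ : Fin n → ℝ → ℝ} (hm : ∀ i, Monotone (φ i))
    (h0 : ∀ i t, φ i 0 ≤ φ i t) (hfin : ∀ i, (Set.range (φ i)).Finite) :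
    MonotoneAlloc k (virtualAlloc φ a) where
  meas i := (measurable_pi_apply i).comp
    (measurable_virtualAlloc (fun i => (hm i).measurable) hfin a)
  nonneg v i := hX _ (ha _).1 i
  sum_le v := hk _ (ha _).1
  mono v i s t hst := by
    simp only [virtualAlloc, apply_update_eq]
    exact ha.mono _ i (hm i hst)
  zero_le v i t := by
    simp only [virtualAlloc, apply_update_eq]
    exact ha.mono _ i (h0 i t)

theorem clampUnit_zero : clampUnit 0 = 0 := clampUnit_of_mem (by simp)

theorem Auction.IsTruthful.alloc_le {M : Auction n} (hM : M.IsTruthful X) {v : Fin n → ℝ}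
    (hv : v ∈ valueProfiles n) (i : Fin n) {s t : ℝ} (hs : s ∈ Set.Icc (0 : ℝ) 1)
    (ht : t ∈ Set.Icc (0 : ℝ) 1) (hst : s ≤ t) :
    M.alloc (Function.update v i s) i ≤ M.alloc (Function.update v i t) i := by
  rcases hst.eq_or_lt with h | h
  · rw [h]
  have hmem : ∀ r ∈ Set.Icc (0 : ℝ) 1, Function.update v i r ∈ valueProfiles n := fun r hr j => by
    by_cases hj : j = i
    · subst hj; simpa using hr
    · simpa [Function.update_of_ne hj] using hv j
  have h1 := hM.incentive_compatible _ (hmem t ht) i s hs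
  have h2 := hM.incentive_compatible _ (hmem s hs) i t ht
  simp only [Function.update_idem, Function.update_self] at h1 h2
  have h3 : 0 ≤ (t - s) * (M.alloc (Function.update v i t) i - M.alloc (Function.update v i s) i) := by
    linarith
  exact sub_nonneg.1 ((mul_nonneg_iff_of_pos_left (sub_pos.2 h)).1 h3)

theorem clamp_mem_valueProfiles (v : Fin n → ℝ) :
    (fun i => clampUnit (v i)) ∈ valueProfiles n := fun i => clampUnit_mem (v i)

theorem clamp_eq_self {v : Fin n → ℝ} (hv : v ∈ valueProfiles n) :
    (fun i => clampUnit (v i)) = v := funext fun i => clampUnit_of_mem (hv i)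

theorem update_mem_valueProfiles {v : Fin n → ℝ} (hv : v ∈ valueProfiles n) (i : Fin n) {t : ℝ}
    (ht : t ∈ Set.Icc (0 : ℝ) 1) : Function.update v i t ∈ valueProfiles n := fun j => by
  by_cases hj : j = i
  · subst hj; simpa using ht
  · simpa [Function.update_of_ne hj] using hv j

theorem Auction.IsTruthful.monotoneAlloc {M : Auction n} (hM : M.IsTruthful X)
    (hX : ∀ x ∈ X, ∀ i, 0 ≤ x i) {k : ℝ} (hk : ∀ x ∈ X, ∑ i, x i ≤ k) :
    MonotoneAlloc k fun v => M.alloc fun i => clampUnit (v i) where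
  meas i := (measurable_pi_apply i).comp (hM.measurable_alloc.comp
    (measurable_pi_lambda _ fun j => measurable_clampUnit.comp (measurable_pi_apply j)))
  nonneg v i := hX _ (hM.feasible _ (clamp_mem_valueProfiles v)) i
  sum_le v := hk _ (hM.feasible _ (clamp_mem_valueProfiles v))
  mono v i s t hst := by
    have h := apply_update_eq (fun _ => clampUnit) v i
    simp only [h]
    exact hM.alloc_le (clamp_mem_valueProfiles v) i (clampUnit_mem s) (clampUnit_mem t)
      (monotone_clampUnit hst)
  zero_le v i t := by
    have h := apply_update_eq (fun _ => clampUnit) v i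
    simp only [h]
    refine hM.alloc_le (clamp_mem_valueProfiles v) i (clampUnit_mem 0) (clampUnit_mem t) ?_
    rw [clampUnit_zero]
    exact (clampUnit_mem t).1

/-- A function whose increments dominate those of a left-endpoint rule dominates the integral. -/
theorem integral_le_of_le_sub {g u : ℝ → ℝ} (hg : Monotone g) {b : ℝ} (hb : 0 ≤ b) (hu0 : 0 ≤ u 0)
    (hu : ∀ s t, 0 ≤ s → s ≤ t → t ≤ b → (t - s) * g s ≤ u t - u s) :
    ∫ t in (0 : ℝ)..b, g t ≤ u b := by
  have hint : ∀ s t, IntervalIntegrable g volume s t := fun s t => hg.intervalIntegrable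
  -- With r equal steps, the integral exceeds the left Riemann sum by at most (b/r)(g b - g 0),
  -- which tends to 0.
  have hstep : ∀ (r : ℕ), 0 < r → ∀ j : ℕ, j ≤ r →
      ∫ t in (0 : ℝ)..(b * j / r), g t ≤ u (b * j / r) + b / r * (g (b * j / r) - g 0) := by
    intro r hr j
    have hr0 : (0 : ℝ) < r := by exact_mod_cast hr
    induction j with
    | zero => intro _; simp [hu0]
    | succ j ih =>
      intro hj
      have ih := ih (by omega)
      set s := b * j / r with hs
      set t := b * ((j + 1 : ℕ) : ℝ) / r with ht
      have hts : t - s = b / r := by rw [hs, ht]; push_cast; field_simp; ring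
      have hbr : 0 ≤ b / r := by positivity
      have hs0 : 0 ≤ s := by rw [hs]; positivity
      have htb : t ≤ b := by
        rw [ht, div_le_iff₀ hr0]
        exact mul_le_mul_of_nonneg_left (by exact_mod_cast hj) hb
      have h1 := hu s t hs0 (by linarith) htb
      have h2 : ∫ x in s..t, g x ≤ (t - s) * g t := by
        have := intervalIntegral.integral_mono_on (by linarith : s ≤ t) (hint s t)
          intervalIntegrable_const (g := fun _ => g t) fun x hx => hg hx.2
        simpa using this
      rw [← intervalIntegral.integral_add_adjacent_intervals (hint 0 s) (hint s t)]
      rw [hts] at h1 h2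
      linarith
  have hlim : Filter.Tendsto (fun r : ℕ => u b + b / r * (g b - g 0)) Filter.atTop
      (nhds (u b + 0 * (g b - g 0))) :=
    ((tendsto_const_div_atTop_nhds_zero_nat b).mul_const _).const_add _
  rw [zero_mul, add_zero] at hlim
  refine ge_of_tendsto hlim ?_
  filter_upwards [Filter.eventually_gt_atTop 0] with r hr
  have hr0 : (r : ℝ) ≠ 0 := by exact_mod_cast hr.ne'
  have := hstep r hr r le_rfl
  rwa [mul_div_cancel_right₀ b hr0] at this

/-- Truthful utility starts nonnegative and grows at least at the rate of the allocation, so it is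
at least the integral of the allocation; what remains bounds the payment. -/
theorem Auction.IsTruthful.pay_le {M : Auction n} (hM : M.IsTruthful X)
    (hX : ∀ x ∈ X, ∀ i, 0 ≤ x i) {k : ℝ} (hk : ∀ x ∈ X, ∑ i, x i ≤ k) {v : Fin n → ℝ}
    (hv : v ∈ valueProfiles n) (i : Fin n) :
    M.pay v i ≤ expostPay (fun v => M.alloc fun i => clampUnit (v i)) i v := by
  have hz := hM.monotoneAlloc hX hk
  set z : (Fin n → ℝ) → Fin n → ℝ := fun v => M.alloc fun i => clampUnit (v i)
  have hzv : ∀ t ∈ Set.Icc (0 : ℝ) 1, z (Function.update v i t) i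
      = M.alloc (Function.update v i t) i := fun t ht => by
    simp only [z, clamp_eq_self (update_mem_valueProfiles hv i ht)]
  have key := integral_le_of_le_sub (hz.mono v i) (hv i).1
    (u := fun t => t * M.alloc (Function.update v i t) i - M.pay (Function.update v i t) i)
    (by simpa using hM.individually_rational _ (update_mem_valueProfiles hv i (t := 0) (by simp)) i)
    fun s t hs hst htb => by
      have htI : t ∈ Set.Icc (0 : ℝ) 1 := ⟨hs.trans hst, htb.trans (hv i).2⟩
      have hsI : s ∈ Set.Icc (0 : ℝ) 1 := ⟨hs, hst.trans htI.2⟩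
      have h1 := hM.incentive_compatible _ (update_mem_valueProfiles hv i htI) i s hsI
      simp only [Function.update_idem, Function.update_self] at h1
      rw [hzv s hsI]
      linarith
  have h2 := hzv (v i) (hv i)
  simp only [Function.update_eq_self] at key h2
  rw [expostPay, myersonPay, clampUnit_of_mem (hv i), Function.update_eq_self, h2]
  linarith

end Welfare


/-! ### Comparing the optimal auction for the shaded distribution with other auctions -/

section Comparison

variable {n : ℕ} {X : Set (Fin n → ℝ)} {a : (Fin n → ℝ) → Fin n → ℝ} {k η σ : ℝ}
  {D E : Fin n → Measure ℝ} {φ : Fin n → ℝ → ℝ} {z : (Fin n → ℝ) → Fin n → ℝ}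

/-- Redraw the value of bidder j: with the others fixed, z is monotone in that value, and the
one-bidder estimate applies. -/
theorem ShadedPair.neg_part_mul_le [∀ i, IsProbabilityMeasure (D i)] {r : ℝ}
    (h : ∀ i, ShadedPair r η σ (D i) (E i) (φ i)) (hz : MonotoneAlloc k z) (i j : Fin n)
    (hij : j ≠ i) (t : ℝ) :
    ∫ v, max (-φ j (v j)) 0 * z (Function.update v i t) j ∂(Measure.pi D)
      ≤ 4 * ∫ v, z (Function.update v i t) j ∂(Measure.pi D) := by
  have hm : Measurable fun v : Fin n → ℝ => max (-φ j (v j)) 0 :=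
    (((h j).mono.measurable.comp (measurable_pi_apply j)).neg).max measurable_const
  have hu := hz.measurable_update i t j
  have hneg : ∀ s, |max (-φ j s) 0| ≤ |φ j 0| := fun s => by
    rw [abs_of_nonneg (le_max_right _ _)]
    have := (h j).neg_part_le le_rfl s
    simpa using this
  have hmu : Measurable fun v : Fin n → ℝ =>
      max (-φ j (v j)) 0 * z (Function.update v i t) j := hm.mul hu
  rw [integral_pi_eq_update D j hmu (B := |φ j 0| * k),
    integral_pi_eq_update D j hu fun v => hz.abs_le _ j, ← integral_const_mul]
  · have hI : ∀ f : (Fin n → ℝ) → ℝ, Measurable f → ∀ B, (∀ v, |f v| ≤ B) →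
        Integrable (fun v => ∫ s, f (Function.update v j s) ∂(D j)) (Measure.pi D) :=
      fun f hf B hB => by
        have : Integrable (fun p : (Fin n → ℝ) × ℝ => f (Function.update p.1 j p.2))
            ((Measure.pi D).prod (D j)) :=
          Integrable.of_bound (hf.comp (measurable_update_prod j)).aestronglyMeasurable B
            (Filter.Eventually.of_forall fun p => hB _)
        exact this.integral_prod_left
    refine integral_mono (hI _ hmu (|φ j 0| * k) fun v => ?_)
      ((hI _ hu k fun v => hz.abs_le _ j).const_mul 4) fun v => ?_
    · rw [abs_mul]
      exact mul_le_mul (hneg _) (hz.abs_le _ j) (abs_nonneg _) (abs_nonneg _)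
    · simp only [Function.update_self, Function.update_comm hij]
      exact (h j).integral_neg_part_mul_le (hz.mono (Function.update v i t) j)
        (fun _ => hz.nonneg _ _) fun _ => hz.le _ _
  · intro v
    rw [abs_mul]
    exact mul_le_mul (hneg _) (hz.abs_le _ j) (abs_nonneg _) (abs_nonneg _)

/-- The optimality of the allocation `a` bounds the interim allocation at negative virtual values. -/
theorem ShadedPair.neg_mul_interim_sub_le [∀ i, IsProbabilityMeasure (D i)] {r : ℝ}
    (h : ∀ i, ShadedPair r η σ (D i) (E i) (φ i)) (ha : IsWelfareMaximizer X a)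
    (hx : MonotoneAlloc k (virtualAlloc φ a)) (hz : MonotoneAlloc k z) (hzX : ∀ v, z v ∈ X)
    {ω : Fin n → ℝ → ℝ} (hm : ∀ i, Measurable (ω i)) (h0 : ∀ i v, 0 ≤ ω i v)
    (h1 : ∀ i v, ω i v ≤ 1) (i : Fin n) (s t : ℝ) :
    -φ i t * (interim D ω (virtualAlloc φ a) i t - interim D ω z i s) ≤ 5 * k := by
  set x := virtualAlloc φ a with hxdef
  set H : (Fin n → ℝ) → ℝ := fun v => k + ∑ j ∈ Finset.univ.erase i,
    max (-φ j (v j)) 0 * z (Function.update v i s) j with hH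
  have hterm : ∀ v j, 0 ≤ max (-φ j (v j)) 0 * z (Function.update v i s) j := fun v j =>
    mul_nonneg (le_max_right _ _) (hz.nonneg _ _)
  have hk : 0 ≤ k := (hz.nonneg 0 i).trans (hz.le 0 i)
  have hH0 : ∀ v, 0 ≤ H v := fun v => add_nonneg hk (Finset.sum_nonneg fun j _ => hterm v j)
  -- Optimality of x at type t is tested against the allocation of z at type s. Since virtual values
  -- are at most 1, the others' gain is at most k plus what z loses on their negative virtual
  -- values.
  have hpt : ∀ v, -φ i t * (x (Function.update v i t) i - z (Function.update v i s) i) ≤ H v := by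
    intro v
    have hopt := (ha fun j => φ j (Function.update v i t j)).2 _ (hzX (Function.update v i s))
    have hxe : a (fun j => φ j (Function.update v i t j)) = x (Function.update v i t) := rfl
    have hup : ∀ j, φ j (Function.update v i t j)
        = Function.update (fun j => φ j (v j)) i (φ i t) j := congrFun (apply_update_eq φ v i t)
    rw [hxe] at hopt
    simp only [hup] at hopt
    rw [sum_update_mul, sum_update_mul] at hopt
    have hsum : ∑ j ∈ Finset.univ.erase i, φ j (v j) * x (Function.update v i t) j
        - ∑ j ∈ Finset.univ.erase i, φ j (v j) * z (Function.update v i s) j ≤ H v := by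
      rw [← Finset.sum_sub_distrib]
      have hle : ∀ j ∈ Finset.univ.erase i, φ j (v j) * x (Function.update v i t) j
          - φ j (v j) * z (Function.update v i s) j ≤ x (Function.update v i t) j
            + max (-φ j (v j)) 0 * z (Function.update v i s) j := fun j _ => by
        have b1 := mul_le_mul_of_nonneg_right ((h j).le_one (v j))
          (hx.nonneg (Function.update v i t) j)
        have b2 := mul_le_mul_of_nonneg_right (le_max_left (-φ j (v j)) 0)
          (hz.nonneg (Function.update v i s) j)
        linarith
      refine (Finset.sum_le_sum hle).trans ?_
      rw [Finset.sum_add_distrib]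
      refine add_le_add ?_ le_rfl
      exact (Finset.sum_le_sum_of_subset_of_nonneg (Finset.erase_subset _ _)
        fun j _ _ => hx.nonneg _ j).trans (hx.sum_le _)
    linarith
  have hint : ∀ j, Integrable (fun v => max (-φ j (v j)) 0 * z (Function.update v i s) j)
      (Measure.pi D) := fun j => by
    refine integrable_pi_of_bound D (((((h j).mono.measurable.comp
      (measurable_pi_apply j)).neg).max measurable_const).mul (hz.measurable_update i s j))
      (B := |φ j 0| * k) fun v => ?_
    rw [abs_mul, abs_of_nonneg (le_max_right _ _)]
    have := (h j).neg_part_le le_rfl (v j)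
    exact mul_le_mul (by simpa using this) (hz.abs_le _ j) (abs_nonneg _) (abs_nonneg _)
  have hHi : Integrable H (Measure.pi D) :=
    (integrable_const k).add (integrable_finsetSum _ fun j _ => hint j)
  have hzi : ∀ j, Integrable (fun v => z (Function.update v i s) j) (Measure.pi D) := fun j =>
    integrable_pi_of_bound D (hz.measurable_update i s j) fun v => hz.abs_le _ j
  -- One k from the allocations of x, and 4k from the negative virtual values under z.
  have hHle : ∫ v, H v ∂(Measure.pi D) ≤ 5 * k := by
    have e1 : ∫ v, H v ∂(Measure.pi D) = k + ∑ j ∈ Finset.univ.erase i,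
        ∫ v, max (-φ j (v j)) 0 * z (Function.update v i s) j ∂(Measure.pi D) := by
      simp only [hH]
      rw [integral_add (integrable_const k) (integrable_finsetSum _ fun j _ => hint j),
        integral_finsetSum _ fun j _ => hint j]
      simp
    have e2 : ∑ j ∈ Finset.univ.erase i, ∫ v, z (Function.update v i s) j ∂(Measure.pi D) ≤ k := by
      rw [← integral_finsetSum _ fun j _ => hzi j]
      have := integral_mono (integrable_finsetSum (Finset.univ.erase i) fun j _ => hzi j)
        (integrable_const k) fun v => (Finset.sum_le_sum_of_subset_of_nonneg
          (Finset.erase_subset i Finset.univ) fun j _ _ => hz.nonneg _ j).trans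
          (hz.sum_le (Function.update v i s))
      simpa using this
    have e3 := Finset.sum_le_sum fun j (hj : j ∈ Finset.univ.erase i) =>
      ShadedPair.neg_part_mul_le h hz i j (Finset.ne_of_mem_erase hj) s
    rw [← Finset.mul_sum] at e3
    linarith
  refine le_trans ?_ hHle
  have i1 := hx.integrable_interim (D := D) hm h0 h1 i t
  have i2 := hz.integrable_interim (D := D) hm h0 h1 i s
  rw [interim, interim, ← integral_sub i1 i2, ← integral_const_mul]
  -- Since H is nonnegative, weights at most 1 can only decrease it; hence H is averaged under the
  -- untrimmed law.
  refine integral_mono ((i1.sub i2).const_mul _) hHi fun v => ?_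
  have hW0 := otherWeight_nonneg h0 i v
  have hW1 := otherWeight_le_one h0 h1 i v
  have b1 := mul_le_mul_of_nonneg_left (hpt v) hW0
  have b2 := mul_le_of_le_one_left (hH0 v) hW1
  simp only []
  linarith

/-- The weight of bidder i times that of the others is the same product for every i. The sum is thus
one integral of this product times the pointwise welfare gap, nonnegative by optimality. -/
theorem ShadedPair.sum_integral_mul_interim_sub_nonneg [∀ i, IsProbabilityMeasure (D i)] {r : ℝ}
    (h : ∀ i, ShadedPair r η σ (D i) (E i) (φ i)) (ha : IsWelfareMaximizer X a)
    (hx : MonotoneAlloc k (virtualAlloc φ a)) (hz : MonotoneAlloc k z) (hzX : ∀ v, z v ∈ X)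
    {ω : Fin n → ℝ → ℝ} (hm : ∀ i, Measurable (ω i)) (h0 : ∀ i v, 0 ≤ ω i v)
    (h1 : ∀ i v, ω i v ≤ 1) :
    0 ≤ ∑ i, ∫ t, ω i t * φ i t * (interim D ω (virtualAlloc φ a) i t - interim D ω z i t) ∂(D i) := by
  set x := virtualAlloc φ a with hxdef
  have hgm : ∀ i, Measurable fun t => ω i t * φ i t := fun i => (hm i).mul (h i).mono.measurable
  have hgb : ∀ i t, |ω i t * φ i t| ≤ |φ i 0| + 1 := fun i t => by
    rw [abs_mul, abs_of_nonneg (h0 i t)]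
    exact (mul_le_of_le_one_left (abs_nonneg _) (h1 i t)).trans ((h i).abs_le t)
  have hI : ∀ i {y : (Fin n → ℝ) → Fin n → ℝ}, MonotoneAlloc k y →
      Integrable (fun t => ω i t * φ i t * interim D ω y i t) (D i) := fun i y hy =>
    Integrable.of_bound ((hgm i).mul (hy.interim_mono hm h0 h1 i).measurable).aestronglyMeasurable
      ((|φ i 0| + 1) * k) (Filter.Eventually.of_forall fun t => by
        rw [norm_mul]
        refine mul_le_mul (hgb i t) ?_ (norm_nonneg _) (by positivity)
        rw [Real.norm_of_nonneg (hy.interim_nonneg D h0 i t)]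
        exact hy.interim_le hm h0 h1 i t)
  have hJ : ∀ i {y : (Fin n → ℝ) → Fin n → ℝ}, MonotoneAlloc k y →
      Integrable (fun v => otherWeight ω i v * (ω i (v i) * φ i (v i) * y v i)) (Measure.pi D) :=
    fun i y hy => integrable_pi_of_bound D ((measurable_otherWeight hm i).mul
      (((hgm i).comp (measurable_pi_apply i)).mul (hy.meas i))) (B := 1 * ((|φ i 0| + 1) * k))
      fun v => by
        rw [abs_mul, abs_mul (ω i (v i) * φ i (v i)), abs_of_nonneg (otherWeight_nonneg h0 i v)]
        exact mul_le_mul (otherWeight_le_one h0 h1 i v)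
          (mul_le_mul (hgb i _) (hy.abs_le v i) (abs_nonneg _) (by positivity))
          (by positivity) zero_le_one
  have e : ∀ i, ∫ t, ω i t * φ i t * (interim D ω x i t - interim D ω z i t) ∂(D i)
      = ∫ v, (otherWeight ω i v * (ω i (v i) * φ i (v i) * x v i)
        - otherWeight ω i v * (ω i (v i) * φ i (v i) * z v i)) ∂(Measure.pi D) := fun i => by
    rw [integral_sub (hJ i hx) (hJ i hz),
      ← hx.integral_mul_interim hm h0 h1 i (hgm i) (hgb i),
      ← hz.integral_mul_interim hm h0 h1 i (hgm i) (hgb i), ← integral_sub (hI i hx) (hI i hz)]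
    simp only [mul_sub]
  simp only [e]
  have hJs : ∀ i, Integrable (fun v => otherWeight ω i v * (ω i (v i) * φ i (v i) * x v i)
      - otherWeight ω i v * (ω i (v i) * φ i (v i) * z v i)) (Measure.pi D) :=
    fun i => (hJ i hx).sub (hJ i hz)
  rw [← integral_finsetSum _ fun i _ => hJs i]
  refine integral_nonneg fun v => ?_
  have hopt := (ha fun j => φ j (v j)).2 _ (hzX v)
  have hxe : a (fun j => φ j (v j)) = x v := rfl
  rw [hxe] at hopt
  have e2 : ∑ i, (otherWeight ω i v * (ω i (v i) * φ i (v i) * x v i)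
        - otherWeight ω i v * (ω i (v i) * φ i (v i) * z v i))
      = (∏ j, ω j (v j)) * (∑ i, φ i (v i) * x v i - ∑ i, φ i (v i) * z v i) := by
    rw [← Finset.sum_sub_distrib, Finset.mul_sum]
    refine Finset.sum_congr rfl fun i _ => ?_
    rw [← mul_otherWeight i v]
    ring
  simp only [Pi.zero_apply]
  rw [e2]
  exact mul_nonneg (Finset.prod_nonneg fun j _ => h0 j (v j)) (sub_nonneg.2 hopt)

/-- In units of kη the losses are 4 for weighting the competitor's revenue, 2 for bounding it by
virtual welfare under E, 9 + 9 for the truncated virtual values, 6 for their η/n terms and 12·5 = 60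
for the deep ones: 90 in all. -/
theorem ShadedPair.sum_expostPay_le [∀ i, IsProbabilityMeasure (D i)]
    (h : ∀ i, ShadedPair n η σ (D i) (E i) (φ i)) (hn : 0 < n) (ha : IsWelfareMaximizer X a)
    (hx : MonotoneAlloc k (virtualAlloc φ a)) (hz : MonotoneAlloc k z) (hzX : ∀ v, z v ∈ X)
    (hxφ : ∀ i v s t, φ i s = φ i t →
      virtualAlloc φ a (Function.update v i s) i = virtualAlloc φ a (Function.update v i t) i) :
    ∑ i, ∫ v, expostPay z i v ∂(Measure.pi D)
      ≤ ∑ i, ∫ v, expostPay (virtualAlloc φ a) i v ∂(Measure.pi D) + 90 * (k * η) := by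
  set x := virtualAlloc φ a with hxdef
  have hnr : (0 : ℝ) < n := by exact_mod_cast hn
  have hT : (0 : ℝ) < 2 * n := by linarith
  have hk : 0 ≤ k := (hz.nonneg 0 ⟨0, hn⟩).trans (hz.le 0 ⟨0, hn⟩)
  have hη : 0 ≤ η := (h ⟨0, hn⟩).η_nonneg
  have hD : ∀ i, D i (Set.Icc 0 1) = 1 := fun i => (h i).supp
  set ω : Fin n → ℝ → ℝ := fun i => trimDensity (2 * n) σ (D i) (φ i) with hω
  have hm : ∀ i, Measurable (ω i) := fun i => measurable_trimDensity _ _ _ (h i).mono.measurable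
  have h0 : ∀ i v, 0 ≤ ω i v := fun i v => (trimDensity_pos hT _ _ _ _).le
  have h1 : ∀ i v, ω i v ≤ 1 := fun i v => trimDensity_le_one hT _ _ _ _
  set y : Fin n → ℝ → ℝ := fun i => interim D ω x i with hy
  set y' : Fin n → ℝ → ℝ := fun i => interim D ω z i with hy'
  have ym := fun i => hx.interim_mono (D := D) hm h0 h1 i
  have ym' := fun i => hz.interim_mono (D := D) hm h0 h1 i
  have y0 := fun i => hx.interim_nonneg D h0 i
  have y0' := fun i => hz.interim_nonneg D h0 i
  have yk := fun i => hx.interim_le (D := D) hm h0 h1 i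
  have yk' := fun i => hz.interim_le (D := D) hm h0 h1 i
  have hsumc : ∀ c : ℝ, ∑ _i : Fin n, η / n * c = η * c := fun c => by
    rw [Finset.sum_const, Finset.card_univ, Fintype.card_fin, nsmul_eq_mul]
    field_simp
  have s1 : ∑ i, ∫ v, expostPay z i v ∂(Measure.pi D)
      ≤ ∑ i, ∫ t, myersonPay (y' i) t ∂(D i) + 4 * (k * η) := by
    refine (hz.sum_integral_expostPay_le hm h0 h1 hD).trans (add_le_add le_rfl ?_)
    have b1 : ∑ j, ∫ t, (1 - ω j t) ∂(D j) ≤ ∑ _j : Fin n, η / n * 4 :=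
      Finset.sum_le_sum fun j _ => by
        have := (h j).integral_one_sub_trimDensity_le'
        linarith
    rw [hsumc] at b1
    have := mul_le_mul_of_nonneg_left b1 hk
    linarith
  have s2 : ∑ i, ∫ t, myersonPay (y i) t ∂(D i) ≤ ∑ i, ∫ v, expostPay x i v ∂(Measure.pi D) :=
    Finset.sum_le_sum fun i _ => hx.integral_expostPay_ge hm h0 h1 hD i
  have m1 : ∑ i, ∫ t, y i t ∂(D i) ≤ k := hx.sum_integral_interim_le hm h0 h1
  have m2 : ∑ i, ∫ t, y' i t ∂(D i) ≤ k := hz.sum_integral_interim_le hm h0 h1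
  have m3 : η * ∑ i, ∫ t, y i t ∂(D i) ≤ η * k := mul_le_mul_of_nonneg_left m1 hη
  have m4 : η * ∑ i, ∫ t, y' i t ∂(D i) ≤ η * k := mul_le_mul_of_nonneg_left m2 hη
  have s3 : ∑ i, ∫ t, myersonPay (y' i) t ∂(D i)
      ≤ ∑ i, ∫ t, φ i t * y' i t ∂(E i) + η * ∑ i, ∫ t, y' i t ∂(D i) + η * k := by
    have := Finset.sum_le_sum fun i (_ : i ∈ Finset.univ) =>
      (h i).integral_myersonPay_le (ym' i) (y0' i) (yk' i)
    rw [Finset.sum_add_distrib, Finset.sum_add_distrib, hsumc, ← Finset.mul_sum] at this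
    exact this
  have s4 : ∑ i, ∫ t, φ i t * y i t ∂(E i) ≤ ∑ i, ∫ t, myersonPay (y i) t ∂(D i) :=
    Finset.sum_le_sum fun i _ => (h i).le_integral_myersonPay (ym i) (y0 i) (yk i) fun s t hst => by
      refine integral_congr_ae (Filter.Eventually.of_forall fun v => ?_)
      simp only [hxφ i v s t hst]
  have s5 : 0 ≤ ∑ i, ∫ t, ω i t * φ i t * (y i t - y' i t) ∂(D i) :=
    ShadedPair.sum_integral_mul_interim_sub_nonneg h ha hx hz hzX hm h0 h1
  have s6 := Finset.sum_le_sum fun i (_ : i ∈ Finset.univ) =>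
    (h i).integral_trimDensity_mul_le (ym i) (ym' i) (y0 i) (yk i) (y0' i) (yk' i)
      (fun t => hx.interim_le_of_le hm h0 h1 i fun v => hx.zero_le v i t)
      -- The two decay hypotheses come from optimality tested against x itself at type 0, and at
      -- type 0 against z, both with bound 5k.
      (fun t => hz.interim_le_of_le hm h0 h1 i fun v => hz.zero_le v i t)
      (by linarith : 0 ≤ 5 * k)
      (fun t _ => ShadedPair.neg_mul_interim_sub_le h ha hx hx (fun v => (ha _).1) hm h0 h1 i 0 t)
      (fun _ => ShadedPair.neg_mul_interim_sub_le h ha hx hz hzX hm h0 h1 i 0 0)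
  have e6 : ∀ i, ∫ t, φ i t * (y i t - y' i t) ∂(E i)
      = ∫ t, φ i t * y i t ∂(E i) - ∫ t, φ i t * y' i t ∂(E i) := fun i => by
    have := (h i).probE
    have hI : ∀ w : ℝ → ℝ, Monotone w → (∀ t, 0 ≤ w t) → (∀ t, w t ≤ k) →
        Integrable (fun t => φ i t * w t) (E i) := fun w hw hw0 hwk =>
      Integrable.of_bound ((h i).mono.measurable.mul hw.measurable).aestronglyMeasurable
        ((|φ i 0| + 1) * k) (Filter.Eventually.of_forall fun t => by
          rw [norm_mul, Real.norm_of_nonneg (hw0 t)]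
          exact mul_le_mul ((h i).abs_le t) (hwk t) (hw0 t) (by positivity))
    rw [← integral_sub (hI _ (ym i) (y0 i) (yk i)) (hI _ (ym' i) (y0' i) (yk' i))]
    simp only [mul_sub]
    rfl
  have e7 : ∑ i, (∫ t, φ i t * (y i t - y' i t) ∂(E i)
        + 9 * η * (∫ t, y i t ∂(D i) + ∫ t, y' i t ∂(D i)) + 6 * (η / n * k)
        + 12 * (5 * k) * (η / n))
      = ∑ i, ∫ t, φ i t * y i t ∂(E i) - ∑ i, ∫ t, φ i t * y' i t ∂(E i)
        + 9 * (η * ∑ i, ∫ t, y i t ∂(D i)) + 9 * (η * ∑ i, ∫ t, y' i t ∂(D i))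
        + 66 * (η * k) := by
    simp only [e6]
    rw [← hsumc k, ← Finset.sum_sub_distrib, Finset.mul_sum, Finset.mul_sum, Finset.mul_sum,
      Finset.mul_sum, Finset.mul_sum, ← Finset.sum_add_distrib, ← Finset.sum_add_distrib,
      ← Finset.sum_add_distrib]
    exact Finset.sum_congr rfl fun i _ => by ring
  have s7 := s5.trans (s6.trans_eq e7)
  linarith

theorem virtualAlloc_congr (v : Fin n → ℝ) (i : Fin n) {s t : ℝ} (hst : φ i s = φ i t) :
    virtualAlloc φ a (Function.update v i s) = virtualAlloc φ a (Function.update v i t) := by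
  simp only [virtualAlloc, apply_update_eq, hst]

/-- The revenue of Myerson's auction is that of Myerson's payment formula. -/
theorem revenue_myersonAuction [∀ i, IsProbabilityMeasure (D i)] {F : Fin n → ℝ → ℝ}
    (hD : ∀ i, D i (Set.Icc 0 1) = 1)
    (hx : MonotoneAlloc k (virtualAlloc (fun i v => ironedVirtualValue (F i) (clampUnit v)) a)) :
    (myersonAuction F a).revenue D = ∑ i, ∫ v, expostPay
      (virtualAlloc (fun i v => ironedVirtualValue (F i) (clampUnit v)) a) i v ∂(Measure.pi D) := by
  rw [← integral_finsetSum _ fun i _ => integrable_pi_of_bound D (hx.measurable_expostPay i)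
    (hx.abs_expostPay_le i), Auction.revenue]
  refine integral_congr_ae ((ae_mem_valueProfiles D hD).mono fun v hv => ?_)
  have hval : ∀ w ∈ valueProfiles n, myersonAlloc F a w
      = virtualAlloc (fun i v => ironedVirtualValue (F i) (clampUnit v)) a w := fun w hw => by
    rw [myersonAlloc, virtualAlloc]
    congr 1
    ext i
    rw [clampUnit_of_mem (hw i)]
  refine Finset.sum_congr rfl fun i _ => ?_
  simp only [myersonAuction, expostPay, myersonPay]
  rw [clampUnit_of_mem (hv i), Function.update_eq_self, hval v hv]
  congr 1
  refine intervalIntegral.integral_congr fun t ht => ?_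
  rw [Set.uIcc_of_le (hv i).1] at ht
  simp only [hval _ (update_mem_valueProfiles hv i ⟨ht.1, ht.2.trans (hv i).2⟩)]

theorem revenue_myersonAuction_nonneg [∀ i, IsProbabilityMeasure (D i)] {F : Fin n → ℝ → ℝ}
    (hD : ∀ i, D i (Set.Icc 0 1) = 1)
    (hx : MonotoneAlloc k (virtualAlloc (fun i v => ironedVirtualValue (F i) (clampUnit v)) a)) :
    0 ≤ (myersonAuction F a).revenue D := by
  rw [revenue_myersonAuction hD hx]
  exact Finset.sum_nonneg fun i _ => integral_nonneg (hx.expostPay_nonneg i)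

theorem Auction.IsTruthful.pay_le_alloc {M : Auction n} (hM : M.IsTruthful X)
    (hX : ∀ x ∈ X, ∀ i, 0 ≤ x i) {v : Fin n → ℝ} (hv : v ∈ valueProfiles n) (i : Fin n) :
    M.pay v i ≤ M.alloc v i := by
  have h1 := hM.individually_rational v hv i
  have h2 := mul_le_of_le_one_left (hX _ (hM.feasible v hv) i) (hv i).2
  linarith

theorem Auction.IsTruthful.integrable_pay [∀ i, IsProbabilityMeasure (D i)]
    (hD : ∀ i, D i (Set.Icc 0 1) = 1) {M : Auction n} (hM : M.IsTruthful X)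
    (hX : ∀ x ∈ X, ∀ i, 0 ≤ x i) (hk : ∀ x ∈ X, ∑ i, x i ≤ k) (i : Fin n) :
    Integrable (fun v => M.pay v i) (Measure.pi D) := by
  refine Integrable.of_bound ((measurable_pi_apply i).comp hM.measurable_pay).aestronglyMeasurable k
    ((ae_mem_valueProfiles D hD).mono fun v hv => ?_)
  rw [Real.norm_of_nonneg (hM.pay_nonneg v hv i)]
  have hf := hM.feasible v hv
  exact (hM.pay_le_alloc hX hv i).trans ((Finset.single_le_sum (fun j _ => hX _ hf j)
    (Finset.mem_univ i)).trans (hk _ hf))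

theorem Auction.IsTruthful.revenue_le_rank [∀ i, IsProbabilityMeasure (D i)]
    (hD : ∀ i, D i (Set.Icc 0 1) = 1) {M : Auction n} (hM : M.IsTruthful X)
    (hX : ∀ x ∈ X, ∀ i, 0 ≤ x i) (hk : ∀ x ∈ X, ∑ i, x i ≤ k) : M.revenue D ≤ k := by
  have := integral_mono_ae (integrable_finsetSum Finset.univ fun i _ =>
    hM.integrable_pay hD hX hk i) (integrable_const k)
    ((ae_mem_valueProfiles D hD).mono fun v hv =>
      (Finset.sum_le_sum fun i _ => hM.pay_le_alloc hX hv i).trans (hk _ (hM.feasible v hv)))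
  rw [integral_const, probReal_univ, one_smul] at this
  exact this

theorem Auction.IsTruthful.revenue_le_expostPay [∀ i, IsProbabilityMeasure (D i)]
    (hD : ∀ i, D i (Set.Icc 0 1) = 1) {M : Auction n} (hM : M.IsTruthful X)
    (hX : ∀ x ∈ X, ∀ i, 0 ≤ x i) (hk : ∀ x ∈ X, ∑ i, x i ≤ k) :
    M.revenue D ≤ ∑ i, ∫ v, expostPay (fun v => M.alloc fun i => clampUnit (v i)) i v
      ∂(Measure.pi D) := by
  have hz := hM.monotoneAlloc hX hk
  have hi := fun i => integrable_pi_of_bound D (hz.measurable_expostPay i) (hz.abs_expostPay_le i)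
  rw [← integral_finsetSum _ fun i _ => hi i, Auction.revenue]
  exact integral_mono_ae (integrable_finsetSum Finset.univ fun i _ =>
    hM.integrable_pay hD hX hk i) (integrable_finsetSum Finset.univ fun i _ => hi i)
    ((ae_mem_valueProfiles D hD).mono fun v hv =>
      Finset.sum_le_sum fun i _ => hM.pay_le hX hk hv i)

end Comparison


/-! ### The sample complexity of Myerson's auction for the dominated empirical distribution -/

theorem exists_sample_size_const {ρ : ℝ} (hρ : 1 < ρ) : ∃ C : ℝ, 0 < C ∧
    ∀ (n N : ℕ) (k ε δ : ℝ), 0 < n → 0 < k → 0 < ε → ρ * ε ≤ n * k → 0 < δ → δ < 1 →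
      C * (n * k ^ 2 / ε ^ 2) * Real.log (n * k / ε) * Real.log (n * k / (ε * δ)) ≤ N →
      0 < N ∧ 49 * n * (Real.log (2 * n * N / δ) / N) ≤ (ε / (90 * k)) ^ 2 := by
  have hl : 0 < Real.log ρ := Real.log_pos hρ
  have hK : 0 < Real.log (4 * 396900) := Real.log_pos (by norm_num)
  -- Here 396900 = 49 · 90². The lower bound log ρ on both logarithms absorbs the additive constant
  -- log(4 · 396900); the factor log(nk/ε) is used only through being at least log ρ.
  refine ⟨2 * 396900 * (2 + Real.log (4 * 396900) / Real.log ρ) / Real.log ρ, by positivity, ?_⟩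
  intro n N k ε δ hn hk hε hρε hδ hδ1 hN
  have hnr : (0 : ℝ) < n := by exact_mod_cast hn
  set l := Real.log ρ with hldef
  set L := Real.log (4 * 396900) with hL
  set Y : ℝ := n * k ^ 2 / ε ^ 2 with hY
  set A := Real.log (n * k / ε) with hA
  set B := Real.log (n * k / (ε * δ)) with hB
  have hY0 : 0 < Y := by positivity
  have hlA : l ≤ A := Real.log_le_log (by linarith) ((le_div_iff₀ hε).2 hρε)
  have hAB : A ≤ B := by
    refine Real.log_le_log (by positivity) ?_
    exact div_le_div_of_nonneg_left (by positivity) (by positivity)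
      (mul_le_of_le_one_right hε.le hδ1.le)
  have hlB : l ≤ B := hlA.trans hAB
  have hA0 : 0 < A := hl.trans_le hlA
  have hB0 : 0 < B := hl.trans_le hlB
  have hN0 : (0 : ℝ) < N := lt_of_lt_of_le (by positivity) hN
  refine ⟨by exact_mod_cast hN0, ?_⟩
  have hmain : L + 2 * B ≤ N / (2 * 396900 * Y) := by
    rw [le_div_iff₀ (by positivity)]
    refine le_trans ?_ hN
    have h1 : L + 2 * B ≤ (2 + L / l) * B := by
      have : L ≤ L / l * B := by
        rw [div_mul_eq_mul_div, le_div_iff₀ hl]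
        exact mul_le_mul_of_nonneg_left hlB hK.le
      linarith
    have h2 : (2 + L / l) * B ≤ (2 + L / l) * B * (A / l) :=
      le_mul_of_one_le_right (by positivity) ((one_le_div hl).2 hlA)
    calc (L + 2 * B) * (2 * 396900 * Y) ≤ (2 + L / l) * B * (A / l) * (2 * 396900 * Y) :=
          mul_le_mul_of_nonneg_right (h1.trans h2) (by positivity)
      _ = 2 * 396900 * (2 + L / l) / l * Y * A * B := by ring
  have hlog : Real.log (2 * n * N / δ) ≤ N / (396900 * Y) := by
    -- The N inside the logarithm is removed by log a ≤ a with a = N/(2 · 396900 Y), which uses half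
    -- of the budget; the other half pays for the remaining factors.
    have e : 2 * n * N / δ = N / (2 * 396900 * Y) * (4 * 396900 * (n * Y / δ)) := by
      field_simp
      norm_num
    have h1 : Real.log (N / (2 * 396900 * Y)) ≤ N / (2 * 396900 * Y) := by
      have := Real.log_le_sub_one_of_pos (show 0 < N / (2 * 396900 * Y) by positivity)
      linarith
    have h2 : Real.log (n * Y / δ) ≤ 2 * B := by
      have : 2 * B = Real.log ((n * k / (ε * δ)) ^ 2) := by rw [Real.log_pow]; norm_num [hB]
      rw [this]
      refine Real.log_le_log (by positivity) ?_
      have e2 : n * Y / δ = (n * k) ^ 2 / (ε ^ 2 * δ) := by rw [hY]; field_simp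
      rw [e2, div_pow, mul_pow ε δ]
      refine div_le_div_of_nonneg_left (by positivity) (by positivity) ?_
      exact mul_le_mul_of_nonneg_left (by nlinarith) (by positivity)
    have e3 : N / (396900 * Y) = N / (2 * 396900 * Y) + N / (2 * 396900 * Y) := by
      field_simp
      norm_num
    rw [e, Real.log_mul (by positivity) (by positivity),
      Real.log_mul (by norm_num) (by positivity), e3, ← hL]
    linarith
  calc 49 * n * (Real.log (2 * n * N / δ) / N) ≤ 49 * n * (N / (396900 * Y) / N) := by gcongr
    _ = (ε / (90 * k)) ^ 2 := by
      rw [hY]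
      field_simp
      norm_num

theorem mainTheorem11 (ρ : ℝ) (hρ : 1 < ρ) :
    ∃ C : ℝ, 0 < C ∧
      ∀ (n : ℕ) (X : Set (Fin n → ℝ)) (k d ε δ : ℝ) (D : Fin n → Measure ℝ) (N : ℕ),
        (∀ x ∈ X, ∀ i, 0 ≤ x i) →
        IsGreatest {s : ℝ | ∃ x ∈ X, ∑ i, x i = s} k →
        IsGreatest {s : ℝ | ∃ x ∈ X, ∃ i, x i = s} d →
        (∀ i, IsProbabilityMeasure (D i)) →
        (∀ i, D i (Set.Icc 0 1) = 1) →
        0 < ε → ρ * ε ≤ n * k →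
        0 < δ → δ < 1 →
        C * (n * k ^ 2 / ε ^ 2) * Real.log (n * k / ε) * Real.log (n * k / (ε * δ)) ≤ N →
        (Measure.pi fun _ : Fin N => Measure.pi D)
            {S | ∃ a, IsWelfareMaximizer X a ∧
              (myersonAuction (dominatedEmpiricalCDF δ S) a).revenue D < optRevenue X D - ε}
          ≤ ENNReal.ofReal δ := by
  obtain ⟨C, hC, hsize⟩ := exists_sample_size_const hρ
  refine ⟨C, hC, fun n X k d ε δ D N hX hkX _ hprob hD hε hρε hδ hδ1 hN => ?_⟩
  have hk : ∀ x ∈ X, ∑ i, x i ≤ k := fun x hx => hkX.2 ⟨x, hx, rfl⟩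
  have hk0 : 0 ≤ k := by
    obtain ⟨x, hx, rfl⟩ := hkX.1
    exact Finset.sum_nonneg fun i _ => hX x hx i
  have hnk : 0 < n * k := lt_of_lt_of_le (by positivity) hρε
  have hkpos : 0 < k := pos_of_mul_pos_right hnk (Nat.cast_nonneg n)
  have hnr : (0 : ℝ) < n := pos_of_mul_pos_left hnk hk0
  have hn : 0 < n := by exact_mod_cast hnr
  have hn1 : (1 : ℝ) ≤ n := by exact_mod_cast hn
  obtain ⟨hN0, hΛ⟩ := hsize n N k ε δ hn hkpos hε hρε hδ hδ1 hN
  have hNr : (0 : ℝ) < N := by exact_mod_cast hN0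
  have hN1 : (1 : ℝ) ≤ N := by exact_mod_cast hN0
  have hΛ0 : 0 < Real.log (2 * n * N / δ) / N := by
    refine div_pos (Real.log_pos ?_) hNr
    rw [lt_div_iff₀ hδ]
    nlinarith [mul_le_mul hn1 hN1 zero_le_one hnr.le]
  -- On good samples the revenue bound holds for every tie-breaking rule at once, so no union over
  -- rules is needed.
  refine (measure_mono fun S hS hgood => ?_).trans (measure_bad_samples_le hn hN0 D hD hδ hδ1)
  obtain ⟨hmem, hgood⟩ := hgood
  obtain ⟨a, ha, hlt⟩ := hS
  set φ : Fin n → ℝ → ℝ :=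
    fun i v => ironedVirtualValue (dominatedEmpiricalCDF δ S i) (clampUnit v) with hφ
  have hx : MonotoneAlloc k (virtualAlloc φ a) := by
    choose T m hT hcdf using fun i =>
      exists_isAtomicMass_dominatedEmpiricalCDF hN0 (fun j => hmem j i) hΛ0
    refine monotoneAlloc_virtualAlloc ha hX hk (fun i => ?_) (fun i => ?_) fun i => ?_
    · simp only [hφ, ← hcdf i]
      exact (hT i).monotone_virtualValue
    · simp only [hφ, ← hcdf i]
      exact (hT i).virtualValue_zero_le
    · simp only [hφ, ← hcdf i]
      exact (hT i).finite_range_virtualValue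
  have hrev0 := revenue_myersonAuction_nonneg hD hx
  refine absurd hlt (not_lt.2 ?_)
  rw [sub_le_iff_le_add]
  -- If there is no truthful auction, the supremum is 0 by convention; this case is covered by
  -- nonnegative revenue.
  refine Real.sSup_le ?_ (by linarith)
  rintro _ ⟨M, hM, rfl⟩
  -- If k < ε, every revenue is below ε and the claim is trivial; otherwise η = ε/(90k) ≤ 1, as the
  -- closeness estimates require.
  rcases lt_or_ge k ε with hkε | hkε
  · have := hM.revenue_le_rank hD hX hk
    linarith
  have hη1 : ε / (90 * k) ≤ 1 := by
    rw [div_le_one (by positivity)]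
    linarith
  choose E hE using fun i => (exists_shadedPair hN0 (fun j => hmem j i) hΛ0 (hD i) (hgood i)
    (by positivity) hη1 hn1 hΛ).2
  have hcmp := ShadedPair.sum_expostPay_le hE hn ha hx (hM.monotoneAlloc hX hk)
    (fun v => hM.feasible _ (clamp_mem_valueProfiles v))
    fun i v s t hst => congrFun (virtualAlloc_congr v i hst) i
  have hM' := hM.revenue_le_expostPay hD hX hk
  have hε' : 90 * (k * (ε / (90 * k))) = ε := by field_simp
  rw [revenue_myersonAuction hD hx]
  linarith
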